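/- Let $k\ge 3$ be odd. A random $k$-XOR instance $\Phi$ on $n$ variables with constraint probability $p\in[0,1]$ is sampled as follows: independently for each ordered tuple $S=(i_1,\dots,i_k)\in[n]^k$, with probability $p$ the constraint $x_{i_1}x_{i_2}\cdots x_{i_k}=\eta_S$ is added, with $\eta_S\in\{\pm1\}$ uniformly random and independent of everything else, and with probability $1-p$ no constraint is added. For $x\in\{\pm1\}^n$ let $P_\Phi(x)$ be the fraction of the constraints of $\Phi$ that $x$ satisfies, and call $p\,n^{k-1}$ (the expected value of $m/n$, where $m$ is the number of constraints) the clause density. Then there are a deterministic algorithm $A$ and a constant $C$ (both depending only on $k$) such that, given $n\ge 2$, a parameter $1\le d\le n$ and a $k$-XOR instance $\Phi$ on $n$ variables, $A$ runs in time at most $n^{Cd}$ and outputs a rational number $v(\Phi)=v_{n,d}(\Phi)$ with the following properties. (1) The output is always a valid upper bound: for every instance $\Phi$, $P_\Phi(x)\le v(\Phi)$ for all $x\in\{\pm1\}^n$. (2) For every constant $\gamma>0$ there is a constant $K$, depending only on $\gamma$ and $k$, such that for all sequences $d=d(n)\ge 1$ with $d=o(n)$ and all $p=p(n)\in[0,1]$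 whose clause density satisfies, for all sufficiently large $n$, $$p\,n^{k-1}\;\ge\;K(\log n)^{K}\left(\frac{n}{d}\right)^{(k-2)/2},$$ the random $k$-XOR instance $\Phi$ satisfies $\Pr\big[v(\Phi)\le \tfrac12+\gamma\big]\to1$ as $n\to\infty$. In other words, for $d\ll n$, $A$ certifies in time $n^{O(d)}$ and with high probability that a random $k$-XOR instance has value at most $\tfrac12+\gamma+o(1)$ for any constant $\gamma>0$, at every clause density $m/n\ge\tilde O\big(n^{(k-2)/2}/d^{(k-2)/2}\big)$, where the $\tilde O$ hides factors polylogarithmic in $n$ and a dependence on $\gamma$ and $k$. -/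

import Mathlib

open Filter Topology Asymptotics

namespace KXor

/-- A `k`-XOR formula on `n` variables: each ordered tuple `S ∈ [n]^k` either carries no constraint
(`none`) or the constraint `∏ i, x (S i) = η` with `η ∈ {1, -1}` (`some η`). -/
abbrev Formula (k n : ℕ) : Type := (Fin k → Fin n) → Option ℤˣ

/-- The tuples that carry a constraint of `Φ`. -/
def constraints {k n : ℕ} (Φ : Formula k n) : Finset (Fin k → Fin n) :=
  Finset.univ.filter fun S => (Φ S).isSome

/-- The tuples whose constraint is present and satisfied by the assignment `x ∈ {1, -1}^n`. -/
def satisfied {k n : ℕ} (Φ : Formula k n) (x : Fin n → ℤˣ) : Finset (Fin k → Fin n) :=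
  Finset.univ.filter fun S => Φ S = some (∏ i, x (S i))

/-- The fraction of the constraints of `Φ` that `x` satisfies (`0` if there is no constraint). -/
noncomputable def satFraction {k n : ℕ} (Φ : Formula k n) (x : Fin n → ℤˣ) : ℝ :=
  ((satisfied Φ x).card : ℝ) / ((constraints Φ).card : ℝ)

/-- Law of one slot: no constraint with probability `1 - p`; otherwise a constraint with a
uniformly random sign. -/
noncomputable def slotWeight (p : ℝ) : Option ℤˣ → ℝ
  | none => 1 - p
  | some _ => p / 2

/-- Probability of the formula `Φ` when the `n ^ k` slots are independent. -/
noncomputable def weight {k n : ℕ} (p : ℝ) (Φ : Formula k n) : ℝ :=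
  ∏ S : Fin k → Fin n, slotWeight p (Φ S)

/-- Probability of the event `E` for a random `k`-XOR formula on `n` variables with constraint
probability `p ∈ [0, 1]`. -/
noncomputable def prob {k n : ℕ} (p : ℝ) (E : Set (Formula k n)) : ℝ :=
  ∑ Φ : Formula k n, E.indicator (weight p) Φ

end KXor

namespace Ram

/-- State of a random access machine: registers and an indirectly addressed memory, both holding
natural numbers. -/
@[ext] structure State where
  reg : ℕ → ℕ
  mem : ℕ → ℕ

/-- Overwrite register `r`. -/
def State.setReg (s : State) (r v : ℕ) : State := { s with reg := Function.update s.reg r v }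

/-- Overwrite memory cell `a`. -/
def State.setMem (s : State) (a v : ℕ) : State := { s with mem := Function.update s.mem a v }

/-- Structured programs of a random access machine. Numerals in a program are constants of the
program text. There is no multiplication instruction, so that in `t` steps numbers can gain at
most `t + O(1)` bits, and unit cost is polynomially equivalent to Turing machine time. -/
inductive Prog : Type
  | const (r c : ℕ)
  | plus (r a b : ℕ)
  | monus (r a b : ℕ)
  | load (r a : ℕ)
  | store (a r : ℕ)
  | seq (P Q : Prog)
  | ite (r : ℕ) (P Q : Prog)
  | loop (r : ℕ) (P : Prog)

/-- `Exec P s t s'`: started in state `s`, the program `P` halts in state `s'` after exactly `t`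
steps. Every assignment, memory access and test of a register costs one step. -/
inductive Exec : Prog → State → ℕ → State → Prop
  /-- `R_r := c` -/
  | const (r c : ℕ) (s : State) : Exec (.const r c) s 1 (s.setReg r c)
  /-- `R_r := R_a + R_b` -/
  | plus (r a b : ℕ) (s : State) : Exec (.plus r a b) s 1 (s.setReg r (s.reg a + s.reg b))
  /-- `R_r := max (R_a - R_b) 0` -/
  | monus (r a b : ℕ) (s : State) : Exec (.monus r a b) s 1 (s.setReg r (s.reg a - s.reg b))
  /-- `R_r := M[R_a]` -/
  | load (r a : ℕ) (s : State) : Exec (.load r a) s 1 (s.setReg r (s.mem (s.reg a)))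
  /-- `M[R_a] := R_r` -/
  | store (a r : ℕ) (s : State) : Exec (.store a r) s 1 (s.setMem (s.reg a) (s.reg r))
  /-- `P; Q` -/
  | seq {P Q : Prog} {s s₁ s₂ : State} {t₁ t₂ : ℕ} (h₁ : Exec P s t₁ s₁) (h₂ : Exec Q s₁ t₂ s₂) :
      Exec (.seq P Q) s (t₁ + t₂) s₂
  /-- `if R_r ≠ 0 then P else Q` -/
  | iteTrue {r : ℕ} {P Q : Prog} {s s₁ : State} {t : ℕ} (hr : s.reg r ≠ 0)
      (h : Exec P s t s₁) : Exec (.ite r P Q) s (t + 1) s₁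
  | iteFalse {r : ℕ} {P Q : Prog} {s s₁ : State} {t : ℕ} (hr : s.reg r = 0)
      (h : Exec Q s t s₁) : Exec (.ite r P Q) s (t + 1) s₁
  /-- `while R_r ≠ 0 do P` -/
  | loopDone {r : ℕ} {P : Prog} {s : State} (hr : s.reg r = 0) : Exec (.loop r P) s 1 s
  | loopStep {r : ℕ} {P : Prog} {s s₁ s₂ : State} {t₁ t₂ : ℕ} (hr : s.reg r ≠ 0)
      (h₁ : Exec P s t₁ s₁) (h₂ : Exec (.loop r P) s₁ t₂ s₂) :
      Exec (.loop r P) s (t₁ + t₂ + 1) s₂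

/-- Execution is deterministic, so a program has at most one result and one running time. -/
theorem Exec.unique {P : Prog} {s s₁ : State} {t : ℕ} (h : Exec P s t s₁) :
    ∀ {t' : ℕ} {s₂ : State}, Exec P s t' s₂ → t = t' ∧ s₁ = s₂ := by
  induction h with
  | const | plus | monus | load | store => intro t' s₂ h'; cases h'; exact ⟨rfl, rfl⟩
  | seq _ _ ih₁ ih₂ =>
    intro t' s₂ h'
    cases h' with
    | seq g₁ g₂ =>
      obtain ⟨rfl, rfl⟩ := ih₁ g₁
      obtain ⟨rfl, rfl⟩ := ih₂ g₂
      exact ⟨rfl, rfl⟩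
  | iteTrue hr _ ih =>
    intro t' s₂ h'
    cases h' with
    | iteTrue _ g => obtain ⟨rfl, rfl⟩ := ih g; exact ⟨rfl, rfl⟩
    | iteFalse hr' _ => exact absurd hr' hr
  | iteFalse hr _ ih =>
    intro t' s₂ h'
    cases h' with
    | iteTrue hr' _ => exact absurd hr hr'
    | iteFalse _ g => obtain ⟨rfl, rfl⟩ := ih g; exact ⟨rfl, rfl⟩
  | loopDone hr =>
    intro t' s₂ h'
    cases h' with
    | loopDone _ => exact ⟨rfl, rfl⟩
    | loopStep hr' _ _ => exact absurd hr hr'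
  | loopStep hr _ _ ih₁ ih₂ =>
    intro t' s₂ h'
    cases h' with
    | loopDone hr' => exact absurd hr' hr
    | loopStep _ g₁ g₂ =>
      obtain ⟨rfl, rfl⟩ := ih₁ g₁
      obtain ⟨rfl, rfl⟩ := ih₂ g₂
      exact ⟨rfl, rfl⟩

/-- The rational number that a halted machine outputs: a numerator and a denominator. -/
def State.output (s : State) : ℚ := (s.reg 0 : ℚ) / (s.reg 1 : ℚ)

end Ram

namespace KXor

/-- Code of one slot of a formula: no constraint, right-hand side `1`, right-hand side `-1`. -/
def slotCode : Option ℤˣ → ℕ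
  | none => 0
  | some η => if η = 1 then 1 else 2

/-- Input state of the machine: `n` and `d` in the registers `0` and `1`; the table of `Φ` in the
memory cells below `n ^ k`, the slot `S` at the address `∑ i, S i * n ^ i`; zeros elsewhere. -/
def inputState {k n : ℕ} (d : ℕ) (Φ : Formula k n) : Ram.State where
  reg r := if r = 0 then n else if r = 1 then d else 0
  mem a := if h : a < n ^ k then slotCode (Φ (finFunctionFinEquiv.symm ⟨a, h⟩)) else 0

/-- The program `A` computes the number `v n d Φ` from every formula `Φ` on `n ≥ 2` variables and
every parameter `1 ≤ d ≤ n`, within `n ^ (C * d)` steps. -/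
def ComputesInTime {k : ℕ} (A : Ram.Prog) (C : ℕ) (v : (n d : ℕ) → Formula k n → ℚ) : Prop :=
  ∀ n d : ℕ, 2 ≤ n → 1 ≤ d → d ≤ n → ∀ Φ : Formula k n, ∃ (t : ℕ) (s : Ram.State),
    Ram.Exec A (inputState d Φ) t s ∧ t ≤ n ^ (C * d) ∧ s.output = v n d Φ

end KXor

/-! Write k = 2h + 1 and split each constraint into its first variable i and two h-tuples a, b.
Twice the number of satisfied constraints is m + F(x), where m counts the constraints and F(x) = Σ_i
x_i Σ_{a,b} η x_a x_b, so F ≤ 2γm has to be certified. Cauchy–Schwarz over i removes the odd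
variable: F² ≤ n Σ_i (Σ_{a,b} η x_a x_b)², which is n times m plus a sum over ordered pairs of
distinct constraints with the same first variable.

This sum is the quadratic form of a Kikuchi matrix (`mat`) up to a known factor. A vertex consists
of a bit and two tapes, each made of h blocks of B variables. An edge takes two constraints with a
common first variable and on each tape replaces one half of its constraint by the other half. On the
vector of values x_s x_s' the edge contributes exactly the product of the two constraint terms, and
every pair of constraints occurs on equally many edges. Edges at vertices with more than τ half
edges of the same index are pruned, and the cost of pruning is counted in `lost`. The largest
eigenvalue of what remains is at most θ if the trace of the 2L-th power is at most θ^(2L). Hence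
numbers B, L, τ, θ with two checkable inequalities (`Certifies`) bound the value of every instance
(`satFraction_le_of_certifies`).

For a random instance let w = p B^h n^h, the expected number of half edges per index and tape.
Degrees are O(n w²) up to a lower-order term (`pr_exists_lt_deg`), and few edges are pruned
(`ex_lost_le`, Markov). Averaging the trace over the signs kills every walk that reads some
constraint exactly once. In a surviving walk at most half of the 2L steps use a new index. A
repeated index leaves at most β = 4Lτ² choices thanks to the pruning, against α for a new one, where
α bounds the degrees. So the trace is at most |Vert| (4αβ)^L (`abs_avg_walk_le`, `avg_trace_le`).
With L above log |Vert| ≈ B log n the largest eigenvalue is O(√(αβ)), which is small compared with n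
w² once Lτ² is. For B ≈ d / log⁵ n this is what the density hypothesis provides
(`mul_le_of_density`, `walk_bound`, `exists_params`).

The algorithm tries all parameters in a range of size n^{O(d)} and outputs 1/2 + g/(2n) for the
least certified g. A matrix power counts positive minus negative walks (`mat_pow_code`), so dynamic
programming over walk lengths with natural numbers replaces linear algebra. The time bound comes
from closure properties of `Computes` and the table construction `exists_prog_table`, combined in
`exists_prog_bound`. -/

namespace Ram

/-! ### Closure properties of polynomial time on the random access machine. -/

/-- A family of computation tasks indexed by `Γ`: named variables held in registers, a memory, a
precondition and a size parameter in which running times are measured. -/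
structure Ctx (Γ : Type) where
  Idx : Type
  var : Idx → Γ → ℕ
  pre : Γ → Prop
  size : Γ → ℕ
  mem : Γ → ℕ → ℕ
  two_le : ∀ γ, pre γ → 2 ≤ size γ

/-- `P` evaluates `f` into register `r` in time at most `size ^ c`, from variables stored in the
registers `ρ` below `r`, without touching memory or the registers below `r`. -/
def Evals {Γ : Type} (C : Ctx Γ) (f : Γ → ℕ) (c r : ℕ) (ρ : C.Idx → ℕ) (P : Prog) : Prop :=
  ∀ (γ : Γ) (s : State), C.pre γ → s.mem = C.mem γ → (∀ j, s.reg (ρ j) = C.var j γ) →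
    ∃ (t : ℕ) (s' : State), Exec P s t s' ∧ t ≤ C.size γ ^ c ∧ s'.reg r = f γ ∧
      (∀ x < r, s'.reg x = s.reg x) ∧ s'.mem = s.mem

/-- `f` is computed in polynomial time in the size, wherever the variables are stored. -/
def Computes {Γ : Type} (C : Ctx Γ) (f : Γ → ℕ) : Prop :=
  ∃ c : ℕ, ∀ (r : ℕ) (ρ : C.Idx → ℕ), (∀ j, ρ j < r) → ∃ P : Prog, Evals C f c r ρ P

/-- `f` is polynomially bounded in the size. -/
def Bdd {Γ : Type} (C : Ctx Γ) (f : Γ → ℕ) : Prop :=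
  ∃ c : ℕ, ∀ γ, C.pre γ → f γ ≤ C.size γ ^ c

/-- Extend the context by one variable, subject to the condition `R`. -/
abbrev Ctx.push {Γ : Type} (C : Ctx Γ) (R : Γ → ℕ → Prop) : Ctx (Γ × ℕ) where
  Idx := Option C.Idx
  var j q := j.elim q.2 fun i => C.var i q.1
  pre q := C.pre q.1 ∧ R q.1 q.2
  size q := C.size q.1
  mem q := C.mem q.1
  two_le q h := C.two_le q.1 h.1

section closure

variable {Γ : Type} {C : Ctx Γ}

theorem one_le_size {γ : Γ} (h : C.pre γ) : 1 ≤ C.size γ := le_trans one_le_two (C.two_le γ h)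

theorem size_pow_mono {γ : Γ} (h : C.pre γ) {a b : ℕ} (hab : a ≤ b) :
    C.size γ ^ a ≤ C.size γ ^ b := Nat.pow_le_pow_right (one_le_size h) hab

theorem two_pow_mul_le {γ : Γ} (h : C.pre γ) (a b : ℕ) :
    2 ^ a * C.size γ ^ b ≤ C.size γ ^ (a + b) := by
  rw [pow_add]
  exact Nat.mul_le_mul_right _ (Nat.pow_le_pow_left (C.two_le γ h) a)

theorem Bdd.mono {f g : Γ → ℕ} (hg : Bdd C g) (h : ∀ γ, C.pre γ → f γ ≤ g γ) : Bdd C f := by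
  obtain ⟨c, hc⟩ := hg
  exact ⟨c, fun γ hγ => (h γ hγ).trans (hc γ hγ)⟩

theorem Bdd.const (m : ℕ) : Bdd C fun _ => m :=
  ⟨m, fun γ hγ => (Nat.lt_two_pow_self).le.trans (Nat.pow_le_pow_left (C.two_le γ hγ) m)⟩

theorem Bdd.size : Bdd C C.size := ⟨1, fun γ _ => by simp⟩

theorem Bdd.mul {f g : Γ → ℕ} (hf : Bdd C f) (hg : Bdd C g) : Bdd C fun γ => f γ * g γ := by
  obtain ⟨a, ha⟩ := hf
  obtain ⟨b, hb⟩ := hg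
  exact ⟨a + b, fun γ hγ => by rw [pow_add]; exact Nat.mul_le_mul (ha γ hγ) (hb γ hγ)⟩

theorem Bdd.add {f g : Γ → ℕ} (hf : Bdd C f) (hg : Bdd C g) : Bdd C fun γ => f γ + g γ := by
  obtain ⟨a, ha⟩ := hf
  obtain ⟨b, hb⟩ := hg
  refine ⟨1 + (a + b), fun γ hγ => le_trans ?_ (two_pow_mul_le hγ 1 (a + b))⟩
  have h1 := (ha γ hγ).trans (size_pow_mono hγ (Nat.le_add_right a b))
  have h2 := (hb γ hγ).trans (size_pow_mono hγ (Nat.le_add_left b a))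
  show f γ + g γ ≤ _
  omega

theorem Bdd.pow_const {f : Γ → ℕ} (hf : Bdd C f) (m : ℕ) : Bdd C fun γ => f γ ^ m := by
  obtain ⟨a, ha⟩ := hf
  exact ⟨a * m, fun γ hγ => by rw [pow_mul]; exact Nat.pow_le_pow_left (ha γ hγ) m⟩

theorem Bdd.fst {f : Γ → ℕ} (hf : Bdd C f) (R : Γ → ℕ → Prop) :
    Bdd (C.push R) fun q => f q.1 := by
  obtain ⟨a, ha⟩ := hf
  exact ⟨a, fun q hq => ha q.1 hq.1⟩

theorem Bdd.snd_lt {b : Γ → ℕ} (hb : Bdd C b) :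
    Bdd (C.push fun γ i => i < b γ) fun q => q.2 := by
  obtain ⟨a, ha⟩ := hb
  exact ⟨a, fun q hq => hq.2.le.trans (ha q.1 hq.1)⟩

theorem Computes.congr {f g : Γ → ℕ} (hf : Computes C f) (h : ∀ γ, C.pre γ → f γ = g γ) :
    Computes C g := by
  obtain ⟨c, hc⟩ := hf
  refine ⟨c, fun r ρ hρ => ?_⟩
  obtain ⟨P, hP⟩ := hc r ρ hρ
  refine ⟨P, fun γ s hγ hm hv => ?_⟩
  rw [← h γ hγ]
  exact hP γ s hγ hm hv

theorem Computes.const (m : ℕ) : Computes C fun _ => m := by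
  refine ⟨0, fun r ρ _ => ⟨.const r m, fun γ s _ _ _ => ⟨1, _, .const r m s, by simp, ?_, ?_, rfl⟩⟩⟩
  · simp [State.setReg]
  · intro x hx
    simp [State.setReg, Function.update_of_ne hx.ne]

theorem Computes.var (j : C.Idx) : Computes C (C.var j) := by
  refine ⟨1, fun r ρ hρ => ⟨.seq (.const r 0) (.plus r (ρ j) r), fun γ s hγ _ hv =>
    ⟨1 + 1, _, .seq (.const r 0 s) (.plus r (ρ j) r _), by simpa using C.two_le γ hγ, ?_, ?_, rfl⟩⟩⟩
  · simp [State.setReg, Function.update_of_ne (hρ j).ne, hv j]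
  · intro x hx
    simp [State.setReg, Function.update_of_ne hx.ne]

theorem Computes.snd (R : Γ → ℕ → Prop) : Computes (C.push R) fun q => q.2 :=
  Computes.var (C := C.push R) none

theorem Computes.fst {f : Γ → ℕ} (hf : Computes C f) (R : Γ → ℕ → Prop) :
    Computes (C.push R) fun q => f q.1 := by
  obtain ⟨c, hc⟩ := hf
  refine ⟨c, fun r ρ hρ => ?_⟩
  obtain ⟨P, hP⟩ := hc r (fun j => ρ (some j)) fun j => hρ _
  exact ⟨P, fun q s hq hm hv => hP q.1 s hq.1 hm fun j => hv (some j)⟩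

/-- As the size is at least 2, sums of running times and constant overheads are absorbed by a larger
exponent. -/
theorem add_le_size_pow {γ : Γ} (h : C.pre γ) {a b x y : ℕ} (hx : x ≤ C.size γ ^ a)
    (hy : y ≤ C.size γ ^ b) : x + y + 2 ≤ C.size γ ^ (2 + (a + b)) := by
  refine le_trans ?_ (two_pow_mul_le h 2 (a + b))
  have h1 := hx.trans (size_pow_mono h (Nat.le_add_right a b))
  have h2 := hy.trans (size_pow_mono h (Nat.le_add_left b a))
  have h3 : 1 ≤ C.size γ ^ (a + b) := Nat.one_le_pow _ _ (one_le_size h)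
  omega

/-- Evaluate `f` and then, with its value as a new variable, `F`. -/
theorem Computes.letE {f : Γ → ℕ} {F : Γ × ℕ → ℕ} {R : Γ → ℕ → Prop} (hf : Computes C f)
    (hF : Computes (C.push R) F) (hR : ∀ γ, C.pre γ → R γ (f γ)) :
    Computes C fun γ => F (γ, f γ) := by
  obtain ⟨c, hc⟩ := hf
  obtain ⟨c', hc'⟩ := hF
  refine ⟨2 + (c + c'), fun r ρ hρ => ?_⟩
  obtain ⟨P, hP⟩ := hc r ρ hρ
  obtain ⟨Q, hQ⟩ := hc' (r + 1) (fun j => j.elim r ρ) (by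
    rintro (_ | j)
    · exact Nat.lt_succ_self r
    · exact (hρ j).trans (Nat.lt_succ_self r))
  refine ⟨.seq P (.seq Q (.seq (.const r 0) (.plus r r (r + 1)))), fun γ s hγ hm hv => ?_⟩
  obtain ⟨t, s₁, e₁, ht, h₁, hx₁, hm₁⟩ := hP γ s hγ hm hv
  obtain ⟨t', s₂, e₂, ht', h₂, hx₂, hm₂⟩ := hQ (γ, f γ) s₁ ⟨hγ, hR γ hγ⟩ (hm₁.trans hm) (by
    rintro (_ | j)
    · exact h₁
    · exact (hx₁ _ (hρ j)).trans (hv j))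
  refine ⟨_, _, .seq e₁ (.seq e₂ (.seq (.const r 0 s₂) (.plus r r (r + 1) _))), ?_, ?_, ?_, ?_⟩
  · have := add_le_size_pow hγ ht (b := c') ht'
    omega
  · simp [State.setReg, h₂]
  · intro x hx
    simp [State.setReg, Function.update_of_ne hx.ne, hx₂ x (hx.trans (Nat.lt_succ_self r)), hx₁ x hx]
  · simp [State.setReg, hm₂, hm₁]

theorem Computes.binary {f g : Γ → ℕ} (op : ℕ → ℕ → ℕ) (I : ℕ → ℕ → ℕ → Prog)
    (hI : ∀ r a b s, Exec (I r a b) s 1 (s.setReg r (op (s.reg a) (s.reg b))))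
    (hf : Computes C f) (hg : Computes C g) : Computes C fun γ => op (f γ) (g γ) := by
  refine Computes.letE (R := fun _ _ => True) (F := fun q => op q.2 (g q.1)) hf ?_ fun _ _ => trivial
  refine Computes.letE (R := fun _ _ => True) (F := fun q => op q.1.2 q.2) (hg.fst _) ?_
    fun _ _ => trivial
  refine ⟨0, fun r ρ hρ => ⟨I r (ρ (some none)) (ρ none), fun γ s _ _ hv =>
    ⟨1, _, hI _ _ _ _, by simp, ?_, ?_, rfl⟩⟩⟩
  · have h1 := hv none
    have h2 := hv (some none)
    simp only [State.setReg, Function.update_self]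
    exact congrArg₂ op h2 h1
  · intro x hx
    simp [State.setReg, Function.update_of_ne hx.ne]

theorem Computes.add {f g : Γ → ℕ} (hf : Computes C f) (hg : Computes C g) :
    Computes C fun γ => f γ + g γ :=
  .binary (· + ·) Prog.plus Exec.plus hf hg

theorem Computes.sub {f g : Γ → ℕ} (hf : Computes C f) (hg : Computes C g) :
    Computes C fun γ => f γ - g γ :=
  .binary (· - ·) Prog.monus Exec.monus hf hg

theorem Computes.load {f : Γ → ℕ} (hf : Computes C f) : Computes C fun γ => C.mem γ (f γ) := by
  refine Computes.letE (R := fun _ _ => True) (F := fun q => C.mem q.1 q.2) hf ?_ fun _ _ => trivial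
  refine ⟨0, fun r ρ hρ => ⟨.load r (ρ none), fun γ s _ hm hv =>
    ⟨1, _, .load _ _ _, by simp, ?_, ?_, rfl⟩⟩⟩
  · have h1 := hv none
    simp only [State.setReg, Function.update_self]
    exact (congrFun hm _).trans (congrArg _ h1)
  · intro x hx
    simp [State.setReg, Function.update_of_ne hx.ne]

theorem Computes.iteZero {f g h : Γ → ℕ} (hf : Computes C f) (hg : Computes C g)
    (hh : Computes C h) : Computes C fun γ => if f γ = 0 then g γ else h γ := by
  refine Computes.letE (R := fun _ _ => True) (F := fun q => if q.2 = 0 then g q.1 else h q.1) hf ?_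
    fun _ _ => trivial
  obtain ⟨c, hc⟩ := hg.fst fun _ _ => True
  obtain ⟨c', hc'⟩ := hh.fst fun _ _ => True
  refine ⟨2 + (c + c'), fun r ρ hρ => ?_⟩
  obtain ⟨P, hP⟩ := hc r ρ hρ
  obtain ⟨Q, hQ⟩ := hc' r ρ hρ
  refine ⟨.ite (ρ none) Q P, fun q s hq hm hv => ?_⟩
  by_cases hz : q.2 = 0
  · obtain ⟨t, s₁, e₁, ht, h₁, hx₁, hm₁⟩ := hP q s hq hm hv
    refine ⟨t + 1, s₁, .iteFalse (by have h1 := hv none; exact h1 ▸ hz) e₁, ?_, by simp [hz, h₁], hx₁, hm₁⟩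
    have := add_le_size_pow (C := C.push fun _ _ => True) hq ht (Nat.zero_le _ : 0 ≤ _ ^ c')
    omega
  · obtain ⟨t, s₁, e₁, ht, h₁, hx₁, hm₁⟩ := hQ q s hq hm hv
    refine ⟨t + 1, s₁, .iteTrue (by have h1 := hv none; exact h1 ▸ hz) e₁, ?_, by simp [hz, h₁], hx₁, hm₁⟩
    have := add_le_size_pow (C := C.push fun _ _ => True) hq (Nat.zero_le _ : 0 ≤ _ ^ c) ht
    omega

theorem Computes.iteLe {f g u v : Γ → ℕ} (hf : Computes C f) (hg : Computes C g)
    (hu : Computes C u) (hv : Computes C v) :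
    Computes C fun γ => if f γ ≤ g γ then u γ else v γ :=
  (Computes.iteZero (hf.sub hg) hu hv).congr fun γ _ => by simp only [Nat.sub_eq_zero_iff_le]

theorem Computes.iteEq {f g u v : Γ → ℕ} (hf : Computes C f) (hg : Computes C g)
    (hu : Computes C u) (hv : Computes C v) :
    Computes C fun γ => if f γ = g γ then u γ else v γ :=
  (Computes.iteZero ((hf.sub hg).add (hg.sub hf)) hu hv).congr fun γ _ => by
    congr 1
    apply propext
    omega

/-- Descending iteration: `F 0 (F 1 (⋯ (F (b - 1) a)))`. -/
def down : (b a : ℕ) → (ℕ → ℕ → ℕ) → ℕ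
  | 0, a, _ => a
  | b + 1, a, F => down b (F b a) F

/-- Register `r` is the counter, `r + 1` the accumulator, and the body leaves its value in `r + 2`.
The counter is decremented before the body runs, so during the body it equals the index that `down`
prescribes. -/
theorem exec_loop {C : Ctx Γ} {F : (Γ × ℕ) × ℕ → ℕ} {b : Γ → ℕ} {c r : ℕ} {ρ : C.Idx → ℕ}
    (hρ : ∀ j, ρ j < r) {P : Prog}
    (hP : Evals ((C.push fun γ i => i < b γ).push fun _ _ => True) F c (r + 2)
      (fun j => j.elim (r + 1) fun j => j.elim r ρ) P) (γ : Γ) (hγ : C.pre γ) (m : ℕ) :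
    ∀ (a : ℕ) (s : State), m ≤ b γ → s.mem = C.mem γ → (∀ j, s.reg (ρ j) = C.var j γ) →
      s.reg r = m → s.reg (r + 1) = a → ∃ (t : ℕ) (s' : State),
      Exec (.loop r (.seq (.const (r + 2) 1) (.seq (.monus r r (r + 2)) (.seq P
        (.seq (.const (r + 1) 0) (.plus (r + 1) (r + 1) (r + 2))))))) s t s' ∧
      t ≤ m * (C.size γ ^ c + 5) + 1 ∧ s'.reg (r + 1) = down m a (fun i x => F ((γ, i), x)) ∧
      (∀ x < r, s'.reg x = s.reg x) ∧ s'.mem = s.mem := by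
  induction m with
  | zero =>
    intro a s _ _ _ hr ha
    exact ⟨1, s, .loopDone hr, by simp, by simpa [down] using ha, fun _ _ => rfl, rfl⟩
  | succ m ih =>
    intro a s hmb hm hv hr ha
    have e1 := Exec.const (r + 2) 1 s
    set s1 := s.setReg (r + 2) 1 with hs1
    have e2 := Exec.monus r r (r + 2) s1
    set s2 := s1.setReg r (s1.reg r - s1.reg (r + 2)) with hs2
    have k1 : ∀ x < r, s2.reg x = s.reg x := fun x hx => by
      simp [hs2, hs1, State.setReg, Function.update_of_ne hx.ne,
        Function.update_of_ne (show x ≠ r + 2 by omega)]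
    have k2 : s2.reg r = m := by
      simp [hs2, hs1, State.setReg, hr]
    have k3 : s2.reg (r + 1) = a := by
      simp [hs2, hs1, State.setReg, ha]
    have k4 : s2.mem = s.mem := rfl
    obtain ⟨t, s3, e3, ht, hv3, hx3, hm3⟩ := hP ((γ, m), a) s2 ⟨⟨hγ, hmb⟩, trivial⟩ (k4.trans hm) (by
      rintro (_ | _ | j)
      · exact k3
      · exact k2
      · exact (k1 _ (hρ j)).trans (hv j))
    have e4 := Exec.const (r + 1) 0 s3
    set s4 := s3.setReg (r + 1) 0 with hs4
    have e5 := Exec.plus (r + 1) (r + 1) (r + 2) s4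
    set s5 := s4.setReg (r + 1) (s4.reg (r + 1) + s4.reg (r + 2)) with hs5
    have k5 : ∀ x < r + 1, s5.reg x = s2.reg x := fun x hx => by
      rw [← hx3 x (by omega)]
      simp [hs5, hs4, State.setReg, Function.update_of_ne hx.ne]
    have k6 : s5.reg (r + 1) = F ((γ, m), a) := by
      simp [hs5, hs4, State.setReg, hv3]
    have k7 : s5.mem = s.mem := hm3.trans k4
    obtain ⟨t', s6, e6, ht', hv6, hx6, hm6⟩ := ih (F ((γ, m), a)) s5 (by omega) (k7.trans hm)
      (fun j => by rw [k5 _ ((hρ j).trans (Nat.lt_succ_self r)), k1 _ (hρ j), hv j])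
      (by rw [k5 r (Nat.lt_succ_self r), k2]) k6
    refine ⟨_, s6, .loopStep (by rw [hr]; omega) (.seq e1 (.seq e2 (.seq e3 (.seq e4 e5)))) e6,
      ?_, ?_, ?_, ?_⟩
    · have : t ≤ C.size γ ^ c := ht
      rw [add_mul]
      omega
    · rw [hv6, down]
    · intro x hx
      rw [hx6 x hx, k5 x (by omega), k1 x hx]
    · rw [hm6, k7]

/-- Only the number of rounds must be polynomially bounded. The accumulator may become much larger
than any power of the size, as walk counts do. -/
theorem Computes.iter {b a : Γ → ℕ} {F : (Γ × ℕ) × ℕ → ℕ} (hb : Computes C b) (ha : Computes C a)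
    (hF : Computes ((C.push fun γ i => i < b γ).push fun _ _ => True) F) (hbb : Bdd C b) :
    Computes C fun γ => down (b γ) (a γ) fun i x => F ((γ, i), x) := by
  obtain ⟨cb, hcb⟩ := hb
  obtain ⟨ca, hca⟩ := ha.fst fun _ _ => True
  obtain ⟨c, hc⟩ := hF
  obtain ⟨β, hβ⟩ := hbb
  refine ⟨4 + (cb + ca + (β + c)) + 3, fun r ρ hρ => ?_⟩
  obtain ⟨P1, hP1⟩ := hcb r ρ hρ
  obtain ⟨P2, hP2⟩ := hca (r + 1) (fun j => j.elim r ρ) (by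
    rintro (_ | j)
    · exact Nat.lt_succ_self r
    · exact (hρ j).trans (Nat.lt_succ_self r))
  obtain ⟨P3, hP3⟩ := hc (r + 2) (fun j => j.elim (r + 1) fun j => j.elim r ρ) (by
    rintro (_ | _ | j)
    · exact Nat.lt_succ_self (r + 1)
    · exact Nat.lt_add_of_pos_right two_pos
    · exact (hρ j).trans (Nat.lt_add_of_pos_right two_pos))
  refine ⟨.seq P1 (.seq P2 (.seq (.loop r (.seq (.const (r + 2) 1) (.seq (.monus r r (r + 2))
    (.seq P3 (.seq (.const (r + 1) 0) (.plus (r + 1) (r + 1) (r + 2)))))))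
    (.seq (.const r 0) (.plus r r (r + 1))))), fun γ s hγ hm hv => ?_⟩
  obtain ⟨t1, s1, e1, ht1, hv1, hx1, hm1⟩ := hP1 γ s hγ hm hv
  obtain ⟨t2, s2, e2, ht2, hv2, hx2, hm2⟩ := hP2 (γ, b γ) s1 ⟨hγ, trivial⟩ (hm1.trans hm) (by
    rintro (_ | j)
    · exact hv1
    · exact (hx1 _ (hρ j)).trans (hv j))
  obtain ⟨t3, s3, e3, ht3, hv3, hx3, hm3⟩ := exec_loop hρ hP3 γ hγ (b γ) (a γ) s2 le_rfl
    (hm2.trans (hm1.trans hm)) (fun j => by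
      rw [hx2 _ ((hρ j).trans (Nat.lt_succ_self r)), hx1 _ (hρ j), hv j])
    (by rw [hx2 r (Nat.lt_succ_self r), hv1]) hv2
  refine ⟨_, _, .seq e1 (.seq e2 (.seq e3 (.seq (.const r 0 s3) (.plus r r (r + 1) _)))), ?_, ?_,
    ?_, ?_⟩
  · have h0 : 1 ≤ C.size γ ^ c := Nat.one_le_pow _ _ (one_le_size hγ)
    have h1 : b γ * (C.size γ ^ c + 5) ≤ C.size γ ^ (3 + (β + c)) :=
      calc b γ * (C.size γ ^ c + 5) ≤ C.size γ ^ β * (2 ^ 3 * C.size γ ^ c) :=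
            Nat.mul_le_mul (hβ γ hγ) (by omega)
        _ = 2 ^ 3 * C.size γ ^ (β + c) := by ring
        _ ≤ _ := two_pow_mul_le hγ _ _
    have ht2' : t2 ≤ C.size γ ^ ca := ht2
    have h2 := add_le_size_pow hγ ht1 ht2'
    have h3 := add_le_size_pow hγ h2 h1
    refine le_trans ?_ (h3.trans (size_pow_mono hγ (by omega)))
    omega
  · simp [State.setReg, hv3]
  · intro x hx
    simp [State.setReg, Function.update_of_ne hx.ne, hx3 x hx, hx2 x (hx.trans (Nat.lt_succ_self r)),
      hx1 x hx]
  · simp [State.setReg, hm3, hm2, hm1]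

theorem down_add_eq_sum (b a : ℕ) (f : ℕ → ℕ) :
    down b a (fun i x => x + f i) = a + ∑ i ∈ Finset.range b, f i := by
  induction b generalizing a with
  | zero => simp [down]
  | succ b ih => rw [down, ih, Finset.sum_range_succ]; ring

theorem Computes.sum {b : Γ → ℕ} {f : Γ × ℕ → ℕ} (hb : Computes C b) (hbb : Bdd C b)
    (hf : Computes (C.push fun γ i => i < b γ) f) :
    Computes C fun γ => ∑ i ∈ Finset.range (b γ), f (γ, i) :=
  (Computes.iter hb (.const 0) (F := fun q => q.2 + f q.1)
    ((Computes.snd _).add (hf.fst _)) hbb).congr fun γ _ => by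
      rw [down_add_eq_sum _ _ fun i => f (γ, i), zero_add]

/-- Multiplication is repeated addition, so only the factor that controls the loop needs a bound. -/
theorem Computes.mul {f g : Γ → ℕ} (hf : Computes C f) (hg : Computes C g) (hb : Bdd C g) :
    Computes C fun γ => f γ * g γ :=
  (Computes.sum hg hb (hf.fst _)).congr fun γ _ => by simp [mul_comm]

/-- The quotient is the number of i < f with (i + 1) g ≤ f. -/
theorem Computes.div {f g : Γ → ℕ} (hf : Computes C f) (hg : Computes C g) (hb : Bdd C f)
    (hbg : Bdd C g) (hpos : ∀ γ, C.pre γ → 0 < g γ) : Computes C fun γ => f γ / g γ := by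
  refine (Computes.sum (f := fun q => if (q.2 + 1) * g q.1 ≤ f q.1 then 1 else 0) hf hb
    (.iteLe (.mul ((Computes.snd _).add (.const 1)) (hg.fst _) (hbg.fst _)) (hf.fst _)
      (.const 1) (.const 0))).congr fun γ hγ => ?_
  rw [← Finset.card_filter]
  have : (Finset.range (f γ)).filter (fun i => (i + 1) * g γ ≤ f γ) = Finset.range (f γ / g γ) := by
    ext i
    simp only [Finset.mem_filter, Finset.mem_range]
    rw [← Nat.le_div_iff_mul_le (hpos γ hγ)]
    have := Nat.div_le_self (f γ) (g γ)
    omega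
  simp [this]

theorem Computes.mod {f g : Γ → ℕ} (hf : Computes C f) (hg : Computes C g) (hb : Bdd C f)
    (hbg : Bdd C g) (hpos : ∀ γ, C.pre γ → 0 < g γ) : Computes C fun γ => f γ % g γ := by
  refine (hf.sub (.mul (hf.div hg hb hbg hpos) hg hbg)).congr fun γ hγ => ?_
  have := Nat.div_add_mod' (f γ) (g γ)
  omega

theorem down_mul_eq_pow (b a x : ℕ) : down b a (fun _ y => y * x) = a * x ^ b := by
  induction b generalizing a with
  | zero => simp [down]
  | succ b ih => rw [down, ih]; ring

/-- Base and exponent are bounded because they control loops; the power itself is not, which permits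
θ^(2L). -/
theorem Computes.pow {f g : Γ → ℕ} (hf : Computes C f) (hg : Computes C g) (hb : Bdd C f)
    (hbg : Bdd C g) : Computes C fun γ => f γ ^ g γ :=
  (Computes.iter hg (.const 1) (F := fun q => q.2 * f q.1.1)
    (.mul (Computes.snd _) ((hf.fst _).fst _) ((hb.fst _).fst _)) hbg).congr fun γ _ => by
      rw [down_mul_eq_pow _ _ (f γ), one_mul]

end closure

end Ram

/-! ### Filling a table in memory, each cell from the previous ones. -/

namespace Ram

section table

variable {Γ : Type} {C : Ctx Γ}

/-- The same tasks with another memory, related to the input by `R`. -/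
abbrev Ctx.remem (C : Ctx Γ) (R : Γ → (ℕ → ℕ) → Prop) : Ctx (Γ × (ℕ → ℕ)) where
  Idx := C.Idx
  var j q := C.var j q.1
  pre q := C.pre q.1 ∧ R q.1 q.2
  size q := C.size q.1
  mem q := q.2
  two_le q h := C.two_le q.1 h.1

/-- The memory `μ` holds the original data below `b` and the values `val 0, …, val (T - 1)` from
the address `b` on. -/
def HoldsTable (old : ℕ → ℕ) (b : ℕ) (val : ℕ → ℕ) (T : ℕ) (μ : ℕ → ℕ) : Prop :=
  (∀ x < b, μ x = old x) ∧ ∀ c < T, μ (b + c) = val c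

/-- Evaluation of one cell of a table, when the previous cells have been filled. -/
abbrev Ctx.cell (C : Ctx Γ) (b T : Γ → ℕ) (val : Γ → ℕ → ℕ) : Ctx ((Γ × (ℕ → ℕ)) × ℕ) :=
  (C.remem fun _ _ => True).push fun q c => c < T q.1 ∧ HoldsTable (C.mem q.1) (b q.1) (val q.1) c q.2

theorem HoldsTable.setMem {old : ℕ → ℕ} {b c : ℕ} {val : ℕ → ℕ} {s : State}
    (h : HoldsTable old b val c s.mem) :
    HoldsTable old b val (c + 1) (s.setMem (b + c) (val c)).mem := by
  refine ⟨fun x hx => ?_, fun x hx => ?_⟩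
  · simp only [State.setMem]
    rw [Function.update_of_ne (by omega), h.1 x hx]
  · simp only [State.setMem]
    rcases Nat.lt_succ_iff_lt_or_eq.1 hx with hx | rfl
    · rw [Function.update_of_ne (by omega), h.2 x hx]
    · simp

/-- Register `r` holds the number of cells still missing, so the next cell is T − m. The invariant
gives the program `P` a memory that already contains all earlier cells. -/
theorem exec_fill {b T : Γ → ℕ} {val : Γ → ℕ → ℕ} {c r : ℕ} {ρ : C.Idx → ℕ}
    (hρ : ∀ j, ρ j < r) {P : Prog}
    (hP : Evals (C.cell b T val) (fun q => val q.1.1 q.2) c (r + 4)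
      (fun j => j.elim (r + 3) ρ) P) (γ : Γ) (hγ : C.pre γ) (m : ℕ) :
    ∀ s : State, m ≤ T γ → HoldsTable (C.mem γ) (b γ) (val γ) (T γ - m) s.mem →
      (∀ j, s.reg (ρ j) = C.var j γ) → s.reg r = m → s.reg (r + 1) = T γ → s.reg (r + 2) = b γ →
      ∃ (t : ℕ) (s' : State),
      Exec (.loop r (.seq (.monus (r + 3) (r + 1) r) (.seq P (.seq (.plus (r + 3) (r + 2) (r + 3))
        (.seq (.store (r + 3) (r + 4)) (.seq (.const (r + 3) 1) (.monus r r (r + 3)))))))) s t s' ∧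
      t ≤ m * (C.size γ ^ c + 6) + 1 ∧ (∀ x < r, s'.reg x = s.reg x) ∧
      HoldsTable (C.mem γ) (b γ) (val γ) (T γ) s'.mem := by
  induction m with
  | zero =>
    intro s _ hm _ hr _ _
    exact ⟨1, s, .loopDone hr, by simp, fun _ _ => rfl, hm⟩
  | succ m ih =>
    intro s hmT hm hv hr hr1 hr2
    have e1 := Exec.monus (r + 3) (r + 1) r s
    set s1 := s.setReg (r + 3) (s.reg (r + 1) - s.reg r) with hs1
    have k1 : ∀ x < r + 3, s1.reg x = s.reg x := fun x hx => by
      simp [hs1, State.setReg, Function.update_of_ne hx.ne]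
    have k2 : s1.reg (r + 3) = T γ - (m + 1) := by
      simp [hs1, State.setReg, hr, hr1]
    have k3 : s1.mem = s.mem := rfl
    obtain ⟨t, s2, e2, ht, hv2, hx2, hm2⟩ := hP ((γ, s.mem), T γ - (m + 1)) s1
      ⟨⟨hγ, trivial⟩, (show T γ - (m + 1) < T γ by omega), hm⟩ k3 (by
        rintro (_ | j)
        · exact k2
        · exact (k1 _ ((hρ j).trans (by omega))).trans (hv j))
    have e3 := Exec.plus (r + 3) (r + 2) (r + 3) s2
    set s3 := s2.setReg (r + 3) (s2.reg (r + 2) + s2.reg (r + 3)) with hs3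
    have e4 := Exec.store (r + 3) (r + 4) s3
    set s4 := s3.setMem (s3.reg (r + 3)) (s3.reg (r + 4)) with hs4
    have e5 := Exec.const (r + 3) 1 s4
    set s5 := s4.setReg (r + 3) 1 with hs5
    have e6 := Exec.monus r r (r + 3) s5
    set s6 := s5.setReg r (s5.reg r - s5.reg (r + 3)) with hs6
    have l1 : ∀ x < r + 3, x ≠ r → s6.reg x = s.reg x := fun x hx hxr => by
      rw [← k1 x hx, ← hx2 x (by omega)]
      simp [hs6, hs5, hs4, hs3, State.setReg, State.setMem, Function.update_of_ne hx.ne,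
        Function.update_of_ne hxr]
    have l2 : s6.reg r = m := by
      simp [hs6, hs5, hs4, hs3, State.setReg, State.setMem]
      rw [hx2 r (by omega), k1 r (by omega), hr]
      rfl
    have l3 : s3.reg (r + 3) = b γ + (T γ - (m + 1)) := by
      simp only [hs3, State.setReg, Function.update_self]
      rw [hx2 (r + 2) (by omega), hx2 (r + 3) (by omega), k2, k1 _ (by omega), hr2]
    have l4 : s3.reg (r + 4) = val γ (T γ - (m + 1)) := by
      simp [hs3, State.setReg, hv2]
    have l5 : HoldsTable (C.mem γ) (b γ) (val γ) (T γ - m) s6.mem := by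
      have h1 : T γ - m = T γ - (m + 1) + 1 := by omega
      rw [h1]
      have h2 : s6.mem = (s3.setMem (b γ + (T γ - (m + 1))) (val γ (T γ - (m + 1)))).mem := by
        rw [← l3, ← l4]
        rfl
      rw [h2]
      refine HoldsTable.setMem ?_
      rw [show s3.mem = s2.mem from rfl, hm2, k3]
      exact hm
    obtain ⟨t', s7, e7, ht', hx7, hm7⟩ := ih s6 (by omega) l5
      (fun j => by rw [l1 _ ((hρ j).trans (by omega)) (hρ j).ne, hv j]) l2
      (by rw [l1 _ (by omega) (by omega), hr1]) (by rw [l1 _ (by omega) (by omega), hr2])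
    refine ⟨_, s7, .loopStep (by rw [hr]; omega)
      (.seq e1 (.seq e2 (.seq e3 (.seq e4 (.seq e5 e6))))) e7, ?_, ?_, hm7⟩
    · have : t ≤ C.size γ ^ c := ht
      rw [add_mul]
      omega
    · intro x hx
      rw [hx7 x hx, l1 x (by omega) hx.ne]

/-- A table whose cells are computed one after the other from the previous ones can be written to
the memory in polynomial time, and then used in the evaluation of `f` and `g`. -/
theorem exists_prog_table {b T : Γ → ℕ} {val : Γ → ℕ → ℕ} {f g : Γ × (ℕ → ℕ) → ℕ}
    (hb : Computes C b) (hT : Computes C T) (hTb : Bdd C T)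
    (hval : Computes (C.cell b T val) fun q => val q.1.1 q.2)
    (hf : Computes (C.remem fun γ μ => HoldsTable (C.mem γ) (b γ) (val γ) (T γ) μ) f)
    (hg : Computes (C.remem fun γ μ => HoldsTable (C.mem γ) (b γ) (val γ) (T γ) μ) g) (r : ℕ)
    (ρ : C.Idx → ℕ) (hρ : ∀ j, ρ j < r) :
    ∃ (c : ℕ) (P : Prog), ∀ (γ : Γ) (s : State), C.pre γ → s.mem = C.mem γ →
      (∀ j, s.reg (ρ j) = C.var j γ) → ∃ (t : ℕ) (s' : State) (μ : ℕ → ℕ), Exec P s t s' ∧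
        t ≤ C.size γ ^ c ∧ HoldsTable (C.mem γ) (b γ) (val γ) (T γ) μ ∧
        s'.reg 0 = f (γ, μ) ∧ s'.reg 1 = g (γ, μ) := by
  obtain ⟨c1, h1⟩ := hT
  obtain ⟨P1, h1⟩ := h1 r ρ hρ
  obtain ⟨c2, h2⟩ := hb
  obtain ⟨P2, h2⟩ := h2 (r + 2) ρ fun j => (hρ j).trans (by omega)
  obtain ⟨c3, h3⟩ := hval
  obtain ⟨P3, h3⟩ := h3 (r + 4) (fun j => j.elim (r + 3) ρ) (by
    rintro (_ | j)
    · exact Nat.lt_succ_self _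
    · exact (hρ j).trans (by omega))
  obtain ⟨c4, h4⟩ := hf
  obtain ⟨P4, h4⟩ := h4 r ρ hρ
  obtain ⟨c5, h5⟩ := hg
  obtain ⟨P5, h5⟩ := h5 (r + 1) ρ fun j => (hρ j).trans (by omega)
  obtain ⟨β, hβ⟩ := hTb
  refine ⟨2 + (2 + (2 + (2 + (c1 + c2) + (3 + (β + c3))) + c4) + c5) + 4,
    .seq P1 (.seq (.const (r + 2) 0) (.seq (.plus (r + 1) r (r + 2)) (.seq P2 (.seq (.loop r
      (.seq (.monus (r + 3) (r + 1) r) (.seq P3 (.seq (.plus (r + 3) (r + 2) (r + 3))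
        (.seq (.store (r + 3) (r + 4)) (.seq (.const (r + 3) 1) (.monus r r (r + 3))))))))
      (.seq P4 (.seq P5 (.seq (.const (r + 2) 0)
        (.seq (.plus 0 r (r + 2)) (.plus 1 (r + 1) (r + 2)))))))))), fun γ s hγ hm hv => ?_⟩
  obtain ⟨t1, s1, e1, ht1, hv1, hx1, hm1⟩ := h1 γ s hγ hm hv
  have e2 := Exec.const (r + 2) 0 s1
  set s2 := s1.setReg (r + 2) 0 with hs2
  have e3 := Exec.plus (r + 1) r (r + 2) s2
  set s3 := s2.setReg (r + 1) (s2.reg r + s2.reg (r + 2)) with hs3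
  have k3 : ∀ x < r + 1, s3.reg x = s1.reg x := fun x hx => by
    simp [hs3, hs2, State.setReg, Function.update_of_ne hx.ne,
      Function.update_of_ne (show x ≠ r + 2 by omega)]
  have k3' : s3.reg (r + 1) = T γ := by
    simp [hs3, hs2, State.setReg, hv1]
  have m3 : s3.mem = C.mem γ := hm1.trans hm
  have v3 : ∀ j, s3.reg (ρ j) = C.var j γ := fun j => by
    rw [k3 _ ((hρ j).trans (by omega)), hx1 _ (hρ j), hv j]
  obtain ⟨t4, s4, e4, ht4, hv4, hx4, hm4⟩ := h2 γ s3 hγ m3 v3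
  have v4 : ∀ j, s4.reg (ρ j) = C.var j γ := fun j => by
    rw [hx4 _ ((hρ j).trans (by omega)), v3]
  obtain ⟨t5, s5, e5, ht5, hx5, hm5⟩ := exec_fill hρ h3 γ hγ (T γ) s4 le_rfl
    ⟨fun x _ => by rw [hm4, m3], fun c hc => by omega⟩ v4
    (by rw [hx4 r (by omega), k3 r (by omega), hv1]) (by rw [hx4 (r + 1) (by omega), k3']) hv4
  have v5 : ∀ j, s5.reg (ρ j) = C.var j γ := fun j => by rw [hx5 _ (hρ j), v4]
  obtain ⟨t6, s6, e6, ht6, hv6, hx6, hm6⟩ := h4 (γ, s5.mem) s5 ⟨hγ, hm5⟩ rfl v5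
  have v6 : ∀ j, s6.reg (ρ j) = C.var j γ := fun j => by rw [hx6 _ (hρ j), v5]
  obtain ⟨t7, s7, e7, ht7, hv7, hx7, hm7⟩ := h5 (γ, s5.mem) s6 ⟨hγ, hm5⟩ hm6 v6
  refine ⟨_, _, s5.mem, .seq e1 (.seq e2 (.seq e3 (.seq e4 (.seq e5 (.seq e6 (.seq e7
    (.seq (.const (r + 2) 0 s7) (.seq (.plus 0 r (r + 2) _) (.plus 1 (r + 1) (r + 2) _))))))))),
    ?_, hm5, ?_, ?_⟩
  · have a0 : 1 ≤ C.size γ ^ c3 := Nat.one_le_pow _ _ (one_le_size hγ)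
    have a1 : T γ * (C.size γ ^ c3 + 6) ≤ C.size γ ^ (3 + (β + c3)) :=
      calc T γ * (C.size γ ^ c3 + 6) ≤ C.size γ ^ β * (2 ^ 3 * C.size γ ^ c3) :=
            Nat.mul_le_mul (hβ γ hγ) (by omega)
        _ = 2 ^ 3 * C.size γ ^ (β + c3) := by ring
        _ ≤ _ := two_pow_mul_le hγ _ _
    have ht6' : t6 ≤ C.size γ ^ c4 := ht6
    have ht7' : t7 ≤ C.size γ ^ c5 := ht7
    have a2 := add_le_size_pow hγ (add_le_size_pow hγ (add_le_size_pow hγ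
      (add_le_size_pow hγ ht1 ht4) a1) ht6') ht7'
    have a3 : C.size γ ^ (2 + (2 + (2 + (2 + (c1 + c2) + (3 + (β + c3))) + c4) + c5)) + 10 ≤
        C.size γ ^ (2 + (2 + (2 + (2 + (c1 + c2) + (3 + (β + c3))) + c4) + c5) + 4) := by
      have b1 := two_pow_mul_le hγ 4 (2 + (2 + (2 + (2 + (c1 + c2) + (3 + (β + c3))) + c4) + c5))
      have b2 : 1 ≤ C.size γ ^ (2 + (2 + (2 + (2 + (c1 + c2) + (3 + (β + c3))) + c4) + c5)) :=
        Nat.one_le_pow _ _ (one_le_size hγ)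
      rw [add_comm _ 4]
      omega
    omega
  · simp [State.setReg, hx7, hv6]
  · simp [State.setReg, hv7]

end table

end Ram

/-! ### From traces to quadratic forms. -/

namespace Kikuchi

open Matrix in
/-- If the trace of an even power of a symmetric matrix is at most the same power of `θ`, then its
quadratic form is at most `θ` times the square norm. -/
theorem dotProduct_mulVec_le {ι : Type*} [Fintype ι] [DecidableEq ι] {M : Matrix ι ι ℝ}
    (hM : Mᵀ = M) {L : ℕ} (hL : L ≠ 0) {θ : ℝ} (hθ : 0 ≤ θ)
    (h : (M ^ (2 * L)).trace ≤ θ ^ (2 * L)) (y : ι → ℝ) : y ⬝ᵥ M *ᵥ y ≤ θ * (y ⬝ᵥ y) := by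
  have hH : M.IsHermitian := by rw [IsHermitian, conjTranspose_eq_transpose_of_trivial, hM]
  set U : Matrix ι ι ℝ := hH.eigenvectorUnitary.1 with hU
  set lam := hH.eigenvalues
  have hUU : star U * U = 1 := Unitary.coe_star_mul_self hH.eigenvectorUnitary
  have hUU' : U * star U = 1 := Unitary.coe_mul_star_self hH.eigenvectorUnitary
  have hsp : M = U * diagonal lam * star U := by
    have := hH.spectral_theorem
    simpa [Unitary.conjStarAlgAut_apply] using this
  have hpow : ∀ m : ℕ, M ^ m = U * diagonal (fun i => lam i ^ m) * star U := by
    intro m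
    induction m with
    | zero => simp [hUU']
    | succ m ih =>
      rw [pow_succ, ih]
      conv_lhs => rw [hsp]
      calc U * diagonal (fun i => lam i ^ m) * star U * (U * diagonal lam * star U)
          = U * diagonal (fun i => lam i ^ m) * (star U * U) * diagonal lam * star U := by
            simp only [Matrix.mul_assoc]
        _ = _ := by
            rw [hUU, Matrix.mul_one, Matrix.mul_assoc U, diagonal_mul_diagonal]
            simp only [pow_succ]
  have htr : (M ^ (2 * L)).trace = ∑ i, lam i ^ (2 * L) := by
    rw [hpow, Matrix.trace_mul_comm, ← Matrix.mul_assoc, hUU, Matrix.one_mul, trace_diagonal]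
  -- The trace is a sum of even powers of the eigenvalues, hence of nonnegative terms, so each term
  -- is at most the trace.
  have hlam : ∀ i, lam i ≤ θ := by
    intro i
    have h1 : lam i ^ (2 * L) ≤ θ ^ (2 * L) := by
      refine le_trans ?_ (htr ▸ h)
      refine Finset.single_le_sum (f := fun i => lam i ^ (2 * L)) (fun j _ => ?_) (Finset.mem_univ i)
      rw [pow_mul]
      positivity
    have h2 : |lam i| ^ (2 * L) ≤ θ ^ (2 * L) := by
      rwa [(even_two_mul L).pow_abs]
    exact (le_abs_self _).trans (le_of_pow_le_pow_left₀ (by positivity) hθ h2)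
  have hst : star U = Uᵀ := by rw [star_eq_conjTranspose, conjTranspose_eq_transpose_of_trivial]
  set z := star U *ᵥ y with hz
  have hzz : z ⬝ᵥ z = y ⬝ᵥ y := by
    rw [hz, dotProduct_mulVec, ← mulVec_transpose, hst, transpose_transpose, mulVec_mulVec, ← hst,
      hUU', one_mulVec]
  have hq : y ⬝ᵥ M *ᵥ y = ∑ i, lam i * z i ^ 2 := by
    rw [hsp, ← mulVec_mulVec, ← hz, ← mulVec_mulVec, dotProduct_mulVec, ← mulVec_transpose, ← hst,
      ← hz]
    simp only [dotProduct, mulVec_diagonal]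
    exact Finset.sum_congr rfl fun i _ => by ring
  rw [hq, ← hzz, dotProduct, Finset.mul_sum]
  refine Finset.sum_le_sum fun i _ => ?_
  rw [← sq]
  exact mul_le_mul_of_nonneg_right (hlam i) (sq_nonneg _)

/-- A memory `V` with cells at the positions `P`, each holding an element of `A`. -/
structure Tape (V P A : Type) where
  rd : V → P → A
  wr : V → P → A → V
  rd_wr : ∀ s p b, rd (wr s p b) p = b
  wr_rd : ∀ s p b, wr (wr s p b) p (rd s p) = s

/-- The index is the first variable of a constraint; the pair holds the two halves of its other
variables. -/
abbrev Inst (I A : Type) : Type := I → A × A → Option ℤˣ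

/-- There is one tape for each of two constraints with a common index. The bit says which half of a
constraint is read from the tape. -/
abbrev Vert (V : Type) : Type := Bool × V × V

abbrev Edge (I P A : Type) : Type := I × (P × A) × (P × A)

/-- Traversing an edge exchanges the value on the tape with the value to be written. Flipping the
bit at the same time restores the same pair, so the edge back carries the same constraint. -/
def lab {A : Type} (c : Bool) (a b : A) : A × A := if c then (b, a) else (a, b)

theorem lab_not {A : Type} (c : Bool) (a b : A) : lab (!c) a b = lab c b a := by
  cases c <;> rfl

def sgn (o : Option ℤˣ) : ℝ := o.elim 0 fun η => ((η : ℤ) : ℝ)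

theorem sgn_sq (o : Option ℤˣ) : sgn o * sgn o = if o.isSome then 1 else 0 := by
  rcases o with _ | η
  · simp [sgn]
  · rcases Int.units_eq_one_or η with rfl | rfl <;> simp [sgn]

theorem sgn_eq_zero {o : Option ℤˣ} (h : ¬ o.isSome) : sgn o = 0 := by
  rcases o with _ | η
  · rfl
  · simp at h

theorem abs_sgn_le (o : Option ℤˣ) : |sgn o| ≤ 1 := by
  rcases o with _ | η
  · simp [sgn]
  · rcases Int.units_eq_one_or η with rfl | rfl <;> simp [sgn]

/-! ### The pruned Kikuchi graph of an arbitrary instance. -/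

section defs

variable {I V P A : Type} (K : Tape V P A) (Ψ : Inst I A)

def lab1 (v : Vert V) (e : Edge I P A) : A × A := lab v.1 (K.rd v.2.1 e.2.1.1) e.2.1.2

def lab2 (v : Vert V) (e : Edge I P A) : A × A := lab v.1 (K.rd v.2.2 e.2.2.1) e.2.2.2

def nb (v : Vert V) (e : Edge I P A) : Vert V :=
  (!v.1, K.wr v.2.1 e.2.1.1 e.2.1.2, K.wr v.2.2 e.2.2.1 e.2.2.2)

def rev (v : Vert V) (e : Edge I P A) : Edge I P A :=
  (e.1, (e.2.1.1, K.rd v.2.1 e.2.1.1), (e.2.2.1, K.rd v.2.2 e.2.2.1))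

theorem lab1_rev (v : Vert V) (e : Edge I P A) : lab1 K (nb K v e) (rev K v e) = lab1 K v e := by
  simp [lab1, nb, rev, K.rd_wr, lab_not]

theorem lab2_rev (v : Vert V) (e : Edge I P A) : lab2 K (nb K v e) (rev K v e) = lab2 K v e := by
  simp [lab2, nb, rev, K.rd_wr, lab_not]

theorem nb_rev (v : Vert V) (e : Edge I P A) : nb K (nb K v e) (rev K v e) = v := by
  simp [nb, rev, K.wr_rd]

theorem rev_rev (v : Vert V) (e : Edge I P A) : rev K (nb K v e) (rev K v e) = e := by
  simp [nb, rev, K.rd_wr]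

/-- Traversing an edge and turning around. -/
def turn : Vert V × Edge I P A ≃ Vert V × Edge I P A where
  toFun q := (nb K q.1 q.2, rev K q.1 q.2)
  invFun q := (nb K q.1 q.2, rev K q.1 q.2)
  left_inv _ := Prod.ext (nb_rev K _ _) (rev_rev K _ _)
  right_inv _ := Prod.ext (nb_rev K _ _) (rev_rev K _ _)

/-- Equal labels are excluded because the diagonal terms of the squares are counted separately by
`size`. -/
def Full (v : Vert V) (e : Edge I P A) : Prop :=
  lab1 K v e ≠ lab2 K v e ∧ (Ψ e.1 (lab1 K v e)).isSome ∧ (Ψ e.1 (lab2 K v e)).isSome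

def wgt (v : Vert V) (e : Edge I P A) : ℝ :=
  sgn (Ψ e.1 (lab1 K v e)) * sgn (Ψ e.1 (lab2 K v e))

theorem full_turn (v : Vert V) (e : Edge I P A) :
    Full K Ψ (nb K v e) (rev K v e) ↔ Full K Ψ v e := by
  simp only [Full, lab1_rev, lab2_rev]
  rfl

theorem wgt_turn (v : Vert V) (e : Edge I P A) :
    wgt K Ψ (nb K v e) (rev K v e) = wgt K Ψ v e := by
  simp only [wgt, lab1_rev, lab2_rev]
  rfl

variable [Fintype P] [Fintype A]

/-- The number of half edges with index `i`. -/
def occ (c : Bool) (i : I) (s : V) : ℕ :=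
  (Finset.univ.filter fun q : P × A => (Ψ i (lab c (K.rd s q.1) q.2)).isSome).card

def Good (τ : ℕ) (i : I) (v : Vert V) : Prop :=
  occ K Ψ v.1 i v.2.1 ≤ τ ∧ occ K Ψ v.1 i v.2.2 ≤ τ

/-- Demanding goodness at both ends makes the condition invariant under `turn`, so that the pruned
matrix stays symmetric. -/
def Incl (τ : ℕ) (v : Vert V) (e : Edge I P A) : Prop :=
  Full K Ψ v e ∧ Good K Ψ τ e.1 v ∧ Good K Ψ τ e.1 (nb K v e)

theorem incl_turn (τ : ℕ) (v : Vert V) (e : Edge I P A) :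
    Incl K Ψ τ (nb K v e) (rev K v e) ↔ Incl K Ψ τ v e := by
  simp only [Incl, full_turn, nb_rev]
  exact and_congr_right fun _ => and_comm

variable [Fintype I] [Fintype V]

open Classical in
/-- The pruned matrix. -/
noncomputable def mat (τ : ℕ) : Matrix (Vert V) (Vert V) ℝ := fun v v' =>
  ∑ e : Edge I P A, if Incl K Ψ τ v e ∧ nb K v e = v' then wgt K Ψ v e else 0

open Classical in
/-- The number of pruned edges. -/
noncomputable def lost (τ : ℕ) : ℕ :=
  (Finset.univ.filter fun q : Vert V × Edge I P A =>
    Full K Ψ q.1 q.2 ∧ ¬ Incl K Ψ τ q.1 q.2).card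

/-- The number of constraints. -/
def size : ℕ := ∑ i, (Finset.univ.filter fun c : A × A => (Ψ i c).isSome).card

-- The involution `turn` exchanges the two ends of every edge and preserves inclusion and weight.
open Classical in
theorem mat_transpose (τ : ℕ) : (mat K Ψ τ).transpose = mat K Ψ τ := by
  have key : ∀ v v', mat K Ψ τ v v' = ∑ q : Vert V × Edge I P A,
      if q.1 = v ∧ Incl K Ψ τ q.1 q.2 ∧ nb K q.1 q.2 = v' then wgt K Ψ q.1 q.2 else 0 := by
    intro v v'
    rw [Fintype.sum_prod_type, Finset.sum_eq_single v]
    · simp [mat]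
    · intro u _ hu
      simp [hu]
    · simp
  ext v' v
  rw [Matrix.transpose_apply, key v v', key v' v]
  refine Fintype.sum_equiv (turn K) _ _ fun q => ?_
  simp only [turn, Equiv.coe_fn_mk, incl_turn, nb_rev, wgt_turn]
  congr 1
  apply propext
  tauto

end defs

/-! ### Soundness of a trace bound, for every instance. -/

section soundness

variable {I V P A : Type} [Fintype I] [Fintype V] [Fintype P] [Fintype A]
  (K : Tape V P A) (Ψ : Inst I A)

open Classical in
theorem sum_rd {V P A : Type} [Fintype V] [Fintype A] (K : Tape V P A) {ν : ℕ} (hν : ∀ p a, (Finset.univ.filter fun s => K.rd s p = a).card = ν)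
    (p : P) (f : A → ℝ) : ∑ s, f (K.rd s p) = ν * ∑ a, f a := by
  rw [← Finset.sum_fiberwise Finset.univ (fun s => K.rd s p), Finset.mul_sum]
  refine Finset.sum_congr rfl fun a _ => ?_
  rw [Finset.sum_congr rfl (g := fun _ => f a), Finset.sum_const, hν, nsmul_eq_mul]
  intro s hs
  rw [(Finset.mem_filter.1 hs).2]

open Classical in
/-- Sums over all pairs of half edges at all vertices. -/
theorem sum_edges {ν : ℕ} (hν : ∀ p a, (Finset.univ.filter fun s => K.rd s p = a).card = ν)
    (f : I → A × A → A × A → ℝ) :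
    ∑ v : Vert V, ∑ e : Edge I P A, f e.1 (lab1 K v e) (lab2 K v e) =
      2 * (Fintype.card P * ν) ^ 2 * ∑ i, ∑ C, ∑ C', f i C C' := by
  have half : ∀ (c : Bool) (g : A × A → ℝ), ∑ s : V, ∑ q : P × A, g (lab c (K.rd s q.1) q.2) =
      Fintype.card P * ν * ∑ C, g C := by
    intro c g
    rw [Finset.sum_comm, Fintype.sum_prod_type]
    have h1 : ∀ p : P, ∑ b : A, ∑ s : V, g (lab c (K.rd s p) b) = ν * ∑ C, g C := by
      intro p
      have h2 : ∀ b : A, ∑ s : V, g (lab c (K.rd s p) b) = ν * ∑ a, g (lab c a b) :=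
        fun b => sum_rd K hν p fun a => g (lab c a b)
      rw [Finset.sum_congr rfl fun b _ => h2 b, ← Finset.mul_sum, Fintype.sum_prod_type]
      congr 1
      cases c
      · exact Finset.sum_comm
      · rfl
    rw [Finset.sum_congr rfl fun p _ => h1 p, Finset.sum_const, nsmul_eq_mul, Finset.card_univ,
      mul_assoc]
  have h3 : ∀ c : Bool, ∑ w : V × V, ∑ e : Edge I P A, f e.1 (lab1 K (c, w) e) (lab2 K (c, w) e) =
      (Fintype.card P * ν) ^ 2 * ∑ i, ∑ C, ∑ C', f i C C' := by
    intro c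
    rw [Finset.sum_comm, Fintype.sum_prod_type, Finset.mul_sum]
    refine Finset.sum_congr rfl fun i _ => ?_
    rw [Finset.sum_comm, Fintype.sum_prod_type]
    simp only [lab1, lab2]
    have h4 : ∀ s : V, ∑ s' : V, ∑ q : (P × A) × (P × A),
        f i (lab c (K.rd s q.1.1) q.1.2) (lab c (K.rd s' q.2.1) q.2.2) =
        Fintype.card P * ν * ∑ q : P × A, ∑ C', f i (lab c (K.rd s q.1) q.2) C' := by
      intro s
      rw [Finset.sum_comm, Fintype.sum_prod_type, Finset.mul_sum]
      refine Finset.sum_congr rfl fun q _ => ?_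
      rw [Finset.sum_comm]
      exact half c fun C' => f i (lab c (K.rd s q.1) q.2) C'
    rw [Finset.sum_congr rfl fun s _ => h4 s, ← Finset.mul_sum, half c fun C => ∑ C', f i C C']
    ring
  rw [Fintype.sum_prod_type, Fintype.sum_bool, h3, h3]
  ring

variable {K Ψ}

open Classical in
/-- A bound for the trace bounds the values of the odd form. -/
theorem sq_le_of_trace_le {ν : ℕ}
    (hν : ∀ p a, (Finset.univ.filter fun s => K.rd s p = a).card = ν)
    {χA : A → ℝ} {χV : V → ℝ} {y : I → ℝ} (hA : ∀ a, χA a * χA a = 1) (hV : ∀ s, χV s * χV s = 1)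
    (hy : ∀ i, y i * y i = 1) (hwr : ∀ s p b, χV (K.wr s p b) = χV s * χA (K.rd s p) * χA b)
    {τ L θ : ℕ} (hL : L ≠ 0) (htr : (mat K Ψ τ ^ (2 * L)).trace ≤ (θ : ℝ) ^ (2 * L)) :
    2 * (Fintype.card P * ν : ℝ) ^ 2 *
      (∑ i, y i * ∑ C : A × A, sgn (Ψ i C) * χA C.1 * χA C.2) ^ 2 ≤
    Fintype.card I * (2 * (Fintype.card P * ν : ℝ) ^ 2 * size Ψ +
      θ * (2 * (Fintype.card V : ℝ) ^ 2) + lost K Ψ τ) := by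
  set g : I → A × A → ℝ := fun i C => sgn (Ψ i C) * χA C.1 * χA C.2 with hg
  set E : ℝ := 2 * (Fintype.card P * ν : ℝ) ^ 2 with hE
  have hEn : 0 ≤ E := by positivity
  -- Cauchy–Schwarz eliminates the odd factor, as the squares of `y` sum to the number of indices.
  have cs : (∑ i, y i * ∑ C, g i C) ^ 2 ≤ Fintype.card I * ∑ i, (∑ C, g i C) ^ 2 := by
    refine (Finset.sum_mul_sq_le_sq_mul_sq _ _ _).trans (le_of_eq ?_)
    congr 1
    simp [sq, hy]
  have hdiag : ∀ i C, g i C * g i C = if (Ψ i C).isSome then 1 else 0 := by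
    intro i C
    rw [← sgn_sq]
    calc g i C * g i C = sgn (Ψ i C) * sgn (Ψ i C) * (χA C.1 * χA C.1) * (χA C.2 * χA C.2) := by
          rw [hg]; ring
      _ = _ := by rw [hA, hA]; ring
  have hsplit : ∑ i, (∑ C, g i C) ^ 2 =
      size Ψ + ∑ i, ∑ C, ∑ C', if C ≠ C' then g i C * g i C' else 0 := by
    rw [size, Nat.cast_sum, ← Finset.sum_add_distrib]
    refine Finset.sum_congr rfl fun i _ => ?_
    rw [Finset.card_filter, Nat.cast_sum, ← Finset.sum_add_distrib, sq, Finset.sum_mul_sum]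
    refine Finset.sum_congr rfl fun C _ => ?_
    have : ∀ C', g i C * g i C' = (if C = C' then g i C * g i C' else 0) +
        if C ≠ C' then g i C * g i C' else 0 := fun C' => by by_cases h : C = C' <;> simp [h]
    rw [Finset.sum_congr rfl fun C' _ => this C', Finset.sum_add_distrib]
    congr 1
    rw [Finset.sum_ite_eq]
    simp [hdiag]
  set χ : Vert V → ℝ := fun v => χV v.2.1 * χV v.2.2 with hχ
  have hχ1 : ∀ v, χ v * χ v = 1 := fun v => by
    calc χ v * χ v = (χV v.2.1 * χV v.2.1) * (χV v.2.2 * χV v.2.2) := by rw [hχ]; ring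
      _ = 1 := by rw [hV, hV, one_mul]
  have hlab : ∀ (c : Bool) (a b : A), χA (lab c a b).1 * χA (lab c a b).2 = χA a * χA b := by
    intro c a b
    cases c
    · rfl
    · exact mul_comm _ _
  -- A write multiplies the character of a tape by those of the old and the new value, which
  -- together form the label. All other factors occur squared.
  have hstep : ∀ (v : Vert V) (e : Edge I P A), wgt K Ψ v e * (χ v * χ (nb K v e)) =
      g e.1 (lab1 K v e) * g e.1 (lab2 K v e) := by
    intro v e
    have h1 := hlab v.1 (K.rd v.2.1 e.2.1.1) e.2.1.2
    have h2 := hlab v.1 (K.rd v.2.2 e.2.2.1) e.2.2.2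
    calc wgt K Ψ v e * (χ v * χ (nb K v e))
        = wgt K Ψ v e * ((χV v.2.1 * χV v.2.1) * (χV v.2.2 * χV v.2.2) *
          (χA (K.rd v.2.1 e.2.1.1) * χA e.2.1.2) * (χA (K.rd v.2.2 e.2.2.1) * χA e.2.2.2)) := by
          simp only [hχ, nb, hwr]; ring
      _ = wgt K Ψ v e * ((χA (K.rd v.2.1 e.2.1.1) * χA e.2.1.2) *
          (χA (K.rd v.2.2 e.2.2.1) * χA e.2.2.2)) := by rw [hV, hV]; ring
      _ = _ := by rw [← h1, ← h2]; simp only [wgt, hg, lab1, lab2]; ring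
  have hwgt : ∀ v e, |wgt K Ψ v e * (χ v * χ (nb K v e))| ≤ 1 := by
    intro v e
    have h1 : |χ v * χ (nb K v e)| = 1 := by
      have : (χ v * χ (nb K v e)) ^ 2 = 1 ^ 2 := by
        calc (χ v * χ (nb K v e)) ^ 2 = (χ v * χ v) * (χ (nb K v e) * χ (nb K v e)) := by ring
          _ = _ := by rw [hχ1, hχ1]; norm_num
      simpa using (sq_eq_sq_iff_abs_eq_abs _ _).1 this
    rw [abs_mul, h1, mul_one, wgt, abs_mul]
    exact mul_le_one₀ (abs_sgn_le _) (abs_nonneg _) (abs_sgn_le _)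
  have hall := sum_edges (I := I) K hν fun i C C' => if C ≠ C' then g i C * g i C' else 0
  have hmat : dotProduct χ ((mat K Ψ τ).mulVec χ) = ∑ v : Vert V, ∑ e : Edge I P A,
      if Incl K Ψ τ v e then wgt K Ψ v e * (χ v * χ (nb K v e)) else 0 := by
    simp only [dotProduct, Matrix.mulVec, mat]
    refine Finset.sum_congr rfl fun v _ => ?_
    simp only [Finset.mul_sum, Finset.sum_mul]
    rw [Finset.sum_comm]
    refine Finset.sum_congr rfl fun e _ => ?_
    rw [Finset.sum_eq_single (nb K v e)]
    · by_cases h : Incl K Ψ τ v e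
      · simp [h]; ring
      · simp [h]
    · intro u _ hu
      simp [hu.symm]
    · simp
  have hquad := dotProduct_mulVec_le (mat_transpose K Ψ τ) hL (Nat.cast_nonneg θ) htr χ
  have hχχ : dotProduct χ χ = 2 * (Fintype.card V : ℝ) ^ 2 := by
    simp only [dotProduct, hχ1]
    simp [sq]
  -- Every pair of present constraints is either on an included edge, hence in the quadratic form,
  -- or on a pruned edge, where it costs at most 1.
  have hdiff : ∑ v : Vert V, ∑ e : Edge I P A, (if lab1 K v e ≠ lab2 K v e then
      g e.1 (lab1 K v e) * g e.1 (lab2 K v e) else 0) ≤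
      dotProduct χ ((mat K Ψ τ).mulVec χ) + lost K Ψ τ := by
    have hl : lost K Ψ τ = ∑ v : Vert V, ∑ e : Edge I P A,
        if Full K Ψ v e ∧ ¬ Incl K Ψ τ v e then 1 else 0 := by
      rw [lost, Finset.card_filter]
      exact Fintype.sum_prod_type _
    rw [hmat, hl, Nat.cast_sum,
      ← Finset.sum_add_distrib]
    refine Finset.sum_le_sum fun v _ => ?_
    rw [Nat.cast_sum, ← Finset.sum_add_distrib]
    refine Finset.sum_le_sum fun e _ => ?_
    by_cases h1 : Incl K Ψ τ v e
    · have h2 : lab1 K v e ≠ lab2 K v e := h1.1.1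
      simp [h1, h2, hstep]
    · by_cases h2 : Full K Ψ v e
      · have h3 : lab1 K v e ≠ lab2 K v e := h2.1
        have h4 := (le_abs_self _).trans (hwgt v e)
        rw [hstep] at h4
        simpa [h1, h2, h3] using h4
      · simp only [h1, h2, if_false, false_and, Nat.cast_zero, add_zero]
        refine le_of_eq (ite_eq_right_iff.2 fun h3 => ?_)
        have h4 : ¬ (Ψ e.1 (lab1 K v e)).isSome ∨ ¬ (Ψ e.1 (lab2 K v e)).isSome := by
          by_contra! h5
          exact h2 ⟨h3, h5⟩
        rcases h4 with h4 | h4 <;> simp [hg, sgn_eq_zero h4]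
  rw [hall] at hdiff
  rw [hχχ] at hquad
  calc E * (∑ i, y i * ∑ C, g i C) ^ 2
      ≤ E * (Fintype.card I * ∑ i, (∑ C, g i C) ^ 2) := mul_le_mul_of_nonneg_left cs hEn
    _ = Fintype.card I * (E * size Ψ +
        E * ∑ i, ∑ C, ∑ C', if C ≠ C' then g i C * g i C' else 0) := by rw [hsplit]; ring
    _ ≤ _ := by
        refine mul_le_mul_of_nonneg_left ?_ (Nat.cast_nonneg _)
        linarith

end soundness

end Kikuchi

/-! ### Expectation over independent slots, and the number of constraints. -/

namespace Kikuchi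

/-- Flip the signs of the constraints. -/
def flip {I J : Type} (ε : I → J → ℤˣ) (Ψ : I → J → Option ℤˣ) : I → J → Option ℤˣ :=
  fun i j => (Ψ i j).map (ε i j * ·)

theorem flip_flip {I J : Type} (ε : I → J → ℤˣ) (Ψ : I → J → Option ℤˣ) : flip ε (flip ε Ψ) = Ψ := by
  funext i j
  rcases h : Ψ i j with _ | η
  · simp [flip, h]
  · simp [flip, h, ← mul_assoc, Int.units_mul_self]

section expectation

open Classical

variable {I J : Type} [Fintype I] [Fintype J]

/-- Weight of a family of slots, indexed by pairs. -/
noncomputable def wt (p : ℝ) (Ψ : I → J → Option ℤˣ) : ℝ :=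
  ∏ i, ∏ j, KXor.slotWeight p (Ψ i j)

/-- Expectation over independent slots. -/
noncomputable def ex (p : ℝ) (f : (I → J → Option ℤˣ) → ℝ) : ℝ := ∑ Ψ, wt p Ψ * f Ψ

/-- Probability over independent slots. -/
noncomputable def pr (p : ℝ) (E : (I → J → Option ℤˣ) → Prop) : ℝ :=
  ex p fun Ψ => if E Ψ then 1 else 0

theorem slotWeight_nonneg {p : ℝ} (h0 : 0 ≤ p) (h1 : p ≤ 1) (o : Option ℤˣ) :
    0 ≤ KXor.slotWeight p o := by
  rcases o with _ | η <;> simp only [KXor.slotWeight] <;> linarith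

theorem wt_nonneg {p : ℝ} (h0 : 0 ≤ p) (h1 : p ≤ 1) (Ψ : I → J → Option ℤˣ) : 0 ≤ wt p Ψ :=
  Finset.prod_nonneg fun _ _ => Finset.prod_nonneg fun _ _ => slotWeight_nonneg h0 h1 _

theorem sum_slotWeight_mul (p : ℝ) (g : Option ℤˣ → ℝ) : ∑ o, KXor.slotWeight p o * g o =
    (1 - p) * g none + p / 2 * (g (some 1) + g (some (-1))) := by
  have : (Finset.univ : Finset ℤˣ) = {1, -1} := by ext x; simp [Int.units_eq_one_or x]
  rw [Fintype.sum_option, this, Finset.sum_pair (by decide)]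
  simp only [KXor.slotWeight]
  ring

theorem ex_prod (p : ℝ) (G : I → (J → Option ℤˣ) → ℝ) :
    ex p (fun Ψ => ∏ i, G i (Ψ i)) =
      ∏ i, ∑ φ : J → Option ℤˣ, (∏ j, KXor.slotWeight p (φ j)) * G i φ := by
  rw [Finset.prod_univ_sum, Fintype.piFinset_univ]
  simp only [ex, wt, Finset.prod_mul_distrib]

theorem ex_prod_prod (p : ℝ) (g : I → J → Option ℤˣ → ℝ) :
    ex p (fun Ψ => ∏ i, ∏ j, g i j (Ψ i j)) =
      ∏ i, ∏ j, ∑ o, KXor.slotWeight p o * g i j o := by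
  rw [ex_prod p fun i φ => ∏ j, g i j (φ j)]
  refine Finset.prod_congr rfl fun i _ => ?_
  rw [Finset.prod_univ_sum, Fintype.piFinset_univ]
  simp only [Finset.prod_mul_distrib]

theorem ex_one (p : ℝ) : ex p (fun _ : I → J → Option ℤˣ => 1) = 1 := by
  have := ex_prod_prod p fun (_ : I) (_ : J) _ => 1
  simp only [sum_slotWeight_mul, Finset.prod_const_one] at this
  rw [this]
  refine Finset.prod_eq_one fun i _ => Finset.prod_eq_one fun j _ => ?_
  ring

theorem ex_add (p : ℝ) (f g : (I → J → Option ℤˣ) → ℝ) :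
    ex p (fun Ψ => f Ψ + g Ψ) = ex p f + ex p g := by
  simp only [ex, mul_add, Finset.sum_add_distrib]

theorem ex_mul_left (p c : ℝ) (f : (I → J → Option ℤˣ) → ℝ) :
    ex p (fun Ψ => c * f Ψ) = c * ex p f := by
  simp only [ex, Finset.mul_sum]
  exact Finset.sum_congr rfl fun _ _ => by ring

theorem ex_sum {ι : Type*} (p : ℝ) (s : Finset ι) (f : ι → (I → J → Option ℤˣ) → ℝ) :
    ex p (fun Ψ => ∑ x ∈ s, f x Ψ) = ∑ x ∈ s, ex p (f x) := by
  simp only [ex, Finset.mul_sum]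
  exact Finset.sum_comm

theorem ex_mono {p : ℝ} (h0 : 0 ≤ p) (h1 : p ≤ 1) {f g : (I → J → Option ℤˣ) → ℝ}
    (h : ∀ Ψ, f Ψ ≤ g Ψ) : ex p f ≤ ex p g :=
  Finset.sum_le_sum fun Ψ _ => mul_le_mul_of_nonneg_left (h Ψ) (wt_nonneg h0 h1 Ψ)

theorem ex_const (p c : ℝ) : ex p (fun _ : I → J → Option ℤˣ => c) = c := by
  have := ex_mul_left p c fun _ : I → J → Option ℤˣ => 1
  simpa [ex_one] using this

theorem pr_mono {p : ℝ} (h0 : 0 ≤ p) (h1 : p ≤ 1) {E F : (I → J → Option ℤˣ) → Prop}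
    (h : ∀ Ψ, E Ψ → F Ψ) : pr p E ≤ pr p F := by
  refine ex_mono h0 h1 fun Ψ => ?_
  by_cases hE : E Ψ
  · simp [hE, h Ψ hE]
  · by_cases hF : F Ψ <;> simp [hE, hF]

theorem pr_or_le {p : ℝ} (h0 : 0 ≤ p) (h1 : p ≤ 1) (E F : (I → J → Option ℤˣ) → Prop) :
    pr p (fun Ψ => E Ψ ∨ F Ψ) ≤ pr p E + pr p F := by
  rw [pr, pr, pr, ← ex_add]
  refine ex_mono h0 h1 fun Ψ => ?_
  by_cases hE : E Ψ <;> by_cases hF : F Ψ <;> simp [hE, hF]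

theorem pr_exists_le {ι : Type*} [Fintype ι] {p : ℝ} (h0 : 0 ≤ p) (h1 : p ≤ 1)
    (E : ι → (I → J → Option ℤˣ) → Prop) : pr p (fun Ψ => ∃ x, E x Ψ) ≤ ∑ x, pr p (E x) := by
  simp only [pr]
  rw [← ex_sum]
  refine ex_mono h0 h1 fun Ψ => ?_
  by_cases h : ∃ x, E x Ψ
  · obtain ⟨x, hx⟩ := h
    have h2 : ∃ x, E x Ψ := ⟨x, hx⟩
    rw [if_pos h2]
    refine le_trans ?_ (Finset.single_le_sum (f := fun x => if E x Ψ then (1 : ℝ) else 0)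
      (fun _ _ => by positivity) (Finset.mem_univ x))
    simp [hx]
  · rw [if_neg h]
    exact Finset.sum_nonneg fun _ _ => by positivity

theorem pr_not (p : ℝ) (E : (I → J → Option ℤˣ) → Prop) : pr p (fun Ψ => ¬ E Ψ) = 1 - pr p E := by
  have h : pr p (fun Ψ => ¬ E Ψ) + pr p E = 1 := by
    rw [pr, pr, ← ex_add]
    refine Eq.trans ?_ (ex_one (I := I) (J := J) p)
    refine congrArg (ex p) (funext fun Ψ => ?_)
    by_cases hE : E Ψ <;> simp [hE]
  linarith

theorem markov {p : ℝ} (h0 : 0 ≤ p) (h1 : p ≤ 1) {f : (I → J → Option ℤˣ) → ℝ} (hf : ∀ Ψ, 0 ≤ f Ψ)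
    {t : ℝ} (ht : 0 < t) {E : (I → J → Option ℤˣ) → Prop} (hE : ∀ Ψ, E Ψ → t ≤ f Ψ) :
    pr p E ≤ ex p f / t := by
  rw [le_div_iff₀ ht, mul_comm, pr, ← ex_mul_left]
  refine ex_mono h0 h1 fun Ψ => ?_
  by_cases h : E Ψ
  · simpa [h] using hE Ψ h
  · simpa [h] using hf Ψ

/-- The probability that all slots of a given set carry constraints. -/
theorem pr_forall_isSome (p : ℝ) (U : Finset (I × J)) :
    pr p (fun Ψ : I → J → Option ℤˣ => ∀ u ∈ U, (Ψ u.1 u.2).isSome) = p ^ U.card := by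
  have h1 : ∀ Ψ : I → J → Option ℤˣ, (if ∀ u ∈ U, (Ψ u.1 u.2).isSome then (1 : ℝ) else 0) =
      ∏ i, ∏ j, if (i, j) ∈ U then (if (Ψ i j).isSome then 1 else 0) else 1 := by
    intro Ψ
    rw [← Fintype.prod_prod_type' fun i j => if (i, j) ∈ U then
      (if (Ψ i j).isSome then (1 : ℝ) else 0) else 1, Finset.prod_ite_mem, Finset.univ_inter]
    by_cases h : ∀ u ∈ U, (Ψ u.1 u.2).isSome
    · rw [if_pos h]
      refine (Finset.prod_eq_one fun u hu => ?_).symm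
      simp [h u hu]
    · rw [if_neg h]
      push Not at h
      obtain ⟨u, hu, hu'⟩ := h
      refine (Finset.prod_eq_zero hu ?_).symm
      simp [hu']
  rw [pr]
  refine (congrArg (ex p) (funext fun Ψ => ?_ : _ = fun Ψ : I → J → Option ℤˣ => ∏ i, ∏ j,
    if (i, j) ∈ U then (if (Ψ i j).isSome then (1 : ℝ) else 0) else 1)).trans ?_
  · rw [← h1]
    congr
  rw [ex_prod_prod p fun i j o => if (i, j) ∈ U then (if o.isSome then 1 else 0) else 1]
  have h2 : ∀ i j, (∑ o, KXor.slotWeight p o *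
      if (i, j) ∈ U then (if o.isSome then 1 else 0) else 1) = if (i, j) ∈ U then p else 1 := by
    intro i j
    rw [sum_slotWeight_mul]
    by_cases h : (i, j) ∈ U
    · simp [h]; ring
    · simp [h]; ring
  simp only [h2]
  rw [← Fintype.prod_prod_type' fun i j => if (i, j) ∈ U then p else 1, Finset.prod_ite_mem,
    Finset.univ_inter, Finset.prod_const]

theorem wt_flip (p : ℝ) (ε : I → J → ℤˣ) (Ψ : I → J → Option ℤˣ) : wt p (flip ε Ψ) = wt p Ψ := by
  refine Finset.prod_congr rfl fun i _ => Finset.prod_congr rfl fun j _ => ?_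
  rcases h : Ψ i j with _ | η <;> simp [flip, h, KXor.slotWeight]

theorem ex_flip (p : ℝ) (ε : I → J → ℤˣ) (f : (I → J → Option ℤˣ) → ℝ) :
    ex p (fun Ψ => f (flip ε Ψ)) = ex p f := by
  refine Fintype.sum_equiv ⟨flip ε, flip ε, flip_flip ε, flip_flip ε⟩ _ _ fun Ψ => ?_
  simp [wt_flip]

/-- Average over independent uniform signs. -/
noncomputable def avg (f : (I → J → ℤˣ) → ℝ) : ℝ :=
  (Fintype.card (I → J → ℤˣ) : ℝ)⁻¹ * ∑ ε, f ε

/-- The law of a slot is invariant under flipping its sign, so the signs can be averaged first while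
the set of present constraints is kept fixed. -/
theorem ex_eq_ex_avg (p : ℝ) (f : (I → J → Option ℤˣ) → ℝ) :
    ex p f = ex p fun Ψ => avg fun ε => f (flip ε Ψ) := by
  simp only [avg]
  rw [ex_mul_left, ex_sum, Finset.sum_congr rfl fun ε _ => ex_flip p ε f, Finset.sum_const,
    Finset.card_univ, nsmul_eq_mul, ← mul_assoc, inv_mul_cancel₀ (by positivity), one_mul]

/-- Second moment bound for the number of constraints. -/
theorem pr_size_lt {p : ℝ} (h0 : 0 < p) (h1 : p ≤ 1) [Nonempty I] [Nonempty J] :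
    pr p (fun Ψ : I → J → Option ℤˣ =>
      ((∑ i, (Finset.univ.filter fun j => (Ψ i j).isSome).card : ℕ) : ℝ) <
        p * (Fintype.card I * Fintype.card J) / 2) ≤
      4 / (p * (Fintype.card I * Fintype.card J)) := by
  set M : ℝ := p * (Fintype.card I * Fintype.card J) with hM
  have hMpos : 0 < M := by positivity
  set S : (I → J → Option ℤˣ) → ℝ := fun Ψ =>
    ∑ u : I × J, if (Ψ u.1 u.2).isSome then 1 else 0 with hS
  have hsize : ∀ Ψ : I → J → Option ℤˣ,
      ((∑ i, (Finset.univ.filter fun j => (Ψ i j).isSome).card : ℕ) : ℝ) = S Ψ := by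
    intro Ψ
    rw [hS]
    simp only [Fintype.sum_prod_type]
    push_cast [Finset.card_filter]
    rfl
  have e1 : ex p S = M := by
    rw [hS, ex_sum]
    have : ∀ u : I × J, ex p (fun Ψ => if (Ψ u.1 u.2).isSome then (1 : ℝ) else 0) = p := fun u => by
      have := pr_forall_isSome p {u}
      simpa [pr] using this
    simp [this, hM]
    ring
  have e2 : ex p (fun Ψ => S Ψ ^ 2) ≤ M ^ 2 + M := by
    have h2 : ∀ u v : I × J, ex p (fun Ψ => (if (Ψ u.1 u.2).isSome then (1 : ℝ) else 0) *
        (if (Ψ v.1 v.2).isSome then (1 : ℝ) else 0)) ≤ p ^ 2 + if u = v then p else 0 := by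
      intro u v
      have := pr_forall_isSome p {u, v}
      have h3 : ex p (fun Ψ => (if (Ψ u.1 u.2).isSome then (1 : ℝ) else 0) *
          (if (Ψ v.1 v.2).isSome then (1 : ℝ) else 0)) = p ^ Finset.card {u, v} := by
        rw [← this, pr]
        congr 1
        ext Ψ
        by_cases a : (Ψ u.1 u.2).isSome <;> by_cases b : (Ψ v.1 v.2).isSome <;> simp [a, b]
      rw [h3]
      by_cases h : u = v
      · simp [h]; positivity
      · simp [h, Finset.card_pair h]
    have h4 : ex p (fun Ψ => S Ψ ^ 2) = ∑ u : I × J, ∑ v : I × J,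
        ex p (fun Ψ => (if (Ψ u.1 u.2).isSome then (1 : ℝ) else 0) *
        (if (Ψ v.1 v.2).isSome then (1 : ℝ) else 0)) := by
      simp only [hS, sq, Finset.sum_mul_sum]
      rw [ex_sum]
      exact Finset.sum_congr rfl fun u _ => ex_sum p _ _
    rw [h4]
    refine (Finset.sum_le_sum fun u _ => Finset.sum_le_sum fun v _ => h2 u v).trans (le_of_eq ?_)
    simp [Finset.sum_add_distrib, hM]
    ring
  have e3 : ex p (fun Ψ => (S Ψ - M) ^ 2) ≤ M := by
    have : ex p (fun Ψ => (S Ψ - M) ^ 2) = ex p (fun Ψ => S Ψ ^ 2) + (-2 * M) * ex p S + M ^ 2 := by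
      conv_rhs => rw [← ex_const (I := I) (J := J) p (M ^ 2)]
      rw [← ex_mul_left, ← ex_add, ← ex_add]
      refine congrArg (ex p) (funext fun Ψ => ?_)
      ring
    rw [this, e1]
    linarith
  -- Chebyshev: a count below M / 2 deviates from the mean M by more than M / 2.
  refine (markov h0.le h1 (f := fun Ψ => (S Ψ - M) ^ 2) (fun _ => sq_nonneg _)
    (t := M ^ 2 / 4) (by positivity) fun Ψ h => ?_).trans ?_
  · rw [hsize] at h
    nlinarith
  · rw [div_le_div_iff₀ (by positivity) hMpos]
    nlinarith

end expectation

end Kikuchi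

/-! ### The trace method with random signs. -/

namespace Kikuchi

section signs

open Classical

variable {I J : Type}

/-- The product of the signs along a list of slots. -/
def signs (H : List (I × J)) (ε : I → J → ℤˣ) : ℝ := ((H.map fun u => ε u.1 u.2).prod : ℤ)

theorem abs_signs (H : List (I × J)) (ε : I → J → ℤˣ) : |signs H ε| = 1 := by
  rcases Int.units_eq_one_or (H.map fun u => ε u.1 u.2).prod with h | h <;> simp [signs, h]

variable [Fintype I] [Fintype J]

theorem avg_mul_left (c : ℝ) (f : (I → J → ℤˣ) → ℝ) : avg (fun ε => c * f ε) = c * avg f := by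
  simp only [avg, ← Finset.mul_sum]
  ring

theorem avg_sum {ι : Type*} (s : Finset ι) (f : ι → (I → J → ℤˣ) → ℝ) :
    avg (fun ε => ∑ x ∈ s, f x ε) = ∑ x ∈ s, avg (f x) := by
  simp only [avg, ← Finset.mul_sum]
  rw [Finset.sum_comm]

theorem abs_avg_signs_le (H : List (I × J)) : |avg (signs H)| ≤ 1 := by
  rw [avg, abs_mul, abs_of_nonneg (by positivity)]
  refine (mul_le_mul_of_nonneg_left (Finset.abs_sum_le_sum_abs _ _) (by positivity)).trans ?_
  simp [abs_signs]

/-- Flipping the sign of the slot `u` alone negates the product, so the terms cancel in pairs. -/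
theorem avg_signs_eq_zero [DecidableEq (I × J)] {H : List (I × J)} {u : I × J} (hu : H.count u = 1) :
    avg (signs H) = 0 := by
  set δ : I → J → ℤˣ := fun i j => if (i, j) = u then -1 else 1 with hδ
  have h1 : (H.map fun w => δ w.1 w.2).prod = -1 := by
    have : ∀ G : List (I × J), (G.map fun w => δ w.1 w.2).prod = (-1) ^ G.count u := by
      intro G
      induction G with
      | nil => simp
      | cons w G ih =>
        rw [List.map_cons, List.prod_cons, ih, List.count_cons]
        by_cases h : w = u
        · simp [hδ, h, pow_succ]
        · simp [hδ, h]
    rw [this, hu, pow_one]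
  have h2 : ∀ ε, signs H (δ * ε) = - signs H ε := by
    intro ε
    have : (H.map fun w => (δ * ε) w.1 w.2).prod = - (H.map fun w => ε w.1 w.2).prod := by
      simp only [Pi.mul_apply]
      rw [List.prod_map_mul, h1, neg_one_mul]
    rw [signs, this, signs]
    push_cast
    ring
  have h3 : ∑ ε, signs H ε = - ∑ ε, signs H ε := by
    conv_lhs => rw [← Equiv.sum_comp (Equiv.mulLeft δ)]
    simp [h2]
  rw [avg, show ∑ ε, signs H ε = 0 by linarith, mul_zero]

/-- Otherwise every slot in the list would occur at least twice, and the list would be too long. -/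
theorem avg_signs_eq_zero_of_lt [DecidableEq (I × J)] {H : List (I × J)} (h : H.length < 2 * H.toFinset.card) :
    avg (signs H) = 0 := by
  by_contra hne
  have h1 : ∀ u ∈ H.toFinset, 2 ≤ H.count u := by
    intro u hu
    have h2 : 0 < H.count u := List.count_pos_iff.2 (List.mem_toFinset.1 hu)
    have h3 : H.count u ≠ 1 := fun h3 => hne (avg_signs_eq_zero h3)
    omega
  have h4 := Finset.card_nsmul_le_sum _ _ _ h1
  have h5 : ∑ u ∈ H.toFinset, H.count u = H.length := by
    convert List.sum_toFinset_count_eq_length H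
  rw [h5, smul_eq_mul] at h4
  omega

end signs

section trace

open Classical

variable {I V P A : Type} (K : Tape V P A) (Ψ : Inst I A)

theorem flip_isSome (ε : I → A × A → ℤˣ) (i : I) (c : A × A) :
    (flip ε Ψ i c).isSome = (Ψ i c).isSome := by simp [flip]

theorem sgn_flip (ε : I → A × A → ℤˣ) (i : I) (c : A × A) :
    sgn (flip ε Ψ i c) = ((ε i c : ℤ) : ℝ) * sgn (Ψ i c) := by
  rcases h : Ψ i c with _ | η <;> simp [flip, h, sgn]

variable [Fintype P] [Fintype A]

/-- Pruning depends only on which constraints are present. This is why the averaging over signs may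
treat the graph as fixed. -/
theorem incl_flip (ε : I → A × A → ℤˣ) (τ : ℕ) (v : Vert V) (e : Edge I P A) :
    Incl K (flip ε Ψ) τ v e ↔ Incl K Ψ τ v e := by
  simp only [Incl, Full, Good, occ, flip_isSome]

variable [Fintype I]

/-- The number of edges of the pruned graph at a vertex. -/
noncomputable def deg (τ : ℕ) (v : Vert V) : ℕ :=
  (Finset.univ.filter fun e : Edge I P A => Incl K Ψ τ v e).card

theorem deg_flip (ε : I → A × A → ℤˣ) (τ : ℕ) (v : Vert V) :
    deg K (flip ε Ψ) τ v = deg K Ψ τ v := by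
  simp only [deg, incl_flip]

/-- An edge of index `i` is a pair of half edges, and a good vertex has at most τ of them on each
tape. This is the purpose of pruning. -/
theorem card_incl_index_le (τ : ℕ) (v : Vert V) (i : I) :
    (Finset.univ.filter fun e : Edge I P A => Incl K Ψ τ v e ∧ e.1 = i).card ≤ τ ^ 2 := by
  by_cases hG : Good K Ψ τ i v
  · rw [sq]
    refine le_trans ?_ (Nat.mul_le_mul hG.1 hG.2)
    rw [occ, occ, ← Finset.card_product]
    refine Finset.card_le_card_of_injOn (fun e => e.2) ?_ ?_
    · intro e he
      simp only [Finset.coe_filter, Finset.mem_univ, true_and, Set.mem_ofPred_eq] at he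
      obtain ⟨⟨⟨_, h1, h2⟩, _⟩, rfl⟩ := he
      simpa using ⟨h1, h2⟩
    · intro e he e' he' h
      simp only [Finset.coe_filter, Finset.mem_univ, true_and, Set.mem_ofPred_eq] at he he'
      exact Prod.ext (he.2.trans he'.2.symm) h
  · rw [Finset.card_eq_zero.2]
    · exact Nat.zero_le _
    · refine Finset.filter_eq_empty_iff.2 fun e _ he => hG ?_
      rw [← he.2]
      exact he.1.2.1

theorem card_incl_seen_le (τ : ℕ) (v : Vert V) (H : List (I × (A × A))) :
    (Finset.univ.filter fun e : Edge I P A => Incl K Ψ τ v e ∧ e.1 ∈ H.map Prod.fst).card ≤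
      H.length * τ ^ 2 := by
  have h1 : (Finset.univ.filter fun e : Edge I P A => Incl K Ψ τ v e ∧ e.1 ∈ H.map Prod.fst) ⊆
      (H.map Prod.fst).toFinset.biUnion fun i =>
        Finset.univ.filter fun e : Edge I P A => Incl K Ψ τ v e ∧ e.1 = i := by
    intro e he
    rw [Finset.mem_filter] at he
    rw [Finset.mem_biUnion]
    exact ⟨e.1, List.mem_toFinset.2 he.2.2, Finset.mem_filter.2 ⟨he.1, he.2.1, rfl⟩⟩
  refine (Finset.card_le_card h1).trans ((Finset.card_biUnion_le_card_mul _ _ _ fun i _ =>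
    card_incl_index_le K Ψ τ v i).trans (Nat.mul_le_mul_right _ ?_))
  simpa using List.toFinset_card_le (H.map Prod.fst)

variable [Fintype V]

/-- Here `H` lists the slots read so far, two per step; `q` steps had a new index, `o` an old one,
and `t` steps remain. A new index allows at most α edges and contributes two new slots. An old index
allows at most 4Lτ² ≤ β edges. If the average survives, every slot is read twice, so q ≤ L.
Weighting the past by α^q β^o makes the induction on `t` lose only a factor 2 per step, one for each
kind of step. -/
theorem abs_avg_walk_le {τ L : ℕ} {α β : ℝ} (hβ : 0 < β) (hβα : β ≤ α)
    (hα : ∀ v, (deg K Ψ τ v : ℝ) ≤ α) (hβτ : 4 * (L : ℝ) * τ ^ 2 ≤ β) (v₀ : Vert V) (t : ℕ) :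
    ∀ (H : List (I × (A × A))) (q o : ℕ) (v : Vert V), H.length + 2 * t = 4 * L →
      2 * q ≤ H.toFinset.card → q + o + t = 2 * L →
      α ^ q * β ^ o * |avg fun ε => signs H ε * (mat K (flip ε Ψ) τ ^ t) v v₀| ≤
        2 ^ t * (α * β) ^ L := by
  have hα0 : 0 < α := hβ.trans_le hβα
  induction t with
  | zero =>
    intro H q o v hH hq ho
    have h1 : (avg fun ε => signs H ε * (mat K (flip ε Ψ) τ ^ 0) v v₀) =
        (if v = v₀ then 1 else 0) * avg (signs H) := by
      rw [← avg_mul_left]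
      simp only [pow_zero, Matrix.one_apply]
      congr 1
      ext ε
      ring
    rw [h1, abs_mul]
    have h2 : |if v = v₀ then (1 : ℝ) else 0| ≤ 1 := by split_ifs <;> simp
    by_cases hz : H.length < 2 * H.toFinset.card
    · rw [avg_signs_eq_zero_of_lt hz]
      simp only [abs_zero, mul_zero]
      positivity
    -- Now twice the number of distinct slots is at most 4L, which gives q ≤ L. Of the 2L − q
    -- factors β, r = L − q are raised to α.
    · obtain ⟨r, rfl⟩ : ∃ r, L = q + r := Nat.exists_eq_add_of_le (by omega)
      have ho' : o = q + r + r := by omega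
      calc α ^ q * β ^ o * (|if v = v₀ then (1 : ℝ) else 0| * |avg (signs H)|)
          ≤ α ^ q * β ^ o * (1 * 1) := by
            gcongr
            exact abs_avg_signs_le H
        _ = (α * β) ^ q * (β ^ r * β ^ r) := by rw [ho', mul_pow]; ring
        _ ≤ (α * β) ^ q * (α ^ r * β ^ r) := by gcongr
        _ = 2 ^ 0 * (α * β) ^ (q + r) := by rw [pow_add, mul_pow α β r]; ring
  | succ t ih =>
    intro H q o v hH hq ho
    set X : ℝ := 2 ^ t * (α * β) ^ L with hX
    have hXn : 0 ≤ X := by positivity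
    set nxt : Edge I P A → List (I × (A × A)) := fun e => (e.1, lab1 K v e) :: (e.1, lab2 K v e) :: H
      with hnxt
    set G : Edge I P A → ℝ := fun e =>
      avg fun ε => signs (nxt e) ε * (mat K (flip ε Ψ) τ ^ t) (nb K v e) v₀ with hG
    have h1 : (avg fun ε => signs H ε * (mat K (flip ε Ψ) τ ^ (t + 1)) v v₀) =
        ∑ e : Edge I P A, if Incl K Ψ τ v e then wgt K Ψ v e * G e else 0 := by
      have h2 : ∀ ε, signs H ε * (mat K (flip ε Ψ) τ ^ (t + 1)) v v₀ = ∑ e : Edge I P A,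
          (if Incl K Ψ τ v e then wgt K Ψ v e else 0) *
            (signs (nxt e) ε * (mat K (flip ε Ψ) τ ^ t) (nb K v e) v₀) := by
        intro ε
        rw [pow_succ', Matrix.mul_apply]
        simp only [mat, Finset.sum_mul, Finset.mul_sum]
        rw [Finset.sum_comm]
        refine Finset.sum_congr rfl fun e _ => ?_
        rw [Finset.sum_eq_single (nb K v e)]
        · by_cases h : Incl K Ψ τ v e
          · simp only [incl_flip, h, and_self, if_true, wgt, sgn_flip, signs, hnxt, List.map_cons,
              List.prod_cons, Units.val_mul, Int.cast_mul]
            ring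
          · simp [incl_flip, h]
        · intro u _ hu
          simp [hu.symm]
        · simp
      simp only [h2]
      rw [avg_sum]
      refine Finset.sum_congr rfl fun e _ => ?_
      rw [avg_mul_left]
      split_ifs <;> simp [hG]
    have hw : ∀ e, |wgt K Ψ v e * G e| ≤ |G e| := by
      intro e
      rw [abs_mul]
      refine mul_le_of_le_one_left (abs_nonneg _) ?_
      rw [wgt, abs_mul]
      exact mul_le_one₀ (abs_sgn_le _) (abs_nonneg _) (abs_sgn_le _)
    have hlen : ∀ e, (nxt e).length + 2 * t = 4 * L := by
      intro e
      simp only [hnxt, List.length_cons]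
      omega
    have hold : ∀ e, Incl K Ψ τ v e → e.1 ∈ H.map Prod.fst → α ^ q * β ^ o * |G e| ≤ X / β := by
      intro e he hm
      have h3 := ih (nxt e) q (o + 1) (nb K v e) (hlen e) (hq.trans (Finset.card_le_card ?_))
        (by omega)
      · rw [le_div_iff₀ hβ]
        refine le_trans (le_of_eq ?_) h3
        rw [pow_succ]
        ring
      · intro u hu
        simp only [hnxt, List.toFinset_cons, Finset.mem_insert]
        exact Or.inr (Or.inr hu)
    -- Neither slot of the edge is in `H`, since its index is new, and the two slots differ because
    -- the edge is full.
    have hnew : ∀ e, Incl K Ψ τ v e → e.1 ∉ H.map Prod.fst → α ^ q * β ^ o * |G e| ≤ X / α := by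
      intro e he hm
      have hnot : ∀ c, (e.1, c) ∉ H := fun c hc => hm (List.mem_map.2 ⟨_, hc, rfl⟩)
      have h3 := ih (nxt e) (q + 1) o (nb K v e) (hlen e) ?_ (by omega)
      · rw [le_div_iff₀ hα0]
        refine le_trans (le_of_eq ?_) h3
        rw [pow_succ]
        ring
      · simp only [hnxt, List.toFinset_cons]
        rw [Finset.card_insert_of_notMem, Finset.card_insert_of_notMem]
        · omega
        · simpa using hnot _
        · simp only [Finset.mem_insert, List.mem_toFinset, not_or]
          exact ⟨fun h => he.1.1 (Prod.ext_iff.1 h).2, hnot _⟩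
    have hterm : ∀ e : Edge I P A,
        α ^ q * β ^ o * |if Incl K Ψ τ v e then wgt K Ψ v e * G e else 0| ≤
        (if Incl K Ψ τ v e then X / α else 0) +
          if Incl K Ψ τ v e ∧ e.1 ∈ H.map Prod.fst then X / β else 0 := by
      intro e
      by_cases he : Incl K Ψ τ v e
      · have h4 : α ^ q * β ^ o * |wgt K Ψ v e * G e| ≤ α ^ q * β ^ o * |G e| :=
          mul_le_mul_of_nonneg_left (hw e) (by positivity)
        by_cases hm : e.1 ∈ H.map Prod.fst
        · have h5 := hold e he hm
          simp only [he, hm, and_self, if_true]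
          have : 0 ≤ X / α := by positivity
          linarith
        · have h5 := hnew e he hm
          simp only [he, hm, and_false, if_true, if_false]
          linarith
      · simp [he]
    rw [h1]
    calc α ^ q * β ^ o * |∑ e : Edge I P A, if Incl K Ψ τ v e then wgt K Ψ v e * G e else 0|
        ≤ α ^ q * β ^ o * ∑ e : Edge I P A, |if Incl K Ψ τ v e then wgt K Ψ v e * G e else 0| :=
          mul_le_mul_of_nonneg_left (Finset.abs_sum_le_sum_abs _ _) (by positivity)
      _ ≤ ∑ e : Edge I P A, ((if Incl K Ψ τ v e then X / α else 0) +
          if Incl K Ψ τ v e ∧ e.1 ∈ H.map Prod.fst then X / β else 0) := by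
          rw [Finset.mul_sum]
          exact Finset.sum_le_sum fun e _ => hterm e
      _ = deg K Ψ τ v * (X / α) + (Finset.univ.filter fun e : Edge I P A =>
            Incl K Ψ τ v e ∧ e.1 ∈ H.map Prod.fst).card * (X / β) := by
          rw [Finset.sum_add_distrib, ← Finset.sum_filter, ← Finset.sum_filter, Finset.sum_const,
            Finset.sum_const, nsmul_eq_mul, nsmul_eq_mul, deg]
      _ ≤ α * (X / α) + β * (X / β) := by
          gcongr
          · exact hα v
          · refine le_trans ?_ hβτ
            have h6 := card_incl_seen_le K Ψ τ v H
            have h7 : H.length ≤ 4 * L := by omega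
            calc ((Finset.univ.filter fun e : Edge I P A =>
                  Incl K Ψ τ v e ∧ e.1 ∈ H.map Prod.fst).card : ℝ)
                ≤ ((H.length * τ ^ 2 : ℕ) : ℝ) := by exact_mod_cast h6
              _ ≤ ((4 * L * τ ^ 2 : ℕ) : ℝ) := by exact_mod_cast Nat.mul_le_mul_right _ h7
              _ = 4 * (L : ℝ) * τ ^ 2 := by push_cast; ring
      _ = 2 ^ (t + 1) * (α * β) ^ L := by
          rw [mul_div_cancel₀ _ hα0.ne', mul_div_cancel₀ _ hβ.ne', hX]
          ring

theorem avg_trace_le {τ L : ℕ} {α β : ℝ} (hβ : 0 < β) (hβα : β ≤ α)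
    (hα : ∀ v, (deg K Ψ τ v : ℝ) ≤ α) (hβτ : 4 * (L : ℝ) * τ ^ 2 ≤ β) :
    (avg fun ε => (mat K (flip ε Ψ) τ ^ (2 * L)).trace) ≤
      Fintype.card (Vert V) * (4 * (α * β)) ^ L := by
  have h1 : ∀ v : Vert V, (avg fun ε => (mat K (flip ε Ψ) τ ^ (2 * L)) v v) ≤
      (4 * (α * β)) ^ L := by
    intro v
    have := abs_avg_walk_le K Ψ hβ hβα hα hβτ v (2 * L) [] 0 0 v (by simp; ring) (by simp) (by simp)
    simp only [pow_zero, mul_one, one_mul, signs, List.map_nil, List.prod_nil, Units.val_one,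
      Int.cast_one] at this
    refine (le_abs_self _).trans (this.trans (le_of_eq ?_))
    rw [pow_mul, mul_pow 4]
    norm_num
  simp only [Matrix.trace, Matrix.diag_apply]
  rw [avg_sum]
  refine (Finset.sum_le_sum fun v _ => h1 v).trans (le_of_eq ?_)
  rw [Finset.sum_const, nsmul_eq_mul, Finset.card_univ]

/-- An even power of a symmetric matrix is a Gram matrix. Markov's inequality needs this sign. -/
theorem trace_nonneg (τ L : ℕ) : 0 ≤ (mat K Ψ τ ^ (2 * L)).trace := by
  have h1 : (mat K Ψ τ ^ L).transpose = mat K Ψ τ ^ L := by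
    rw [Matrix.transpose_pow, mat_transpose]
  have h2 : mat K Ψ τ ^ (2 * L) = (mat K Ψ τ ^ L).transpose * mat K Ψ τ ^ L := by
    rw [h1, two_mul, pow_add]
  rw [h2, Matrix.trace]
  refine Finset.sum_nonneg fun v _ => ?_
  rw [Matrix.diag_apply, Matrix.mul_apply]
  exact Finset.sum_nonneg fun u _ => by
    rw [Matrix.transpose_apply]
    exact mul_self_nonneg _

/-- The trace is small with high probability when all degrees are bounded. -/
theorem pr_trace_lt {p : ℝ} (h0 : 0 ≤ p) (h1 : p ≤ 1) {τ L : ℕ} {α β θ : ℝ} (hβ : 0 < β)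
    (hβα : β ≤ α) (hβτ : 4 * (L : ℝ) * τ ^ 2 ≤ β) (hθ : 0 < θ) :
    pr p (fun Ψ : Inst I A => (∀ v, (deg K Ψ τ v : ℝ) ≤ α) ∧
      θ ^ (2 * L) < (mat K Ψ τ ^ (2 * L)).trace) ≤
      Fintype.card (Vert V) * (4 * (α * β) / θ ^ 2) ^ L := by
  have hα0 : 0 < α := hβ.trans_le hβα
  set f : Inst I A → ℝ := fun Ψ =>
    if ∀ v, (deg K Ψ τ v : ℝ) ≤ α then (mat K Ψ τ ^ (2 * L)).trace else 0 with hf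
  have hf0 : ∀ Ψ, 0 ≤ f Ψ := fun Ψ => by
    rw [hf]
    dsimp only
    split_ifs
    · exact trace_nonneg K Ψ τ L
    · exact le_rfl
  refine (markov h0 h1 hf0 (t := θ ^ (2 * L)) (by positivity) fun Ψ h => ?_).trans ?_
  · rw [hf]
    dsimp only
    rw [if_pos h.1]
    exact h.2.le
  · have h2 : ex p f ≤ Fintype.card (Vert V) * (4 * (α * β)) ^ L := by
      -- The degree condition is invariant under sign flips, so it is constant under the inner
      -- average.
      rw [ex_eq_ex_avg]
      refine (ex_mono h0 h1 (g := fun _ => Fintype.card (Vert V) * (4 * (α * β)) ^ L)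
        fun Ψ => ?_).trans (ex_const _ _).le
      simp only [hf, deg_flip]
      by_cases hd : ∀ v, (deg K Ψ τ v : ℝ) ≤ α
      · simp only [hd, implies_true, if_true]
        exact avg_trace_le K Ψ hβ hβα hd hβτ
      · simp only [hd, if_false, avg, Finset.sum_const_zero, mul_zero]
        positivity
    rw [div_pow, ← pow_mul, ← mul_div_assoc]
    gcongr

end trace

end Kikuchi

/-! ### Concentration of the degrees. -/

namespace Kikuchi

section independence

open Classical

variable {I J : Type} [Fintype I] [Fintype J]

theorem ex_apply (p : ℝ) (i : I) (g : (J → Option ℤˣ) → ℝ) :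
    ex p (fun Ψ : I → J → Option ℤˣ => g (Ψ i)) =
      ∑ φ : J → Option ℤˣ, (∏ j, KXor.slotWeight p (φ j)) * g φ := by
  have h1 := ex_prod p fun (i' : I) φ => if i' = i then g φ else 1
  have h2 : ∑ φ : J → Option ℤˣ, (∏ j, KXor.slotWeight p (φ j)) = 1 := by
    have := ex_one (I := Unit) (J := J) p
    have h3 := ex_prod (I := Unit) p fun _ (_ : J → Option ℤˣ) => (1 : ℝ)
    simp only [Finset.prod_const_one] at h3
    rw [this] at h3
    simpa using h3.symm
  have h4 : ∀ i' : I, (∑ φ : J → Option ℤˣ, (∏ j, KXor.slotWeight p (φ j)) *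
      if i' = i then g φ else 1) = if i' = i then
        ∑ φ : J → Option ℤˣ, (∏ j, KXor.slotWeight p (φ j)) * g φ else 1 := by
    intro i'
    split_ifs <;> simp [h2]
  simp only [h4] at h1
  rw [Finset.prod_ite_eq' Finset.univ i] at h1
  simp only [Finset.mem_univ, if_true] at h1
  rw [← h1]
  refine congrArg (ex p) (funext fun Ψ => ?_)
  rw [Finset.prod_ite_eq' Finset.univ i fun i' => g (Ψ i')]
  simp

theorem ex_prod_apply (p : ℝ) (G : I → (J → Option ℤˣ) → ℝ) :
    ex p (fun Ψ : I → J → Option ℤˣ => ∏ i, G i (Ψ i)) =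
      ∏ i, ex p (fun Ψ : I → J → Option ℤˣ => G i (Ψ i)) := by
  rw [ex_prod]
  exact Finset.prod_congr rfl fun i _ => (ex_apply p i (G i)).symm

theorem exp_le_one_add_two_mul {x : ℝ} (h0 : 0 ≤ x) (h1 : x ≤ 1) : Real.exp x ≤ 1 + 2 * x := by
  have h2 := Real.abs_exp_sub_one_sub_id_le (abs_le.2 ⟨by linarith, h1⟩)
  have h3 := (le_abs_self _).trans h2
  nlinarith

/-- An exponential moment bound for a sum of independent bounded variables. -/
theorem pr_lt_sum_le {p : ℝ} (h0 : 0 ≤ p) (h1 : p ≤ 1) (D : I → (J → Option ℤˣ) → ℝ) {M μ : ℝ}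
    (hM : 0 < M) (hD0 : ∀ i φ, 0 ≤ D i φ) (hDM : ∀ i φ, D i φ ≤ M)
    (hμ : ∀ i, ex p (fun Ψ : I → J → Option ℤˣ => D i (Ψ i)) ≤ μ) (α : ℝ) :
    pr p (fun Ψ : I → J → Option ℤˣ => α < ∑ i, D i (Ψ i)) ≤
      Real.exp ((2 * (Fintype.card I * μ) - α) / M) := by
  have hi : ∀ i, ex p (fun Ψ : I → J → Option ℤˣ => Real.exp (D i (Ψ i) / M)) ≤
      Real.exp (2 * (μ / M)) := by
    intro i
    have h2 : ex p (fun Ψ : I → J → Option ℤˣ => Real.exp (D i (Ψ i) / M)) ≤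
        ex p (fun Ψ : I → J → Option ℤˣ => 1 + 2 / M * D i (Ψ i)) := by
      refine ex_mono h0 h1 fun Ψ => ?_
      refine (exp_le_one_add_two_mul (div_nonneg (hD0 _ _) hM.le)
        ((div_le_one hM).2 (hDM _ _))).trans (le_of_eq (by ring))
    rw [ex_add, ex_const, ex_mul_left] at h2
    refine h2.trans ?_
    have h3 : 2 / M * ex p (fun Ψ : I → J → Option ℤˣ => D i (Ψ i)) ≤ 2 / M * μ :=
      mul_le_mul_of_nonneg_left (hμ i) (by positivity)
    have h4 := Real.add_one_le_exp (2 * (μ / M))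
    have h5 : 2 / M * μ = 2 * (μ / M) := by ring
    linarith
  refine (markov h0 h1 (f := fun Ψ => ∏ i, Real.exp (D i (Ψ i) / M))
    (fun Ψ => Finset.prod_nonneg fun _ _ => (Real.exp_pos _).le) (t := Real.exp (α / M))
    (Real.exp_pos _) fun Ψ h => ?_).trans ?_
  · rw [← Real.exp_sum, ← Finset.sum_div]
    exact Real.exp_le_exp.2 (div_le_div_of_nonneg_right h.le hM.le)
  · rw [ex_prod_apply p fun i φ => Real.exp (D i φ / M), sub_div, Real.exp_sub]
    refine div_le_div_of_nonneg_right ?_ (Real.exp_pos _).le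
    refine (Finset.prod_le_prod (fun i _ => ?_) fun i _ => hi i).trans (le_of_eq ?_)
    · rw [← ex_const (I := I) (J := J) p 0]
      exact ex_mono h0 h1 fun Ψ => (Real.exp_pos _).le
    · rw [Finset.prod_const, ← Real.exp_nat_mul, Finset.card_univ]
      congr 1
      ring

end independence

section degree

open Classical

variable {I V P A : Type} [Fintype P] [Fintype A] (K : Tape V P A)

/-- The pairs of half edges with a given index, where there are not too many of them. -/
noncomputable def loc (τ : ℕ) (v : Vert V) (φ : A × A → Option ℤˣ) : ℕ :=
  if Good K (fun _ : Unit => φ) τ () v then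
    (Finset.univ.filter fun q : (P × A) × (P × A) => Full K (fun _ : Unit => φ) v ((), q)).card
  else 0

theorem loc_le (τ : ℕ) (v : Vert V) (φ : A × A → Option ℤˣ) : loc K τ v φ ≤ τ ^ 2 := by
  rw [loc]
  split_ifs with hG
  · rw [sq]
    refine le_trans ?_ (Nat.mul_le_mul hG.1 hG.2)
    rw [occ, occ, ← Finset.card_product]
    refine Finset.card_le_card fun q hq => ?_
    simp only [Finset.mem_filter, Finset.mem_univ, true_and, Finset.mem_product] at hq ⊢
    exact hq.2
  · exact Nat.zero_le _

variable [Fintype I]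

/-- Goodness of the far end of the edge is dropped. Each summand then depends on the slots of a
single index, so the summands are independent. -/
theorem deg_le_sum_loc (Ψ : Inst I A) (τ : ℕ) (v : Vert V) :
    deg K Ψ τ v ≤ ∑ i, loc K τ v (Ψ i) := by
  have h1 : deg K Ψ τ v = ∑ i, (Finset.univ.filter fun q : (P × A) × (P × A) =>
      Incl K Ψ τ v (i, q)).card := by
    simp only [deg, Finset.card_filter]
    exact Fintype.sum_prod_type _
  rw [h1]
  refine Finset.sum_le_sum fun i _ => ?_
  rw [loc]
  split_ifs with hG
  · exact Finset.card_le_card (Finset.monotone_filter_right _ fun q _ hq => hq.1)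
  · rw [Finset.card_eq_zero.2]
    exact Finset.filter_eq_empty_iff.2 fun q _ hq => hG hq.2.1

theorem pr_isSome_pair (p : ℝ) {i : I} {C C' : A × A} (h : C ≠ C') :
    pr p (fun Ψ : Inst I A => (Ψ i C).isSome ∧ (Ψ i C').isSome) = p ^ 2 := by
  have := pr_forall_isSome (I := I) (J := A × A) p {(i, C), (i, C')}
  rw [Finset.card_pair (by simpa using h)] at this
  simpa using this

/-- There are (|P| |A|)² pairs of half edges, and two distinct slots are both present with
probability p². -/
theorem ex_loc_le {p : ℝ} (h0 : 0 ≤ p) (h1 : p ≤ 1) (τ : ℕ) (v : Vert V) (i : I) :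
    ex p (fun Ψ : Inst I A => (loc K τ v (Ψ i) : ℝ)) ≤
      (p * (Fintype.card P * Fintype.card A)) ^ 2 := by
  have h2 : ∀ Ψ : Inst I A, (loc K τ v (Ψ i) : ℝ) ≤
      ∑ q : (P × A) × (P × A), if Full K Ψ v (i, q) then (1 : ℝ) else 0 := by
    intro Ψ
    have : loc K τ v (Ψ i) ≤
        (Finset.univ.filter fun q : (P × A) × (P × A) => Full K Ψ v (i, q)).card := by
      rw [loc]
      split_ifs
      · exact le_rfl
      · exact Nat.zero_le _
    rw [← Nat.cast_one, ← Nat.cast_zero]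
    simp only [← Nat.cast_ite, ← Nat.cast_sum]
    rw [← Finset.card_filter]
    exact_mod_cast this
  refine (ex_mono h0 h1 h2).trans ?_
  rw [ex_sum]
  have h3 : ∀ q : (P × A) × (P × A),
      ex p (fun Ψ : Inst I A => if Full K Ψ v (i, q) then (1 : ℝ) else 0) ≤ p ^ 2 := by
    intro q
    by_cases hC : lab1 K v (i, q) = lab2 K v (i, q)
    · simp only [Full, hC, ne_eq, not_true_eq_false, false_and, if_false, ex_const]
      positivity
    · rw [← pr_isSome_pair (I := I) p (i := i) hC]
      exact pr_mono h0 h1 fun Ψ h => h.2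
  refine (Finset.sum_le_sum fun q _ => h3 q).trans (le_of_eq ?_)
  simp
  ring

/-- With high probability all degrees are bounded. -/
theorem pr_exists_lt_deg [Fintype V] {p : ℝ} (h0 : 0 ≤ p) (h1 : p ≤ 1) {τ : ℕ} (hτ : 0 < τ)
    (α : ℝ) : pr p (fun Ψ : Inst I A => ∃ v : Vert V, α < deg K Ψ τ v) ≤
      Fintype.card (Vert V) * Real.exp ((2 * (Fintype.card I *
        (p * (Fintype.card P * Fintype.card A)) ^ 2) - α) / (τ : ℝ) ^ 2) := by
  refine (pr_exists_le h0 h1 _).trans ?_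
  have h2 : ∀ v : Vert V, pr p (fun Ψ : Inst I A => α < deg K Ψ τ v) ≤
      Real.exp ((2 * (Fintype.card I *
        (p * (Fintype.card P * Fintype.card A)) ^ 2) - α) / (τ : ℝ) ^ 2) := by
    intro v
    refine le_trans (pr_mono h0 h1 fun Ψ h => ?_) (pr_lt_sum_le (I := I) h0 h1
      (fun _ φ => (loc K τ v φ : ℝ)) (by positivity) (fun _ _ => Nat.cast_nonneg _)
      (fun _ φ => by exact_mod_cast loc_le K τ v φ) (fun i => ex_loc_le K h0 h1 τ v i) α)
    refine h.trans_le ?_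
    exact_mod_cast deg_le_sum_loc K Ψ τ v
  refine (Finset.sum_le_sum fun v _ => h2 v).trans (le_of_eq ?_)
  rw [Finset.sum_const, nsmul_eq_mul, Finset.card_univ]

end degree

end Kikuchi

/-! ### The expected number of pruned edges. -/

namespace Kikuchi

section lost

open Classical

variable {I V P A : Type} (K : Tape V P A)

/-- Exchange of the two halves of a vertex and of an edge. -/
def swapHalves : Vert V × Edge I P A ≃ Vert V × Edge I P A where
  toFun q := ((q.1.1, q.1.2.2, q.1.2.1), (q.2.1, q.2.2.2, q.2.2.1))
  invFun q := ((q.1.1, q.1.2.2, q.1.2.1), (q.2.1, q.2.2.2, q.2.2.1))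
  left_inv _ := rfl
  right_inv _ := rfl

theorem full_swapHalves (Ψ : Inst I A) (q : Vert V × Edge I P A) :
    Full K Ψ (swapHalves q).1 (swapHalves q).2 ↔ Full K Ψ q.1 q.2 := by
  simp only [Full, swapHalves, Equiv.coe_fn_mk, lab1, lab2]
  exact ⟨fun h => ⟨h.1.symm, h.2.2, h.2.1⟩, fun h => ⟨h.1.symm, h.2.2, h.2.1⟩⟩

theorem lab_injective {c : Bool} {a b a' b' : A} :
    lab c a b = lab c a' b' ↔ a = a' ∧ b = b' := by
  cases c
  · exact Prod.mk_inj
  · exact Prod.mk_inj.trans and_comm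

variable [Fintype I] [Fintype V] [Fintype P] [Fintype A]

/-- Pruned edges are counted by triples of half edges. -/
theorem mul_lost_le (Ψ : Inst I A) (τ : ℕ) : τ * lost K Ψ τ ≤ 4 *
    ∑ q : Vert V × Edge I P A, if Full K Ψ q.1 q.2 then occ K Ψ q.1.1 q.2.1 q.1.2.1 else 0 := by
  set f : Vert V × Edge I P A → ℕ := fun q =>
    if Full K Ψ q.1 q.2 then occ K Ψ q.1.1 q.2.1 q.1.2.1 + occ K Ψ q.1.1 q.2.1 q.1.2.2 else 0 with hf
  -- A pruned full edge has more than τ half edges on one of two tapes at one of two ends. The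
  -- bijections `turn` and `swapHalves` carry these four counts to a single one, whence the factor
  -- 4.
  have hle : ∀ q : Vert V × Edge I P A,
      τ * (if Full K Ψ q.1 q.2 ∧ ¬ Incl K Ψ τ q.1 q.2 then 1 else 0) ≤ f q + f (turn K q) := by
    intro q
    have h1 : f (turn K q) = if Full K Ψ q.1 q.2 then
        occ K Ψ (nb K q.1 q.2).1 q.2.1 (nb K q.1 q.2).2.1 +
        occ K Ψ (nb K q.1 q.2).1 q.2.1 (nb K q.1 q.2).2.2 else 0 := by
      simp only [hf, turn, Equiv.coe_fn_mk, full_turn]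
      rfl
    by_cases hF : Full K Ψ q.1 q.2
    · by_cases hi : Incl K Ψ τ q.1 q.2
      · simp [hi]
      · rw [h1]
        simp only [hf, hF, hi, not_false_eq_true, and_self, if_true, mul_one]
        by_contra hlt
        exact hi ⟨hF, ⟨by omega, by omega⟩, ⟨by omega, by omega⟩⟩
    · simp [hF]
  have hturn : ∑ q, f (turn K q) = ∑ q, f q := Equiv.sum_comp (turn K) f
  have hsplit : ∑ q, f q = 2 * ∑ q : Vert V × Edge I P A,
      if Full K Ψ q.1 q.2 then occ K Ψ q.1.1 q.2.1 q.1.2.1 else 0 := by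
    have h2 : ∀ q, f q = (if Full K Ψ q.1 q.2 then occ K Ψ q.1.1 q.2.1 q.1.2.1 else 0) +
        if Full K Ψ (swapHalves q).1 (swapHalves q).2 then
          occ K Ψ (swapHalves q).1.1 (swapHalves q).2.1 (swapHalves q).1.2.1 else 0 := by
      intro q
      simp only [full_swapHalves, hf]
      split_ifs <;> rfl
    rw [Finset.sum_congr rfl fun q _ => h2 q, Finset.sum_add_distrib,
      Equiv.sum_comp swapHalves fun q : Vert V × Edge I P A =>
        if Full K Ψ q.1 q.2 then occ K Ψ q.1.1 q.2.1 q.1.2.1 else 0]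
    ring
  have h3 : lost K Ψ τ = ∑ q : Vert V × Edge I P A,
      if Full K Ψ q.1 q.2 ∧ ¬ Incl K Ψ τ q.1 q.2 then 1 else 0 := by
    rw [lost, Finset.card_filter]
  rw [h3, Finset.mul_sum]
  refine (Finset.sum_le_sum fun q _ => hle q).trans (le_of_eq ?_)
  rw [Finset.sum_add_distrib, hturn, hsplit]
  ring

/-- Three distinct slots are present with probability p³. If the third coincides with one of the
others only p² is available, so such coincidences have to be counted. -/
theorem pr_isSome_triple_le {p : ℝ} (h0 : 0 ≤ p) (h1 : p ≤ 1) (i : I) (C C' C'' : A × A) :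
    pr p (fun Ψ : Inst I A => C ≠ C' ∧ (Ψ i C).isSome ∧ (Ψ i C').isSome ∧ (Ψ i C'').isSome) ≤
      p ^ 3 + (if C'' = C then p ^ 2 else 0) + if C'' = C' then p ^ 2 else 0 := by
  have hp3 : 0 ≤ p ^ 3 := by positivity
  have hp2 : 0 ≤ p ^ 2 := by positivity
  by_cases hC : C = C'
  · have h2 : pr p (fun Ψ : Inst I A => C ≠ C' ∧ (Ψ i C).isSome ∧ (Ψ i C').isSome ∧
        (Ψ i C'').isSome) = 0 := by
      simp [pr, hC, ex_const]
    rw [h2]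
    split_ifs <;> linarith
  · have h2 : pr p (fun Ψ : Inst I A => C ≠ C' ∧ (Ψ i C).isSome ∧ (Ψ i C').isSome ∧
        (Ψ i C'').isSome) ≤ p ^ 2 := by
      rw [← pr_isSome_pair (I := I) p (i := i) hC]
      exact pr_mono h0 h1 fun Ψ h => ⟨h.2.1, h.2.2.1⟩
    by_cases ha : C'' = C
    · simp only [ha, if_true] at h2 ⊢
      split_ifs
      linarith
    · by_cases hb : C'' = C'
      · simp only [hb, if_true] at h2 ⊢
        split_ifs <;> linarith
      · simp only [ha, hb, if_false, add_zero]
        have h3 := pr_forall_isSome (I := I) (J := A × A) p {(i, C), (i, C'), (i, C'')}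
        have h4 : Finset.card {(i, C), (i, C'), (i, C'')} = 3 := by
          rw [Finset.card_eq_three]
          exact ⟨_, _, _, by simpa using hC, by simpa using Ne.symm ha,
            by simpa using Ne.symm hb, rfl⟩
        rw [h4] at h3
        rw [← h3]
        exact pr_mono h0 h1 fun Ψ h => by simpa using h.2

theorem sum_edge_left (g : P → ℝ) : ∑ e : Edge I P A, g e.2.1.1 =
    Fintype.card I * (Fintype.card P * Fintype.card A) * Fintype.card A * ∑ a, g a := by
  have h1 : ∑ q : (P × A) × (P × A), g q.1.1 =
      (Fintype.card P * Fintype.card A) * Fintype.card A * ∑ a, g a := by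
    rw [Fintype.sum_prod_type]
    simp only [Finset.sum_const, Finset.card_univ, nsmul_eq_mul, ← Finset.mul_sum]
    rw [Fintype.sum_prod_type]
    simp only [Finset.sum_const, Finset.card_univ, nsmul_eq_mul, ← Finset.mul_sum,
      Fintype.card_prod]
    push_cast
    ring
  rw [Fintype.sum_prod_type]
  simp only [h1, Finset.sum_const, Finset.card_univ, nsmul_eq_mul]
  ring

theorem sum_edge_right (g : P → ℝ) : ∑ e : Edge I P A, g e.2.2.1 =
    Fintype.card I * (Fintype.card P * Fintype.card A) * Fintype.card A * ∑ a, g a := by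
  rw [← sum_edge_left]
  exact Fintype.sum_equiv ((Equiv.refl I).prodCongr (Equiv.prodComm _ _)) _ _ fun _ => rfl

/-- Two positions of the same half vertex agree for few triples. -/
theorem sum_coincidence_same_le {κ : ℝ} (hκ : (∑ s : V, ∑ a : P, ∑ b : P,
      if K.rd s a = K.rd s b then (1 : ℝ) else 0) ≤ κ * (Fintype.card V * Fintype.card P)) :
    (∑ v : Vert V, ∑ e : Edge I P A, ∑ q : P × A,
      if lab v.1 (K.rd v.2.1 q.1) q.2 = lab1 K v e then (1 : ℝ) else 0) ≤
    2 * (Fintype.card I * (Fintype.card V : ℝ) ^ 2) * (Fintype.card P * Fintype.card A) ^ 2 * κ := by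
  have h1 : ∀ (c : Bool) (s s' : V), (∑ e : Edge I P A, ∑ q : P × A,
      if lab c (K.rd s q.1) q.2 = lab1 K (c, s, s') e then (1 : ℝ) else 0) =
      Fintype.card I * (Fintype.card P * Fintype.card A) * Fintype.card A *
        ∑ a : P, ∑ b : P, if K.rd s a = K.rd s b then (1 : ℝ) else 0 := by
    intro c s s'
    have h2 : ∀ q' : P × A, (∑ q : P × A,
        if K.rd s q.1 = K.rd s q'.1 ∧ q.2 = q'.2 then (1 : ℝ) else 0) =
        ∑ a : P, if K.rd s a = K.rd s q'.1 then (1 : ℝ) else 0 := by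
      intro q'
      rw [Fintype.sum_prod_type]
      refine Finset.sum_congr rfl fun a _ => ?_
      by_cases ha : K.rd s a = K.rd s q'.1 <;> simp [ha]
    have h3 : ∀ e : Edge I P A, (∑ q : P × A,
        if lab c (K.rd s q.1) q.2 = lab1 K (c, s, s') e then (1 : ℝ) else 0) =
        ∑ a : P, if K.rd s a = K.rd s e.2.1.1 then (1 : ℝ) else 0 := by
      intro e
      simp only [lab1, lab_injective]
      exact h2 e.2.1
    rw [Finset.sum_congr rfl fun e _ => h3 e,
      sum_edge_left fun b => ∑ a : P, if K.rd s a = K.rd s b then (1 : ℝ) else 0, Finset.sum_comm]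
  simp only [Fintype.sum_prod_type (α₁ := Bool), Fintype.sum_prod_type (α₁ := V)]
  simp only [h1, ← Finset.mul_sum, Finset.sum_const, Finset.card_univ, nsmul_eq_mul,
    Fintype.card_bool]
  have h4 : 0 ≤ 2 * ((Fintype.card V : ℝ) *
      (Fintype.card I * (Fintype.card P * Fintype.card A) * Fintype.card A)) := by positivity
  refine le_trans (le_of_eq ?_) ((mul_le_mul_of_nonneg_left hκ h4).trans (le_of_eq ?_))
  · push_cast; ring
  · ring

/-- Two positions of different half vertices agree for few triples. -/
theorem sum_coincidence_diff {ν : ℕ}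
    (hν : ∀ p a, (Finset.univ.filter fun s => K.rd s p = a).card = ν) :
    (∑ v : Vert V, ∑ e : Edge I P A, ∑ q : P × A,
      if lab v.1 (K.rd v.2.1 q.1) q.2 = lab2 K v e then (1 : ℝ) else 0) =
    2 * (Fintype.card I * Fintype.card V * ν * Fintype.card A) *
      ((Fintype.card P : ℝ) ^ 2 * (Fintype.card P * Fintype.card A)) := by
  have h1 : ∀ (c : Bool) (s s' : V), (∑ e : Edge I P A, ∑ q : P × A,
      if lab c (K.rd s q.1) q.2 = lab2 K (c, s, s') e then (1 : ℝ) else 0) =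
      Fintype.card I * (Fintype.card P * Fintype.card A) * Fintype.card A *
        ∑ b : P, ∑ a : P, if K.rd s' b = K.rd s a then (1 : ℝ) else 0 := by
    intro c s s'
    have h3 : ∀ e : Edge I P A, (∑ q : P × A,
        if lab c (K.rd s q.1) q.2 = lab2 K (c, s, s') e then (1 : ℝ) else 0) =
        ∑ a : P, if K.rd s' e.2.2.1 = K.rd s a then (1 : ℝ) else 0 := by
      intro e
      simp only [lab2, lab_injective]
      rw [Fintype.sum_prod_type]
      refine Finset.sum_congr rfl fun a _ => ?_
      by_cases ha : K.rd s a = K.rd s' e.2.2.1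
      · simp [ha]
      · simp [ha, Ne.symm ha]
    rw [Finset.sum_congr rfl fun e _ => h3 e,
      sum_edge_right fun b => ∑ a : P, if K.rd s' b = K.rd s a then (1 : ℝ) else 0]
  have h2 : ∀ (s : V) (b a : P), (∑ s' : V, if K.rd s' b = K.rd s a then (1 : ℝ) else 0) = ν := by
    intro s b a
    rw [← hν b (K.rd s a), Finset.card_filter]
    push_cast
    rfl
  have h3 : ∀ s : V, (∑ s' : V, ∑ b : P, ∑ a : P, if K.rd s' b = K.rd s a then (1 : ℝ) else 0) =
      ν * (Fintype.card P : ℝ) ^ 2 := by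
    intro s
    rw [Finset.sum_comm]
    have h4 : ∀ b : P, (∑ s' : V, ∑ a : P, if K.rd s' b = K.rd s a then (1 : ℝ) else 0) =
        Fintype.card P * ν := by
      intro b
      rw [Finset.sum_comm]
      simp [h2]
    rw [Finset.sum_congr rfl fun b _ => h4 b, Finset.sum_const, Finset.card_univ, nsmul_eq_mul]
    ring
  simp only [Fintype.sum_prod_type (α₁ := Bool), Fintype.sum_prod_type (α₁ := V)]
  simp only [h1, ← Finset.mul_sum, h3, Finset.sum_const, Finset.card_univ, nsmul_eq_mul,
    Fintype.card_bool]
  push_cast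
  ring

/-- The expected number of pruned edges. -/
theorem ex_lost_le {p : ℝ} (h0 : 0 ≤ p) (h1 : p ≤ 1) {ν : ℕ}
    (hν : ∀ p a, (Finset.univ.filter fun s => K.rd s p = a).card = ν)
    (hνV : ν * Fintype.card A = Fintype.card V) (hPA : Fintype.card P ≤ Fintype.card A) {κ : ℝ}
    (hκ : (∑ s : V, ∑ a : P, ∑ b : P, if K.rd s a = K.rd s b then (1 : ℝ) else 0) ≤
      κ * (Fintype.card V * Fintype.card P)) (τ : ℕ) :
    τ * ex p (fun Ψ : Inst I A => (lost K Ψ τ : ℝ)) ≤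
      8 * (Fintype.card I * (Fintype.card V : ℝ) ^ 2) *
        ((p * (Fintype.card P * Fintype.card A)) ^ 3 +
          (κ + 1) * (p * (Fintype.card P * Fintype.card A)) ^ 2) := by
  have hstep : ∀ Ψ : Inst I A, (τ : ℝ) * lost K Ψ τ ≤ 4 * ∑ v : Vert V, ∑ e : Edge I P A,
      ∑ q : P × A, if lab1 K v e ≠ lab2 K v e ∧ (Ψ e.1 (lab1 K v e)).isSome ∧
        (Ψ e.1 (lab2 K v e)).isSome ∧ (Ψ e.1 (lab v.1 (K.rd v.2.1 q.1) q.2)).isSome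
        then (1 : ℝ) else 0 := by
    intro Ψ
    have h2 := mul_lost_le K Ψ τ
    have h3 : ((τ * lost K Ψ τ : ℕ) : ℝ) ≤ _ := Nat.cast_le.2 h2
    push_cast at h3
    refine h3.trans (le_of_eq ?_)
    rw [Fintype.sum_prod_type]
    congr 1
    refine Finset.sum_congr rfl fun v _ => Finset.sum_congr rfl fun e _ => ?_
    by_cases hF : Full K Ψ v e
    · rw [if_pos hF, occ, Finset.card_filter]
      push_cast
      refine Finset.sum_congr rfl fun q _ => ?_
      by_cases hq : (Ψ e.1 (lab v.1 (K.rd v.2.1 q.1) q.2)).isSome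
      · rw [if_pos hq, if_pos ⟨hF.1, hF.2.1, hF.2.2, hq⟩]
      · rw [if_neg hq, if_neg fun h => hq h.2.2.2]
    · rw [if_neg hF]
      refine (Finset.sum_eq_zero fun q _ => ?_).symm
      rw [if_neg fun h => hF ⟨h.1, h.2.1, h.2.2.1⟩]
  rw [← ex_mul_left]
  refine (ex_mono h0 h1 hstep).trans ?_
  rw [ex_mul_left, ex_sum]
  have hterm : (∑ v : Vert V, ex p fun Ψ : Inst I A => ∑ e : Edge I P A, ∑ q : P × A,
      if lab1 K v e ≠ lab2 K v e ∧ (Ψ e.1 (lab1 K v e)).isSome ∧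
        (Ψ e.1 (lab2 K v e)).isSome ∧ (Ψ e.1 (lab v.1 (K.rd v.2.1 q.1) q.2)).isSome
        then (1 : ℝ) else 0) ≤ ∑ v : Vert V, ∑ e : Edge I P A, ∑ q : P × A, (p ^ 3 +
        p ^ 2 * (if lab v.1 (K.rd v.2.1 q.1) q.2 = lab1 K v e then (1 : ℝ) else 0) +
        p ^ 2 * if lab v.1 (K.rd v.2.1 q.1) q.2 = lab2 K v e then (1 : ℝ) else 0) := by
    refine Finset.sum_le_sum fun v _ => ?_
    rw [ex_sum]
    refine Finset.sum_le_sum fun e _ => ?_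
    rw [ex_sum]
    refine Finset.sum_le_sum fun q _ => ?_
    refine le_trans (le_of_eq ?_) ((pr_isSome_triple_le h0 h1 e.1 (lab1 K v e) (lab2 K v e)
      (lab v.1 (K.rd v.2.1 q.1) q.2)).trans (le_of_eq ?_))
    · rw [pr]
      congr!
    · simp only [mul_ite, mul_one, mul_zero]
  refine (mul_le_mul_of_nonneg_left hterm (by norm_num)).trans ?_
  simp only [Finset.sum_add_distrib, ← Finset.mul_sum]
  have hs := sum_coincidence_same_le (I := I) (A := A) K hκ
  have hd := sum_coincidence_diff (I := I) K hν
  have hc : (∑ v : Vert V, ∑ e : Edge I P A, ∑ q : P × A, p ^ 3) =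
      2 * (Fintype.card I * (Fintype.card V : ℝ) ^ 2) *
        (p * (Fintype.card P * Fintype.card A)) ^ 3 := by
    simp
    ring
  rw [hc, hd]
  have hνV' : (ν : ℝ) * Fintype.card A = Fintype.card V := by exact_mod_cast hνV
  have hPA' : (Fintype.card P : ℝ) ≤ Fintype.card A := by exact_mod_cast hPA
  -- For a given position and value there are |V| / |A| tapes. Coincidences between the tapes thus
  -- carry a relative factor |P| / |A| ≤ 1, which is the summand 1 in κ + 1.
  have hd' : 2 * (Fintype.card I * Fintype.card V * ν * Fintype.card A) *
      ((Fintype.card P : ℝ) ^ 2 * (Fintype.card P * Fintype.card A)) ≤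
      2 * (Fintype.card I * (Fintype.card V : ℝ) ^ 2) * (Fintype.card P * Fintype.card A) ^ 2 := by
    have : 2 * (Fintype.card I * Fintype.card V * ν * Fintype.card A) *
        ((Fintype.card P : ℝ) ^ 2 * (Fintype.card P * Fintype.card A)) =
        2 * (Fintype.card I * (Fintype.card V : ℝ) ^ 2) * ((Fintype.card P : ℝ) ^ 2 *
          Fintype.card A) * Fintype.card P := by
      rw [← hνV']; ring
    rw [this]
    calc _ ≤ 2 * (Fintype.card I * (Fintype.card V : ℝ) ^ 2) * ((Fintype.card P : ℝ) ^ 2 *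
          Fintype.card A) * Fintype.card A := by gcongr
      _ = _ := by ring
  have hp2 : 0 ≤ p ^ 2 := by positivity
  have e1 := mul_le_mul_of_nonneg_left hs hp2
  have e2 := mul_le_mul_of_nonneg_left hd' hp2
  rw [mul_pow p _ 2]
  linarith

end lost

end Kikuchi

/-! ### The tape of h blocks of B variables, and the translation of formulas. -/

namespace Kikuchi

section tape

open Classical

/-- Writing at the position `p` is a bijection between any two fibers of reading at `p`, so all
fibers have the same size. -/
theorem Tape.card_fiber_mul {V P A : Type} [Fintype V] [Fintype A] (K : Tape V P A) (p : P) (a : A) :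
    (Finset.univ.filter fun s => K.rd s p = a).card * Fintype.card A = Fintype.card V := by
  have h1 : ∀ a', (Finset.univ.filter fun s => K.rd s p = a').card =
      (Finset.univ.filter fun s => K.rd s p = a).card := by
    intro a'
    refine Finset.card_nbij' (fun s => K.wr s p a) (fun s => K.wr s p a') ?_ ?_ ?_ ?_
    · intro s _
      simp [K.rd_wr]
    · intro s _
      simp [K.rd_wr]
    · intro s hs
      have : K.rd s p = a' := by simpa using hs
      simp only
      rw [← this, K.wr_rd]
    · intro s hs
      have : K.rd s p = a := by simpa using hs
      simp only
      rw [← this, K.wr_rd]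
  have h2 := Finset.card_eq_sum_card_fiberwise (s := Finset.univ) (t := Finset.univ)
    (f := fun s : V => K.rd s p) fun _ _ => Finset.mem_coe.2 (Finset.mem_univ _)
  rw [Finset.card_univ, Finset.sum_congr rfl fun a' _ => h1 a', Finset.sum_const,
    Finset.card_univ, smul_eq_mul] at h2
  rw [h2, mul_comm]

end tape

section concrete

variable {h B n : ℕ}

abbrev Tup (h n : ℕ) : Type := Fin h → Fin n

/-- The half vertices are `h` blocks of `B` variables; a position selects a variable of each block. -/
def tape (h B n : ℕ) : Tape (Tup (h * B) n) (Tup h B) (Tup h n) where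
  rd s p j := s (finProdFinEquiv (j, p j))
  wr s p b z := if (finProdFinEquiv.symm z).2 = p (finProdFinEquiv.symm z).1 then
    b (finProdFinEquiv.symm z).1 else s z
  rd_wr s p b := by
    funext j
    simp
  wr_rd s p b := by
    funext z
    by_cases hz : (finProdFinEquiv.symm z).2 = p (finProdFinEquiv.symm z).1
    · simp only [if_pos hz]
      rw [← hz, Prod.mk.eta, Equiv.apply_symm_apply]
    · simp only [if_neg hz]

open Classical in
theorem card_fiber_tape (hn : 0 < n) (hB : 0 < B) (p : Tup h B) (a : Tup h n) :
    (Finset.univ.filter fun s => (tape h B n).rd s p = a).card = n ^ (h * (B - 1)) := by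
  have h1 := (tape h B n).card_fiber_mul p a
  have h2 : Fintype.card (Tup (h * B) n) = n ^ (h * (B - 1)) * n ^ h := by
    rw [← pow_add, Fintype.card_fun, Fintype.card_fin, Fintype.card_fin]
    congr 1
    obtain ⟨b, rfl⟩ : ∃ b, B = b + 1 := ⟨B - 1, by omega⟩
    simp; ring
  rw [h2] at h1
  simp only [Fintype.card_fun, Fintype.card_fin] at h1
  refine Nat.eq_of_mul_eq_mul_right (pow_pos hn h) (Eq.trans ?_ h1)
  congr!

theorem card_eq_mul (hB : 0 < B) : n ^ (h * (B - 1)) * Fintype.card (Tup h n) =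
    Fintype.card (Tup (h * B) n) := by
  simp only [Fintype.card_fun, Fintype.card_fin]
  rw [← pow_add]
  congr 1
  obtain ⟨b, rfl⟩ : ∃ b, B = b + 1 := ⟨B - 1, by omega⟩
  simp; ring

-- The B diagonal pairs always agree. Each of the at most B² other pairs agrees for a fraction 1 / n
-- of all blocks, which adds at most another B because B ≤ n.
open Classical in
theorem sum_block_coincidence_le (hBn : B ≤ n) :
    (∑ w : Fin B → Fin n, ∑ x : Fin B, ∑ y : Fin B, if w x = w y then (1 : ℝ) else 0) ≤
      2 * ((n : ℝ) ^ B * B) := by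
  have h1 : ∀ x y : Fin B, x ≠ y → n * (Finset.univ.filter fun w : Fin B → Fin n =>
      w x = w y).card ≤ n ^ B := by
    intro x y hxy
    have h2 : Fintype.card (Fin B → Fin n) = n ^ B := by simp
    rw [← h2, ← Finset.card_univ (α := Fin B → Fin n), mul_comm]
    have h4 : (Finset.univ.filter fun w : Fin B → Fin n => w x = w y).card * n =
        ((Finset.univ.filter fun w : Fin B → Fin n => w x = w y) ×ˢ
          (Finset.univ : Finset (Fin n))).card := by
      rw [Finset.card_product, Finset.card_univ, Fintype.card_fin]
    rw [h4]
    -- Overwriting the entry at `x` loses nothing, because it can be recovered from the equal entry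
    -- at `y`.
    refine Finset.card_le_card_of_injOn (fun q => Function.update q.1 x q.2)
      (fun _ _ => Finset.mem_coe.2 (Finset.mem_univ _)) ?_
    intro q hq q' hq' he
    simp only [Finset.coe_product, Finset.coe_filter, Finset.mem_univ, true_and, Finset.coe_univ,
      Set.mem_prod, Set.mem_ofPred_eq, Set.mem_univ, and_true] at hq hq'
    simp only at he
    have e0 : ∀ z, z ≠ x → q.1 z = q'.1 z := fun z hz => by
      have := congrFun he z
      simpa [Function.update_of_ne hz] using this
    have e1 : q.2 = q'.2 := by simpa using congrFun he x
    refine Prod.ext (funext fun z => ?_) e1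
    by_cases hz : z = x
    · rw [hz, hq, hq', e0 y hxy.symm]
    · exact e0 z hz
  have h3 : ∀ x y : Fin B, (n : ℝ) * (∑ w : Fin B → Fin n, if w x = w y then (1 : ℝ) else 0) ≤
      n ^ B + if x = y then (n : ℝ) * n ^ B else 0 := by
    intro x y
    by_cases hxy : x = y
    · simp [hxy]
    · have := h1 x y hxy
      rw [Finset.card_filter] at this
      have h4 : ((n * (∑ w : Fin B → Fin n, if w x = w y then 1 else 0) : ℕ) : ℝ) ≤
          ((n ^ B : ℕ) : ℝ) := Nat.cast_le.2 this
      push_cast at h4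
      simpa [hxy] using h4
  rcases Nat.eq_zero_or_pos n with rfl | hn
  · obtain rfl : B = 0 := by omega
    simp
  have hn' : (0 : ℝ) < n := by exact_mod_cast hn
  have h5 : (n : ℝ) * (∑ w : Fin B → Fin n, ∑ x : Fin B, ∑ y : Fin B,
      if w x = w y then (1 : ℝ) else 0) ≤ B * (B * n ^ B) + n * (n ^ B * B) := by
    rw [Finset.sum_comm, Finset.mul_sum]
    have h6 : ∀ x : Fin B, (n : ℝ) * (∑ w : Fin B → Fin n, ∑ y : Fin B,
        if w x = w y then (1 : ℝ) else 0) ≤ B * n ^ B + n * n ^ B := by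
      intro x
      rw [Finset.sum_comm, Finset.mul_sum]
      refine (Finset.sum_le_sum fun y _ => h3 x y).trans (le_of_eq ?_)
      simp [Finset.sum_add_distrib]
    refine (Finset.sum_le_sum fun x _ => h6 x).trans (le_of_eq ?_)
    simp
    ring
  have hBn' : (B : ℝ) ≤ n := by exact_mod_cast hBn
  have h7 : (B : ℝ) * (B * n ^ B) ≤ n * (n ^ B * B) := by
    calc (B : ℝ) * (B * n ^ B) ≤ n * (B * n ^ B) := by gcongr
      _ = _ := by ring
  refine le_of_mul_le_mul_left ?_ hn'
  linarith

-- Two positions read the same value iff they agree in every block, so the count is a product over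
-- the h blocks, with a factor 2 from each.
open Classical in
theorem sum_coincidence_tape_le (hBn : B ≤ n) :
    (∑ s : Tup (h * B) n, ∑ a : Tup h B, ∑ b : Tup h B,
      if (tape h B n).rd s a = (tape h B n).rd s b then (1 : ℝ) else 0) ≤
      2 ^ h * (Fintype.card (Tup (h * B) n) * Fintype.card (Tup h B)) := by
  set F : (Fin B → Fin n) × Fin B × Fin B → ℝ := fun t => if t.1 t.2.1 = t.1 t.2.2 then 1 else 0
    with hF
  set e : Tup (h * B) n ≃ (Fin h → Fin B → Fin n) :=
    (finProdFinEquiv.symm.arrowCongr (Equiv.refl (Fin n))).trans (Equiv.curry _ _ _) with he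
  have he1 : ∀ s j l, e s j l = s (finProdFinEquiv (j, l)) := fun s j l => rfl
  have h1 : (∑ s : Tup (h * B) n, ∑ a : Tup h B, ∑ b : Tup h B,
      if (tape h B n).rd s a = (tape h B n).rd s b then (1 : ℝ) else 0) =
      ∑ φ : Fin h → (Fin B → Fin n) × Fin B × Fin B, ∏ j, F (φ j) := by
    rw [← Equiv.sum_comp (Equiv.arrowProdEquivProdArrow (Fin h) (fun _ => Fin B → Fin n)
      (fun _ => Fin B × Fin B)).symm, Fintype.sum_prod_type, ← Equiv.sum_comp e]
    refine Finset.sum_congr rfl fun s _ => ?_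
    rw [← Equiv.sum_comp (Equiv.arrowProdEquivProdArrow (Fin h) (fun _ => Fin B)
      (fun _ => Fin B)).symm, Fintype.sum_prod_type]
    refine Finset.sum_congr rfl fun a _ => Finset.sum_congr rfl fun b _ => ?_
    simp only [hF, Equiv.arrowProdEquivProdArrow, Equiv.coe_fn_symm_mk, he1]
    rw [Finset.prod_ite_zero, Finset.prod_const_one]
    congr 1
    simp only [Finset.mem_univ, forall_true_left]
    exact propext funext_iff
  rw [h1]
  have h2 := Finset.prod_univ_sum (fun _ : Fin h =>
    (Finset.univ : Finset ((Fin B → Fin n) × Fin B × Fin B))) fun _ t => F t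
  rw [Fintype.piFinset_univ] at h2
  rw [← h2, Finset.prod_const, Finset.card_univ, Fintype.card_fin]
  have h3 : ∑ t, F t ≤ 2 * ((n : ℝ) ^ B * B) := by
    rw [Fintype.sum_prod_type]
    simp only [Fintype.sum_prod_type]
    exact sum_block_coincidence_le hBn
  refine (pow_le_pow_left₀ (Finset.sum_nonneg fun t _ => ?_) h3 h).trans (le_of_eq ?_)
  · simp only [hF]
    split_ifs <;> norm_num
  · simp only [Fintype.card_fun, Fintype.card_fin]
    push_cast
    rw [mul_pow, mul_pow, ← pow_mul, mul_comm B h]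

end concrete

section formula

variable {h n : ℕ}

/-- The tuple with first entry `i`, followed by the entries of `a` and `b`. -/
def slot (i : Fin n) (a b : Tup h n) : Fin (h + h + 1) → Fin n := Fin.cons i (Fin.append a b)

def slotEquiv (h n : ℕ) : Fin n × (Tup h n × Tup h n) ≃ (Fin (h + h + 1) → Fin n) :=
  ((Equiv.refl (Fin n)).prodCongr (Fin.appendEquiv h h)).trans
    (Fin.consEquiv fun _ : Fin (h + h + 1) => Fin n)

/-- The formula as a family of slots. -/
def inst (Φ : KXor.Formula (h + h + 1) n) : Inst (Fin n) (Tup h n) := fun i c => Φ (slot i c.1 c.2)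

def instEquiv (h n : ℕ) : KXor.Formula (h + h + 1) n ≃ Inst (Fin n) (Tup h n) :=
  ((slotEquiv h n).symm.arrowCongr (Equiv.refl _)).trans (Equiv.curry _ _ _)

theorem instEquiv_apply (Φ : KXor.Formula (h + h + 1) n) : instEquiv h n Φ = inst Φ := rfl

theorem weight_eq_wt (p : ℝ) (Φ : KXor.Formula (h + h + 1) n) :
    KXor.weight p Φ = wt p (inst Φ) := by
  rw [KXor.weight, wt, ← Equiv.prod_comp (slotEquiv h n), Fintype.prod_prod_type]
  rfl

theorem prob_eq_pr (p : ℝ) (E : Inst (Fin n) (Tup h n) → Prop) :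
    KXor.prob p {Φ : KXor.Formula (h + h + 1) n | E (inst Φ)} = pr p E := by
  have h1 : pr p E = ∑ Ψ : Inst (Fin n) (Tup h n),
      wt p Ψ * @ite ℝ (E Ψ) (Classical.propDecidable _) 1 0 := by
    rw [pr, ex]
    congr!
  rw [h1, ← Equiv.sum_comp (instEquiv h n), KXor.prob]
  refine Finset.sum_congr rfl fun Φ _ => ?_
  rw [instEquiv_apply, ← weight_eq_wt]
  by_cases hE : E (inst Φ)
  · rw [if_pos hE, mul_one]
    exact Set.indicator_of_mem (s := {Φ | E (inst Φ)}) hE _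
  · rw [if_neg hE, mul_zero]
    exact Set.indicator_of_notMem (s := {Φ | E (inst Φ)}) hE _

theorem sum_slots {M : Type*} [AddCommMonoid M] (f : (Fin (h + h + 1) → Fin n) → M) :
    ∑ S, f S = ∑ i, ∑ c : Tup h n × Tup h n, f (slot i c.1 c.2) := by
  rw [← Equiv.sum_comp (slotEquiv h n), Fintype.sum_prod_type]
  rfl

theorem size_inst (Φ : KXor.Formula (h + h + 1) n) :
    size (inst Φ) = (KXor.constraints Φ).card := by
  rw [KXor.constraints, Finset.card_filter, sum_slots, size]
  simp only [Finset.card_filter]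
  rfl

/-- Twice the number of satisfied constraints. -/
theorem two_mul_card_satisfied (Φ : KXor.Formula (h + h + 1) n) (x : Fin n → ℤˣ) :
    2 * ((KXor.satisfied Φ x).card : ℝ) = (KXor.constraints Φ).card +
      ∑ i, ((x i : ℤ) : ℝ) * ∑ c : Tup h n × Tup h n, sgn (inst Φ i c) *
        (∏ j, ((x (c.1 j) : ℤ) : ℝ)) * ∏ j, ((x (c.2 j) : ℤ) : ℝ) := by
  have h1 : ∀ S, 2 * (if Φ S = some (∏ i, x (S i)) then (1 : ℝ) else 0) =
      (if (Φ S).isSome then (1 : ℝ) else 0) + sgn (Φ S) * ∏ i, ((x (S i) : ℤ) : ℝ) := by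
    intro S
    have h2 : ∏ i, ((x (S i) : ℤ) : ℝ) = (((∏ i, x (S i) : ℤˣ) : ℤ) : ℝ) := by
      rw [Units.coe_prod]; push_cast; rfl
    rw [h2]
    rcases hS : Φ S with _ | η
    · simp [sgn]
    · rcases Int.units_eq_one_or η with rfl | rfl <;>
        rcases Int.units_eq_one_or (∏ i, x (S i)) with h3 | h3 <;> rw [h3] <;> norm_num [sgn]
  rw [KXor.satisfied, KXor.constraints, Finset.card_filter, Finset.card_filter]
  push_cast
  rw [Finset.mul_sum, Finset.sum_congr rfl fun S _ => h1 S, Finset.sum_add_distrib,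
    sum_slots fun S => sgn (Φ S) * ∏ i, ((x (S i) : ℤ) : ℝ)]
  congr 1
  refine Finset.sum_congr rfl fun i _ => ?_
  rw [Finset.mul_sum]
  refine Finset.sum_congr rfl fun c _ => ?_
  have h3 : ∏ j, ((x (slot i c.1 c.2 j) : ℤ) : ℝ) = ((x i : ℤ) : ℝ) *
      ((∏ j, ((x (c.1 j) : ℤ) : ℝ)) * ∏ j, ((x (c.2 j) : ℤ) : ℝ)) := by
    rw [Fin.prod_univ_succ, Fin.prod_univ_add]
    simp only [slot, Fin.cons_zero, Fin.cons_succ, Fin.append_left, Fin.append_right]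
  rw [h3, inst]
  ring

theorem prod_wr {B : ℕ} (x : Fin n → ℤˣ) (s : Tup (h * B) n) (p : Tup h B) (b : Tup h n) :
    (∏ z, ((x ((tape h B n).wr s p b z) : ℤ) : ℝ)) = (∏ z, ((x (s z) : ℤ) : ℝ)) *
      (∏ j, ((x ((tape h B n).rd s p j) : ℤ) : ℝ)) * ∏ j, ((x (b j) : ℤ) : ℝ) := by
  have hx : ∀ i, ((x i : ℤ) : ℝ) * ((x i : ℤ) : ℝ) = 1 := fun i => by
    rcases Int.units_eq_one_or (x i) with h | h <;> simp [h]
  rw [← Equiv.prod_comp finProdFinEquiv, ← Equiv.prod_comp finProdFinEquiv, Fintype.prod_prod_type,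
    Fintype.prod_prod_type, ← Finset.prod_mul_distrib, ← Finset.prod_mul_distrib]
  refine Finset.prod_congr rfl fun j _ => ?_
  simp only [tape, Equiv.symm_apply_apply]
  rw [← Finset.mul_prod_erase _ _ (Finset.mem_univ (p j)),
    ← Finset.mul_prod_erase Finset.univ (fun l => ((x (s (finProdFinEquiv (j, l))) : ℤ) : ℝ))
      (Finset.mem_univ (p j)), if_pos rfl]
  have h1 : ∏ l ∈ Finset.univ.erase (p j),
      ((x (if l = p j then b j else s (finProdFinEquiv (j, l))) : ℤ) : ℝ) =
      ∏ l ∈ Finset.univ.erase (p j), ((x (s (finProdFinEquiv (j, l))) : ℤ) : ℝ) :=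
    Finset.prod_congr rfl fun l hl => by rw [if_neg (Finset.ne_of_mem_erase hl)]
  rw [h1]
  -- The old entry occurs twice on the right-hand side, once in the tape and once as the value read;
  -- its square is 1.
  linear_combination (-((x (b j) : ℤ) : ℝ) * ∏ l ∈ Finset.univ.erase (p j),
    ((x (s (finProdFinEquiv (j, l))) : ℤ) : ℝ)) * hx (s (finProdFinEquiv (j, p j)))

open Classical in
/-- The parameters `B`, `L`, `τ`, `θ` certify the bound `1 / 2 + g / (2 n)`. -/
def Certifies (Ψ : Inst (Fin n) (Tup h n)) (g B L τ θ : ℕ) : Prop :=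
  (mat (tape h B n) Ψ τ ^ (2 * L)).trace ≤ (θ : ℝ) ^ (2 * L) ∧
  n ^ 3 * (2 * (B ^ h * n ^ (h * (B - 1))) ^ 2 * size Ψ + θ * (2 * (n ^ (h * B)) ^ 2) +
    lost (tape h B n) Ψ τ) ≤ 2 * (B ^ h * n ^ (h * (B - 1))) ^ 2 * (g ^ 2 * size Ψ ^ 2)

/-- Multiplied by n², the soundness inequality and the certificate give (nF)² ≤ (gm)², where F is
the odd form and m the number of constraints. Then 2 · satisfied = m + F ≤ m (1 + g / n). -/
theorem satFraction_le_of_certifies (Φ : KXor.Formula (h + h + 1) n) (x : Fin n → ℤˣ)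
    {g B L τ θ : ℕ} (hn : 0 < n) (hB : 0 < B) (hL : L ≠ 0) (hc : Certifies (inst Φ) g B L τ θ) :
    KXor.satFraction Φ x ≤ ((n + g : ℕ) : ℝ) / ((2 * n : ℕ) : ℝ) := by
  have hx : ∀ i, ((x i : ℤ) : ℝ) * ((x i : ℤ) : ℝ) = 1 := fun i => by
    rcases Int.units_eq_one_or (x i) with h | h <;> simp [h]
  have hxx : ∀ {m : ℕ} (a : Tup m n),
      (∏ j, ((x (a j) : ℤ) : ℝ)) * (∏ j, ((x (a j) : ℤ) : ℝ)) = 1 := fun a => by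
    rw [← Finset.prod_mul_distrib]
    exact Finset.prod_eq_one fun j _ => hx _
  have key := sq_le_of_trace_le (K := tape h B n) (Ψ := inst Φ) (ν := n ^ (h * (B - 1)))
    (fun p a => by rw [← card_fiber_tape hn hB p a]; congr!) (fun a => hxx a) (fun s => hxx s) hx
    (fun s p b => prod_wr x s p b) hL (τ := τ) (θ := θ) (by convert hc.1)
  set F : ℝ := ∑ i, ((x i : ℤ) : ℝ) * ∑ c : Tup h n × Tup h n, sgn (inst Φ i c) *
        (∏ j, ((x (c.1 j) : ℤ) : ℝ)) * ∏ j, ((x (c.2 j) : ℤ) : ℝ) with hF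
  have hsat := two_mul_card_satisfied Φ x
  rw [← hF, ← size_inst] at hsat
  have h2 : ((_ : ℕ) : ℝ) ≤ ((_ : ℕ) : ℝ) := Nat.cast_le.2 hc.2
  simp only [Fintype.card_fun, Fintype.card_fin] at key
  push_cast at key h2
  set W : ℝ := ((B : ℝ) ^ h * (n : ℝ) ^ (h * (B - 1))) with hW
  set m : ℝ := (size (inst Φ) : ℝ) with hm
  have hn' : (0 : ℝ) < n := by exact_mod_cast hn
  have hB' : (0 : ℝ) < B := by exact_mod_cast hB
  have hWpos : 0 < 2 * W ^ 2 := by positivity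
  have h3 : 2 * W ^ 2 * (n * F) ^ 2 ≤ 2 * W ^ 2 * (g * m) ^ 2 := by
    have h4 := mul_le_mul_of_nonneg_left key (sq_nonneg (n : ℝ))
    nlinarith
  have h5 : (n * F) ^ 2 ≤ (g * m) ^ 2 := le_of_mul_le_mul_left h3 hWpos
  have h6 : n * F ≤ g * m := by
    exact (abs_le.1 (abs_le_of_sq_le_sq h5 (by positivity))).2
  rw [KXor.satFraction, ← size_inst, ← hm]
  -- An instance without constraints has fraction 0 / 0 = 0.
  rcases (Nat.cast_nonneg (size (inst Φ)) : (0 : ℝ) ≤ (size (inst Φ) : ℝ)).eq_or_lt with h7 | h7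
  · rw [hm, ← h7, div_zero]
    positivity
  · rw [div_le_div_iff₀ h7 (by positivity)]
    push_cast
    nlinarith

end formula

end Kikuchi

/-! ### The probability that given parameters fail to certify. -/

namespace Kikuchi

section whp

open Classical

variable {h n : ℕ}

/-- The three terms of the certificate (diagonal, eigenvalue bound, pruned edges) are each shown to
take at most a third of the right-hand side. -/
theorem certifies_of_bounds {Ψ : Inst (Fin n) (Tup h n)} {g B L τ θ : ℕ} {p γ w : ℝ} (hB : 0 < B)
    (hw : w = p * ((B : ℝ) ^ h * (n : ℝ) ^ h)) (hp : 0 < p) (hn : 0 < n)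
    (hg : γ * n ≤ g) (hγ : 0 < γ) (ha : 6 ≤ γ ^ 2 * (p * ((n : ℝ) ^ h) ^ 2))
    (hθ : (θ : ℝ) ≤ γ ^ 2 / 12 * (n * w ^ 2))
    (hm : p * (n * ((n : ℝ) ^ h) ^ 2) / 2 ≤ size Ψ)
    (hl : (lost (tape h B n) Ψ τ : ℝ) ≤ γ ^ 2 / 6 * (n * w ^ 2) * ((n : ℝ) ^ (h * B)) ^ 2)
    (htr : (mat (tape h B n) Ψ τ ^ (2 * L)).trace ≤ (θ : ℝ) ^ (2 * L)) :
    Certifies Ψ g B L τ θ := by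
  refine ⟨by convert htr, ?_⟩
  rw [← Nat.cast_le (α := ℝ)]
  push_cast
  set u : ℝ := (n : ℝ) ^ (h * (B - 1)) with hu
  set A : ℝ := (n : ℝ) ^ h with hA
  set Q : ℝ := (B : ℝ) ^ h with hQ
  set m : ℝ := (size Ψ : ℝ) with hmdef
  have hV : (n : ℝ) ^ (h * B) = u * A := by
    rw [hu, hA, ← pow_add]
    congr 1
    obtain ⟨b, rfl⟩ : ∃ b, B = b + 1 := ⟨B - 1, by omega⟩
    simp; ring
  rw [hV] at hl ⊢
  have hn' : (0 : ℝ) < n := by exact_mod_cast hn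
  have hB' : (0 : ℝ) < B := by exact_mod_cast hB
  have hu0 : 0 < u := by positivity
  have hA0 : 0 < A := by positivity
  have hQ0 : 0 < Q := by positivity
  have hm0 : 0 < m := lt_of_lt_of_le (by positivity) hm
  have hw0 : 0 < w := by rw [hw]; positivity
  have k1 : 3 * n ≤ γ ^ 2 * m := by
    have := mul_le_mul_of_nonneg_left hm (sq_nonneg γ)
    nlinarith
  -- Equality holds when m is replaced by its lower bound p n A² / 2.
  have k2 : (u * A) ^ 2 * (n * w) ^ 2 ≤ 4 * (Q * u) ^ 2 * m ^ 2 := by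
    have e1 : (u * A) ^ 2 * (n * w) ^ 2 = 4 * (Q * u) ^ 2 * (p * (n * A ^ 2) / 2) ^ 2 := by
      rw [hw]; ring
    rw [e1]
    gcongr
  have k3 : 2 * (Q * u) ^ 2 * ((γ * n) ^ 2 * m ^ 2) ≤ 2 * (Q * u) ^ 2 * (g ^ 2 * m ^ 2) := by
    gcongr
  refine le_trans ?_ k3
  have t1 : (n : ℝ) ^ 3 * (2 * (Q * u) ^ 2 * m) ≤ 2 * (Q * u) ^ 2 * ((γ * n) ^ 2 * m ^ 2) / 3 := by
    have : 0 ≤ 2 * (Q * u) ^ 2 * n ^ 2 * m := by positivity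
    nlinarith [mul_le_mul_of_nonneg_left k1 this]
  have t2 : (n : ℝ) ^ 3 * (θ * (2 * (u * A) ^ 2)) ≤ 2 * (Q * u) ^ 2 * ((γ * n) ^ 2 * m ^ 2) / 3 := by
    calc (n : ℝ) ^ 3 * (θ * (2 * (u * A) ^ 2))
        ≤ (n : ℝ) ^ 3 * ((γ ^ 2 / 12 * (n * w ^ 2)) * (2 * (u * A) ^ 2)) := by gcongr
      _ = γ ^ 2 * n ^ 2 / 6 * ((u * A) ^ 2 * (n * w) ^ 2) := by ring
      _ ≤ γ ^ 2 * n ^ 2 / 6 * (4 * (Q * u) ^ 2 * m ^ 2) := by gcongr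
      _ = _ := by ring
  have t3 : (n : ℝ) ^ 3 * lost (tape h B n) Ψ τ ≤
      2 * (Q * u) ^ 2 * ((γ * n) ^ 2 * m ^ 2) / 3 := by
    calc (n : ℝ) ^ 3 * lost (tape h B n) Ψ τ
        ≤ (n : ℝ) ^ 3 * (γ ^ 2 / 6 * (n * w ^ 2) * (u * A) ^ 2) := by gcongr
      _ = γ ^ 2 * n ^ 2 / 6 * ((u * A) ^ 2 * (n * w) ^ 2) := by ring
      _ ≤ γ ^ 2 * n ^ 2 / 6 * (4 * (Q * u) ^ 2 * m ^ 2) := by gcongr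
      _ = _ := by ring
  linarith

/-- The four terms of the bound belong to four failures: too few constraints, too many pruned edges,
a large degree, and a large trace although all degrees are bounded. -/
theorem pr_not_certifies_le {g B L τ θ : ℕ} {p γ w l : ℝ} (hB : 0 < B) (hBn : B ≤ n)
    (hw : w = p * ((B : ℝ) ^ h * (n : ℝ) ^ h)) (hp : 0 < p) (hp1 : p ≤ 1) (hn : 0 < n)
    (hg : γ * n ≤ g) (hγ : 0 < γ) (ha : 6 ≤ γ ^ 2 * (p * ((n : ℝ) ^ h) ^ 2)) (hL : 0 < L)
    (hτ : 0 < τ) (hl : 0 < l) (hτl : (w + (2 ^ h + 1)) * l ≤ τ)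
    (hLV : 2 * ((n : ℝ) ^ (h * B)) ^ 2 * n ≤ Real.exp L)
    (hθ : (θ : ℝ) ≤ γ ^ 2 / 12 * (n * w ^ 2))
    (hθ2 : 4 * ((2 * (n * w ^ 2) + 4 * L * (τ : ℝ) ^ 2) * (4 * L * (τ : ℝ) ^ 2)) * Real.exp 1 ≤
      (θ : ℝ) ^ 2) :
    pr p (fun Ψ : Inst (Fin n) (Tup h n) => ¬ Certifies Ψ g B L τ θ) ≤
      4 / (p * (n * ((n : ℝ) ^ h) ^ 2)) + (48 / (γ ^ 2 * l) + (1 / n + 1 / n)) := by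
  have hn' : (0 : ℝ) < n := by exact_mod_cast hn
  have hB' : (0 : ℝ) < B := by exact_mod_cast hB
  have hL' : (0 : ℝ) < L := by exact_mod_cast hL
  have hτ' : (0 : ℝ) < τ := by exact_mod_cast hτ
  have hw0 : 0 < w := by rw [hw]; positivity
  have hV0 : 0 < (n : ℝ) ^ (h * B) := by positivity
  have hcardI : (Fintype.card (Fin n) : ℝ) = n := by simp
  have hcardA : (Fintype.card (Tup h n) : ℝ) = (n : ℝ) ^ h := by simp
  have hcardP : (Fintype.card (Tup h B) : ℝ) = (B : ℝ) ^ h := by simp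
  have hcardV : (Fintype.card (Tup (h * B) n) : ℝ) = (n : ℝ) ^ (h * B) := by simp
  have hcardJ : (Fintype.card (Tup h n × Tup h n) : ℝ) = ((n : ℝ) ^ h) ^ 2 := by
    rw [Fintype.card_prod]; push_cast; rw [hcardA]; ring
  have hcardVert : (Fintype.card (Vert (Tup (h * B) n)) : ℝ) = 2 * ((n : ℝ) ^ (h * B)) ^ 2 := by
    rw [Fintype.card_prod, Fintype.card_prod, Fintype.card_bool]; push_cast; rw [hcardV]; ring
  set α : ℝ := 2 * (n * w ^ 2) + 4 * L * (τ : ℝ) ^ 2 with hα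
  set β : ℝ := 4 * L * (τ : ℝ) ^ 2 with hβ
  have hβ0 : 0 < β := by positivity
  have hβα : β ≤ α := by
    have : 0 ≤ 2 * (n * w ^ 2) := by positivity
    linarith
  have hθ0 : (0 : ℝ) < θ := by
    have h1 : (0 : ℝ) < θ ^ 2 := lt_of_lt_of_le (by positivity) hθ2
    exact lt_of_le_of_ne (Nat.cast_nonneg θ) fun h0 => by simp [← h0] at h1
  have : Nonempty (Fin n) := ⟨⟨0, hn⟩⟩
  have hsub : ∀ Ψ : Inst (Fin n) (Tup h n), ¬ Certifies Ψ g B L τ θ →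
      ((size Ψ : ℝ) < p * (n * ((n : ℝ) ^ h) ^ 2) / 2) ∨
      (γ ^ 2 / 6 * (n * w ^ 2) * ((n : ℝ) ^ (h * B)) ^ 2 ≤ lost (tape h B n) Ψ τ ∨
      ((∃ v, α < deg (tape h B n) Ψ τ v) ∨ ((∀ v, (deg (tape h B n) Ψ τ v : ℝ) ≤ α) ∧
        (θ : ℝ) ^ (2 * L) < (mat (tape h B n) Ψ τ ^ (2 * L)).trace))) := by
    intro Ψ hc
    by_contra hcon
    push Not at hcon
    obtain ⟨c1, c2, c3, c4⟩ := hcon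
    exact hc (certifies_of_bounds hB hw hp hn hg hγ ha hθ c1 c2.le (c4 c3))
  refine (pr_mono hp.le hp1 hsub).trans ((pr_or_le hp.le hp1 _ _).trans (add_le_add ?_
    ((pr_or_le hp.le hp1 _ _).trans (add_le_add ?_ ((pr_or_le hp.le hp1 _ _).trans
      (add_le_add ?_ ?_))))))
  · have := pr_size_lt (I := Fin n) (J := Tup h n × Tup h n) hp hp1
    rw [hcardI, hcardJ] at this
    exact this
  · refine (markov hp.le hp1 (f := fun Ψ => (lost (tape h B n) Ψ τ : ℝ)) (fun _ => Nat.cast_nonneg _)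
      (t := γ ^ 2 / 6 * (n * w ^ 2) * ((n : ℝ) ^ (h * B)) ^ 2) (by positivity)
      fun Ψ hΨ => hΨ).trans ?_
    have key := ex_lost_le (I := Fin n) (tape h B n) hp.le hp1 (ν := n ^ (h * (B - 1)))
      (fun p a => by rw [← card_fiber_tape hn hB p a]; congr!) (card_eq_mul hB)
      (by simpa using Nat.pow_le_pow_left hBn h) (κ := 2 ^ h)
      (by
        refine le_trans (le_of_eq ?_) (sum_coincidence_tape_le hBn)
        congr!) τ
    rw [hcardI, hcardA, hcardP, hcardV, ← hw] at key
    rw [div_le_div_iff₀ (by positivity) (by positivity)]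
    set X := ex p (fun Ψ : Inst (Fin n) (Tup h n) => (lost (tape h B n) Ψ τ : ℝ))
    set V := (n : ℝ) ^ (h * B)
    have hX0 : 0 ≤ X := by
      rw [← ex_const (I := Fin n) (J := Tup h n × Tup h n) p 0]
      exact ex_mono hp.le hp1 fun Ψ => Nat.cast_nonneg _
    have k1 : (w + (2 ^ h + 1)) * l * X ≤ (w + (2 ^ h + 1)) * (8 * (n * V ^ 2) * w ^ 2) := by
      calc (w + (2 ^ h + 1)) * l * X ≤ τ * X := by gcongr
        _ ≤ 8 * (n * V ^ 2) * (w ^ 3 + (2 ^ h + 1) * w ^ 2) := key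
        _ = _ := by ring
    have k2 : l * X ≤ 8 * (n * V ^ 2) * w ^ 2 := by
      refine le_of_mul_le_mul_left ?_ (show 0 < w + (2 ^ h + 1) by positivity)
      linarith
    calc X * (γ ^ 2 * l) = γ ^ 2 * (l * X) := by ring
      _ ≤ γ ^ 2 * (8 * (n * V ^ 2) * w ^ 2) := by gcongr
      _ = _ := by ring
  · refine (pr_exists_lt_deg (I := Fin n) (tape h B n) hp.le hp1 hτ α).trans ?_
    rw [hcardVert, hcardI, hcardA, hcardP, ← hw]
    -- The summand 4Lτ² of α turns the exponent of the degree bound into −4L, enough for a union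
    -- bound over the vertices.
    have e1 : (2 * (n * w ^ 2) - α) / (τ : ℝ) ^ 2 = -(4 * L) := by
      rw [hα]
      field_simp
      ring
    rw [e1, Real.exp_neg, ← div_eq_mul_inv, div_le_div_iff₀ (Real.exp_pos _) hn', one_mul]
    exact hLV.trans (Real.exp_le_exp.2 (by linarith))
  · have key := pr_trace_lt (I := Fin n) (tape h B n) hp.le hp1 (τ := τ) (L := L) hβ0 hβα le_rfl hθ0
    rw [hcardVert] at key
    refine le_trans (le_of_eq ?_) (key.trans ?_)
    · congr!
    · have e1 : 4 * (α * β) / (θ : ℝ) ^ 2 ≤ Real.exp (-1) := by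
        rw [Real.exp_neg, div_le_iff₀ (by positivity), ← div_eq_inv_mul, le_div_iff₀ (Real.exp_pos _)]
        exact hθ2
      have e2 : (4 * (α * β) / (θ : ℝ) ^ 2) ^ L ≤ Real.exp (-(L : ℝ)) := by
        refine (pow_le_pow_left₀ (by positivity) e1 L).trans (le_of_eq ?_)
        rw [← Real.exp_nat_mul]
        congr 1
        ring
      have e3 : 2 * ((n : ℝ) ^ (h * B)) ^ 2 * Real.exp (-(L : ℝ)) ≤ 1 / n := by
        rw [Real.exp_neg, ← div_eq_mul_inv, div_le_div_iff₀ (Real.exp_pos _) hn', one_mul]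
        exact hLV
      exact (mul_le_mul_of_nonneg_left e2 (by positivity)).trans e3

end whp

end Kikuchi

/-! ### Choice of the parameters. -/

namespace Kikuchi

section asymptotics

open Classical

variable {h n : ℕ}

/-- With D = p n^(2(h+1)) one has n w² = D² B^(2h+2) / n^(2h+1). Inserting B ≥ d / ℓ⁵ in 2h + 1 of
the factors costs ℓ^(10h+5), which leaves ℓ^15 of the ℓ^(10h+20) in the hypothesis. -/
theorem mul_le_of_density {d B : ℕ} {p ℓ : ℝ} (hn : 0 < n) (hd : 0 < d) (hℓ : 1 ≤ ℓ)
    (hB : (d : ℝ) / ℓ ^ 5 ≤ B)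
    (hD : ℓ ^ (10 * (h + 1) + 10) * ((n : ℝ) / d) ^ (2 * h + 1) ≤
      (p * ((n : ℝ) ^ (h + 1)) ^ 2) ^ 2) :
    ℓ ^ 15 * B ≤ n * (p * ((B : ℝ) ^ (h + 1) * (n : ℝ) ^ (h + 1))) ^ 2 := by
  have hn' : (0 : ℝ) < n := by exact_mod_cast hn
  have hd' : (0 : ℝ) < d := by exact_mod_cast hd
  have hℓ0 : 0 < ℓ := by linarith
  refine le_of_mul_le_mul_right ?_ (show 0 < (n : ℝ) ^ (2 * h + 1) by positivity)
  calc ℓ ^ 15 * B * (n : ℝ) ^ (2 * h + 1)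
      = ℓ ^ (10 * (h + 1) + 10) * ((n : ℝ) / d) ^ (2 * h + 1) *
          (B * ((d : ℝ) / ℓ ^ 5) ^ (2 * h + 1)) := by
        rw [div_pow, div_pow]
        field_simp
        ring
    _ ≤ (p * ((n : ℝ) ^ (h + 1)) ^ 2) ^ 2 * (B * (B : ℝ) ^ (2 * h + 1)) := by gcongr
    _ = _ := by ring

/-- Up to constants Lτ² is Bℓ³(w² + 1). The part with w² is small against n w² since Bℓ⁵ ≤ 2n; the
other part is small since ℓ^15 B ≤ n w². -/
theorem walk_bound {δ ℓ B n w τ L c q : ℝ} (hδ0 : 0 < δ) (hℓ1 : 1 ≤ ℓ) (hB : 0 ≤ B)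
    (hw0 : 0 < w) (hc0 : 0 < c) (hq : 0 ≤ q) (hτ0 : 0 ≤ τ)
    (hC : 8 * q * (c + 1) ^ 2 ≤ δ * ℓ / 4) (hBu : B * ℓ ^ 5 ≤ 2 * n) (hNB : ℓ ^ 15 * B ≤ n * w ^ 2)
    (hτle : τ ≤ (w + (c + 1)) * ℓ) (hLle : L ≤ q * (B * ℓ)) :
    4 * L * τ ^ 2 ≤ δ * (n * w ^ 2) := by
  have hℓ0 : 0 < ℓ := by linarith
  have hN0 : 0 ≤ n * w ^ 2 := le_trans (by positivity) hNB
  have h1 : τ ^ 2 ≤ 2 * (c + 1) ^ 2 * (w ^ 2 + 1) * ℓ ^ 2 := by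
    calc τ ^ 2 ≤ ((w + (c + 1)) * ℓ) ^ 2 := by gcongr
      _ = (w + (c + 1)) ^ 2 * ℓ ^ 2 := by ring
      _ ≤ 2 * (c + 1) ^ 2 * (w ^ 2 + 1) * ℓ ^ 2 := by
        gcongr
        nlinarith [sq_nonneg (w - (c + 1)), mul_nonneg (sq_nonneg w)
          (show 0 ≤ (c + 1) ^ 2 - 1 by nlinarith)]
  have h2 : 4 * L * τ ^ 2 ≤ 8 * q * (c + 1) ^ 2 * (B * ℓ ^ 3) * (w ^ 2 + 1) := by
    calc 4 * L * τ ^ 2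
        ≤ 4 * (q * (B * ℓ)) * (2 * (c + 1) ^ 2 * (w ^ 2 + 1) * ℓ ^ 2) := by
          gcongr
      _ = _ := by ring
  have h3 : 8 * q * (c + 1) ^ 2 * (B * ℓ ^ 3) ≤ δ * n / 2 := by
    calc 8 * q * (c + 1) ^ 2 * (B * ℓ ^ 3) ≤ δ * ℓ / 4 * (B * ℓ ^ 3) := by gcongr
      _ = δ / 4 * (B * ℓ ^ 4) := by ring
      _ ≤ δ / 4 * (B * ℓ ^ 5) := by
        have : ℓ ^ 4 ≤ ℓ ^ 5 := pow_le_pow_right₀ hℓ1 (by norm_num)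
        gcongr
      _ ≤ δ / 4 * (2 * n) := by gcongr
      _ = _ := by ring
  have h4 : 8 * q * (c + 1) ^ 2 * (B * ℓ ^ 3) ≤ δ * (n * w ^ 2) / 2 := by
    calc 8 * q * (c + 1) ^ 2 * (B * ℓ ^ 3) ≤ δ * ℓ / 4 * (B * ℓ ^ 3) := by gcongr
      _ = δ / 4 * (ℓ ^ 4 * B) := by ring
      _ ≤ δ / 4 * (ℓ ^ 15 * B) := by
        have : ℓ ^ 4 ≤ ℓ ^ 15 := pow_le_pow_right₀ hℓ1 (by norm_num)
        gcongr
      _ ≤ δ / 4 * (n * w ^ 2) := by gcongr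
      _ ≤ δ * (n * w ^ 2) / 2 := by nlinarith [mul_nonneg hδ0.le hN0]
  calc 4 * L * τ ^ 2 ≤ 8 * q * (c + 1) ^ 2 * (B * ℓ ^ 3) * w ^ 2 +
        8 * q * (c + 1) ^ 2 * (B * ℓ ^ 3) := by linarith
    _ ≤ δ * n / 2 * w ^ 2 + δ * (n * w ^ 2) / 2 := by gcongr
    _ = _ := by ring

theorem vert_bound {h n B L : ℕ} (hn2 : 2 ≤ n) (hB1 : 1 ≤ B)
    (hL : (2 * ((h : ℝ) + 1) + 2) * B * Real.log n ≤ L) :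
    2 * ((n : ℝ) ^ ((h + 1) * B)) ^ 2 * n ≤ Real.exp L := by
  have hn2' : (2 : ℝ) ≤ n := by exact_mod_cast hn2
  have hn' : (0 : ℝ) < n := by linarith
  have e : (2 * (h + 1) + 2) * B = 2 * (h + 1) * B + 2 * B := by ring
  calc 2 * ((n : ℝ) ^ ((h + 1) * B)) ^ 2 * n ≤ n * ((n : ℝ) ^ ((h + 1) * B)) ^ 2 * n := by
        gcongr
    _ = (n : ℝ) ^ (2 * (h + 1) * B + 2) := by ring
    _ ≤ (n : ℝ) ^ ((2 * (h + 1) + 2) * B) :=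
        pow_le_pow_right₀ (by linarith) (by omega)
    _ = Real.exp (((2 * (h + 1) + 2) * B : ℕ) * Real.log n) := by
        rw [Real.exp_nat_mul, Real.exp_log hn']
    _ ≤ Real.exp L := by
        refine Real.exp_le_exp.2 (le_trans (le_of_eq ?_) hL)
        push_cast; ring

/-- With e ≤ 2.75 the constant 132 = 4 · 4 · 3 · 2.75 makes the product equal to (εN / 2)². -/
theorem threshold_bound {N β ε θ : ℝ} (hβ0 : 0 ≤ β) (hβ1 : β ≤ 1 * N) (hβ2 : β ≤ ε ^ 2 / 132 * N)
    (hε : 0 ≤ ε * N / 2) (hθ : ε * N / 2 ≤ θ) :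
    4 * ((2 * N + β) * β) * Real.exp 1 ≤ θ ^ 2 := by
  have he : Real.exp 1 ≤ 2.75 := by linarith [Real.exp_one_lt_d9]
  calc 4 * ((2 * N + β) * β) * Real.exp 1
      ≤ 4 * ((2 * N + 1 * N) * (ε ^ 2 / 132 * N)) * 2.75 := by
        have : 0 ≤ 2 * N + β := by linarith
        have : 0 ≤ 2 * N + 1 * N := by linarith
        have : 0 ≤ ε ^ 2 / 132 * N := by linarith
        gcongr
    _ = (ε * N / 2) ^ 2 := by ring
    _ ≤ θ ^ 2 := by gcongr

-- All dependence on γ is met by taking n large, since the density hypothesis leaves powers of ℓ =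
-- log n to spare. The failure probability is dominated by the pruned edges and is O(1 / ℓ) for
-- fixed γ.
set_option maxHeartbeats 400000 in
theorem exists_params (h : ℕ) {γ : ℝ} (hγ : 0 < γ) : ∀ᶠ n : ℕ in atTop, ∀ (d : ℕ) (p : ℝ),
    1 ≤ d → d ≤ n → 0 ≤ p → p ≤ 1 →
    Real.log n ^ (5 * (h + 1) + 5) * ((n : ℝ) / d) ^ (((2 * h + 1 : ℕ) : ℝ) / 2) ≤
      p * ((n : ℝ) ^ (h + 1)) ^ 2 →
    ∃ B g L τ θ : ℕ, (1 ≤ B ∧ B ≤ d) ∧ (1 ≤ L ∧ L ≤ n) ∧ τ < n ^ (2 * (h + 1) + 3) ∧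
      θ < n ^ (4 * (h + 1) + 2) ∧ (g : ℝ) ≤ 2 * γ * n ∧
      pr p (fun Ψ : Inst (Fin n) (Tup (h + 1) n) => ¬ Certifies Ψ g B L τ θ) ≤
        4 / (n : ℝ) + (48 / (γ ^ 2 * Real.log n) + (1 / (n : ℝ) + 1 / n)) := by
  set ε : ℝ := γ ^ 2 / 12 with hε
  have hε0 : 0 < ε := by positivity
  set δ : ℝ := min 1 (ε ^ 2 / 132) with hδ
  have hδ0 : 0 < δ := by positivity
  set c : ℝ := 2 ^ (h + 1) + 1 with hc
  set C₁ : ℝ := 8 * (2 * (h + 1) + 3) * (c + 1) ^ 2 with hC₁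
  have tlog : Tendsto (fun n : ℕ => Real.log n) atTop atTop :=
    Real.tendsto_log_atTop.comp tendsto_natCast_atTop_atTop
  have elog : ∀ᶠ n : ℕ in atTop, Real.log (n : ℝ) ^ 6 ≤ n := by
    have := (Real.isLittleO_pow_log_id_atTop (n := 6)).comp_tendsto tendsto_natCast_atTop_atTop
    filter_upwards [this.bound one_pos, tlog.eventually_ge_atTop 0] with n hn h0
    simpa [abs_of_nonneg h0] using hn
  filter_upwards [elog, tlog.eventually_ge_atTop 1, tlog.eventually_ge_atTop (6 / γ ^ 2),
    tlog.eventually_ge_atTop (2 / ε), tlog.eventually_ge_atTop (4 * C₁ / δ),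
    tlog.eventually_ge_atTop (2 * (2 * (h + 1) + 3)), eventually_ge_atTop 2,
    tlog.eventually_ge_atTop (1 / γ), tlog.eventually_ge_atTop (ε + 1),
    tlog.eventually_ge_atTop (c + 2)]
    with n hℓn hℓ1 hℓγ hℓε hℓC hℓh hn2 hℓγ' hℓε' hℓc d p hd hdn hp hp1 hD
  set ℓ : ℝ := Real.log n with hℓ
  have hn : 0 < n := by omega
  have hn' : (0 : ℝ) < n := by exact_mod_cast hn
  have hd' : (0 : ℝ) < d := by exact_mod_cast hd
  have hℓ0 : 0 < ℓ := by linarith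
  have hℓle : ℓ ≤ n := (le_self_pow₀ hℓ1 (by norm_num)).trans hℓn
  have hnd : 1 ≤ (n : ℝ) / d := by rw [le_div_iff₀ hd', one_mul]; exact_mod_cast hdn
  have hDℓ : ℓ ≤ p * ((n : ℝ) ^ (h + 1)) ^ 2 := by
    refine le_trans ?_ hD
    refine le_trans (le_self_pow₀ hℓ1 (by omega : 5 * (h + 1) + 5 ≠ 0)) ?_
    exact le_mul_of_one_le_right (by positivity) (Real.one_le_rpow hnd (by positivity))
  have hp0 : 0 < p := by
    rcases hp.lt_or_eq with h0 | h0
    · exact h0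
    · rw [← h0, zero_mul] at hDℓ; linarith
  -- Dividing by ℓ⁵ keeps Lτ² below n w² even for d close to n; rounding up keeps B ≥ 1.
  set B : ℕ := ⌈(d : ℝ) / ℓ ^ 5⌉₊ with hBdef
  have hBle : (d : ℝ) / ℓ ^ 5 ≤ B := Nat.le_ceil _
  have hB1 : 1 ≤ B := Nat.ceil_pos.2 (by positivity)
  have hBd : B ≤ d := Nat.ceil_le.2 (div_le_self hd'.le (one_le_pow₀ hℓ1))
  have hBn : B ≤ n := hBd.trans hdn
  have hB' : (1 : ℝ) ≤ B := by exact_mod_cast hB1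
  have hBu : B * ℓ ^ 5 ≤ 2 * n := by
    have h1 : (B : ℝ) < d / ℓ ^ 5 + 1 := Nat.ceil_lt_add_one (by positivity)
    have h2 : B * ℓ ^ 5 ≤ d + ℓ ^ 5 := by
      calc B * ℓ ^ 5 ≤ (d / ℓ ^ 5 + 1) * ℓ ^ 5 := by gcongr
        _ = d + ℓ ^ 5 := by field_simp
    have h3 : ℓ ^ 5 ≤ n := (pow_le_pow_right₀ hℓ1 (by norm_num)).trans hℓn
    have h4 : (d : ℝ) ≤ n := by exact_mod_cast hdn
    linarith
  have hD2 : ℓ ^ (10 * (h + 1) + 10) * ((n : ℝ) / d) ^ (2 * h + 1) ≤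
      (p * ((n : ℝ) ^ (h + 1)) ^ 2) ^ 2 := by
    refine le_trans (le_of_eq ?_) (pow_le_pow_left₀ (by positivity) hD 2)
    rw [mul_pow, ← pow_mul, ← Real.rpow_mul_natCast (by positivity),
      show ((2 * h + 1 : ℕ) : ℝ) / 2 * (2 : ℕ) = ((2 * h + 1 : ℕ) : ℝ) by push_cast; ring,
      Real.rpow_natCast]
    congr 2
    ring
  set w : ℝ := p * ((B : ℝ) ^ (h + 1) * (n : ℝ) ^ (h + 1)) with hw
  have hw0 : 0 < w := by positivity
  set N : ℝ := n * w ^ 2 with hN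
  have hNB : ℓ ^ 15 * B ≤ N := mul_le_of_density hn hd hℓ1 hBle hD2
  have hNℓ : ℓ ≤ N := by
    refine le_trans ?_ hNB
    calc ℓ ≤ ℓ ^ 15 := le_self_pow₀ hℓ1 (by norm_num)
      _ ≤ ℓ ^ 15 * B := le_mul_of_one_le_right (by positivity) hB'
  -- The factor ℓ in τ makes Markov's bound for the pruned edges O(1 / ℓ). The value of L puts e^L
  -- above n times the number of vertices. The number θ is the largest one that the certificate can
  -- afford.
  set τ : ℕ := ⌈(w + c) * ℓ⌉₊ with hτ
  set L : ℕ := ⌈(2 * (h + 1) + 2) * B * ℓ⌉₊ with hL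
  set θ : ℕ := ⌊ε * N⌋₊ with hθ
  have hc0 : 0 < c := by positivity
  have hwB : w ≤ (n : ℝ) ^ (2 * (h + 1)) := by
    calc w ≤ 1 * ((n : ℝ) ^ (h + 1) * (n : ℝ) ^ (h + 1)) := by
          rw [hw]; gcongr
      _ = _ := by ring
  have hτle : (τ : ℝ) ≤ (w + (c + 1)) * ℓ := by
    have : (τ : ℝ) < (w + c) * ℓ + 1 := Nat.ceil_lt_add_one (by positivity)
    have h1 : (w + (c + 1)) * ℓ = (w + c) * ℓ + ℓ := by ring
    linarith
  have hLle : (L : ℝ) ≤ (2 * (h + 1) + 3) * (B * ℓ) := by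
    have : (L : ℝ) < (2 * (h + 1) + 2) * B * ℓ + 1 := Nat.ceil_lt_add_one (by positivity)
    have h1 := one_le_mul_of_one_le_of_one_le hB' hℓ1
    have h2 : (2 * ((h : ℝ) + 1) + 3) * (B * ℓ) = (2 * (h + 1) + 2) * B * ℓ + B * ℓ := by ring
    linarith
  have hτge : (w + c) * ℓ ≤ τ := Nat.le_ceil _
  have hLge : (2 * (h + 1) + 2) * B * ℓ ≤ L := Nat.le_ceil _
  have hτ1 : 1 ≤ τ := Nat.ceil_pos.2 (by positivity)
  have hL1 : 1 ≤ L := Nat.ceil_pos.2 (by positivity)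
  have hθle : (θ : ℝ) ≤ ε * N := Nat.floor_le (by positivity)
  have hθlt : ε * N < θ + 1 := Nat.lt_floor_add_one _
  clear_value θ L τ B
  have hβ : 4 * L * (τ : ℝ) ^ 2 ≤ δ * N := by
    have hC : C₁ ≤ δ * ℓ / 4 := by
      rw [div_le_iff₀ hδ0] at hℓC; linarith
    exact walk_bound (q := 2 * (h + 1) + 3) hδ0 hℓ1 (by positivity) hw0 hc0 (by positivity)
      (Nat.cast_nonneg _) hC hBu hNB hτle hLle
  have hN0 : 0 < N := hℓ0.trans_le hNℓ
  have hθge : ε * N / 2 ≤ θ := by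
    have h2 : 2 ≤ ε * N := by
      rw [div_le_iff₀' hε0] at hℓε
      exact hℓε.trans (by gcongr)
    linarith
  -- The certificate is proved for slack γ although 2γ is allowed, which leaves room for rounding g
  -- down to an integer.
  have hgn : γ * n ≤ (⌊2 * γ * n⌋₊ : ℕ) := by
    have h1 : 2 * γ * n < ⌊2 * γ * n⌋₊ + 1 := Nat.lt_floor_add_one _
    have h2 : 1 ≤ γ * n := by
      rw [div_le_iff₀' hγ] at hℓγ'
      exact hℓγ'.trans (by gcongr)
    linarith
  have hnpow : ∀ m : ℕ, (1 : ℝ) ≤ (n : ℝ) ^ m := fun m => one_le_pow₀ (by exact_mod_cast hn)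
  refine ⟨B, ⌊2 * γ * n⌋₊, L, τ, θ, ⟨hB1, hBd⟩, ⟨hL1, ?_⟩, ?_, ?_,
    Nat.floor_le (by positivity), ?_⟩
  · have : (L : ℝ) ≤ n := by
      refine hLle.trans ?_
      have h1 : (2 * (h + 1) + 3) * (B * ℓ) ≤ ℓ / 2 * (B * ℓ) := by
        gcongr
        linarith
      have h2 : B * ℓ ^ 2 ≤ B * ℓ ^ 5 :=
        mul_le_mul_of_nonneg_left (pow_le_pow_right₀ hℓ1 (by norm_num)) (by positivity)
      have h3 : ℓ / 2 * (B * ℓ) = B * ℓ ^ 2 / 2 := by ring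
      linarith
    exact_mod_cast this
  · have : (τ : ℝ) < (n : ℝ) ^ (2 * (h + 1) + 3) := by
      have hc1 : c + 1 < n := by linarith
      have hn2' : (2 : ℝ) ≤ n := by exact_mod_cast hn2
      calc (τ : ℝ) ≤ (w + (c + 1)) * ℓ := hτle
        _ ≤ ((n : ℝ) ^ (2 * (h + 1)) + (c + 1)) * n := by gcongr
        _ < ((n : ℝ) ^ (2 * (h + 1)) + n) * n := by gcongr
        _ ≤ ((n : ℝ) ^ (2 * (h + 1)) * n + (n : ℝ) ^ (2 * (h + 1)) * n) * n := by
          gcongr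
          · exact le_mul_of_one_le_right (by positivity) (by linarith)
          · exact le_mul_of_one_le_left (by positivity) (hnpow _)
        _ = 2 * ((n : ℝ) ^ (2 * (h + 1)) * n * n) := by ring
        _ ≤ n * ((n : ℝ) ^ (2 * (h + 1)) * n * n) := by gcongr
        _ = _ := by ring
    exact_mod_cast this
  · have : (θ : ℝ) < (n : ℝ) ^ (4 * (h + 1) + 2) := by
      have hεn : ε < n := by linarith
      calc (θ : ℝ) ≤ ε * N := hθle
        _ < n * N := by gcongr
        _ ≤ n * (n * ((n : ℝ) ^ (2 * (h + 1))) ^ 2) := by rw [hN]; gcongr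
        _ = _ := by ring
    exact_mod_cast this
  · have hγ6 : 6 ≤ γ ^ 2 * (p * ((n : ℝ) ^ (h + 1)) ^ 2) := by
      rw [div_le_iff₀' (by positivity)] at hℓγ
      exact hℓγ.trans (by gcongr)
    have hLV : 2 * ((n : ℝ) ^ ((h + 1) * B)) ^ 2 * n ≤ Real.exp L := vert_bound hn2 hB1 hLge
    have hθ2 : 4 * ((2 * N + 4 * L * (τ : ℝ) ^ 2) * (4 * L * (τ : ℝ) ^ 2)) * Real.exp 1 ≤
        (θ : ℝ) ^ 2 := by
      have hδ1 : δ ≤ 1 := min_le_left _ _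
      have hδε : δ ≤ ε ^ 2 / 132 := min_le_right _ _
      exact threshold_bound (by positivity) (hβ.trans (mul_le_mul_of_nonneg_right hδ1 hN0.le))
        (hβ.trans (mul_le_mul_of_nonneg_right hδε hN0.le)) (by positivity) hθge
    refine (pr_not_certifies_le hB1 hBn hw hp0 hp1 hn hgn hγ hγ6 hL1 hτ1 hℓ0 hτge hLV hθle
      hθ2).trans ?_
    gcongr
    have : 1 ≤ p * ((n : ℝ) ^ (h + 1)) ^ 2 := hℓ1.trans hDℓ
    calc (n : ℝ) ≤ n * (p * ((n : ℝ) ^ (h + 1)) ^ 2) := le_mul_of_one_le_right hn'.le this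
      _ = _ := by ring

end asymptotics

end Kikuchi

/-! ### Functions computed in polynomial time with polynomially bounded values. -/

namespace Ram

/-- Computed in polynomial time, with polynomially bounded values. -/
structure Feasible {Γ : Type} (C : Ctx Γ) (f : Γ → ℕ) : Prop where
  comp : Computes C f
  bdd : Bdd C f

namespace Feasible

variable {Γ : Type} {C : Ctx Γ} {f g u v : Γ → ℕ}

theorem congr (hf : Feasible C f) (h : ∀ γ, C.pre γ → f γ = g γ) : Feasible C g :=
  ⟨hf.comp.congr h, hf.bdd.mono fun γ hγ => (h γ hγ).ge⟩

theorem const (m : ℕ) : Feasible C fun _ => m := ⟨.const m, .const m⟩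

theorem add (hf : Feasible C f) (hg : Feasible C g) : Feasible C fun γ => f γ + g γ :=
  ⟨hf.comp.add hg.comp, hf.bdd.add hg.bdd⟩

theorem sub (hf : Feasible C f) (hg : Feasible C g) : Feasible C fun γ => f γ - g γ :=
  ⟨hf.comp.sub hg.comp, hf.bdd.mono fun _ _ => Nat.sub_le _ _⟩

theorem mul (hf : Feasible C f) (hg : Feasible C g) : Feasible C fun γ => f γ * g γ :=
  ⟨hf.comp.mul hg.comp hg.bdd, hf.bdd.mul hg.bdd⟩

theorem div (hf : Feasible C f) (hg : Feasible C g) (hpos : ∀ γ, C.pre γ → 0 < g γ) :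
    Feasible C fun γ => f γ / g γ :=
  ⟨hf.comp.div hg.comp hf.bdd hg.bdd hpos, hf.bdd.mono fun _ _ => Nat.div_le_self _ _⟩

theorem mod (hf : Feasible C f) (hg : Feasible C g) (hpos : ∀ γ, C.pre γ → 0 < g γ) :
    Feasible C fun γ => f γ % g γ :=
  ⟨hf.comp.mod hg.comp hf.bdd hg.bdd hpos, hf.bdd.mono fun _ _ => Nat.mod_le _ _⟩

theorem pow (hf : Feasible C f) (hg : Feasible C g) (hb : Bdd C fun γ => f γ ^ g γ) :
    Feasible C fun γ => f γ ^ g γ :=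
  ⟨hf.comp.pow hg.comp hf.bdd hg.bdd, hb⟩

theorem pow_const (hf : Feasible C f) (m : ℕ) : Feasible C fun γ => f γ ^ m :=
  hf.pow (.const m) (hf.bdd.pow_const m)

theorem bdd_ite {p : Γ → Prop} [DecidablePred p] (hu : Bdd C u) (hv : Bdd C v) :
    Bdd C fun γ => if p γ then u γ else v γ :=
  (hu.add hv).mono fun γ _ => by split_ifs <;> omega

theorem iteZero (hf : Computes C f) (hu : Feasible C u) (hv : Feasible C v) :
    Feasible C fun γ => if f γ = 0 then u γ else v γ :=
  ⟨.iteZero hf hu.comp hv.comp, bdd_ite hu.bdd hv.bdd⟩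

theorem iteEq (hf : Computes C f) (hg : Computes C g) (hu : Feasible C u) (hv : Feasible C v) :
    Feasible C fun γ => if f γ = g γ then u γ else v γ :=
  ⟨.iteEq hf hg hu.comp hv.comp, bdd_ite hu.bdd hv.bdd⟩

theorem iteLe (hf : Computes C f) (hg : Computes C g) (hu : Feasible C u) (hv : Feasible C v) :
    Feasible C fun γ => if f γ ≤ g γ then u γ else v γ :=
  ⟨.iteLe hf hg hu.comp hv.comp, bdd_ite hu.bdd hv.bdd⟩

theorem fst (hf : Feasible C f) (R : Γ → ℕ → Prop) : Feasible (C.push R) fun q => f q.1 :=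
  ⟨hf.comp.fst R, hf.bdd.fst R⟩

theorem snd_lt (hf : Bdd C f) : Feasible (C.push fun γ i => i < f γ) fun q => q.2 :=
  ⟨.snd _, hf.snd_lt⟩

theorem sum {b : Γ → ℕ} {F : Γ → ℕ → ℕ} (hb : Feasible C b)
    (hF : Feasible (C.push fun γ i => i < b γ) fun q => F q.1 q.2) :
    Feasible C fun γ => ∑ i ∈ Finset.range (b γ), F γ i := by
  refine ⟨hb.comp.sum hb.bdd hF.comp, ?_⟩
  obtain ⟨c, hc⟩ := hF.bdd
  refine (hb.bdd.mul (Bdd.size.pow_const c)).mono fun γ hγ => ?_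
  refine (Finset.sum_le_card_nsmul _ _ (C.size γ ^ c) fun i hi =>
    hc (γ, i) ⟨hγ, Finset.mem_range.1 hi⟩).trans ?_
  simp

end Feasible

theorem Computes.sum' {Γ : Type} {C : Ctx Γ} {b : Γ → ℕ} {F : Γ → ℕ → ℕ} (hb : Feasible C b)
    (hF : Computes (C.push fun γ i => i < b γ) fun q => F q.1 q.2) :
    Computes C fun γ => ∑ i ∈ Finset.range (b γ), F γ i :=
  Computes.sum (f := fun q => F q.1 q.2) hb.comp hb.bdd hF

end Ram

/-! ### The Kikuchi graph in arithmetic codes, with polynomial-time evaluation. -/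

namespace Kikuchi

open Finset

/-- Base `n` code of the values read from the tape with code `s` at the position with code `P`. -/
def readCode (n h B s P : ℕ) : ℕ :=
  ∑ j ∈ range h, s / n ^ (P / B ^ j % B + B * j) % n * n ^ j

def writeCode (n h B s P b : ℕ) : ℕ :=
  ∑ z ∈ range (h * B), (if P / B ^ (z / B) % B = z % B then b / n ^ (z / B) % n
    else s / n ^ z % n) * n ^ z

def slotAddr (n h c i x y : ℕ) : ℕ :=
  i + n * (if c = 0 then x + n ^ h * y else y + n ^ h * x)

/-- Address of the slot at one end of an edge; `q` codes a position and a value. -/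
def endAddr (n h B c i s q : ℕ) : ℕ :=
  slotAddr n h c i (readCode n h B s (q % B ^ h)) (q / B ^ h)

def endWrite (n h B s q : ℕ) : ℕ := writeCode n h B s (q % B ^ h) (q / B ^ h)

def occCode (φ : ℕ → ℕ) (n h B c i s : ℕ) : ℕ :=
  ∑ q ∈ range (B ^ h * n ^ h), if φ (endAddr n h B c i s q) = 0 then 0 else 1

/-- Status of an edge: `0` if it is not full, `3` if it is full but not included, otherwise `1` or
`2` according to the sign. -/
def kernelCode (φ : ℕ → ℕ) (n h B τ c s s' i q q' : ℕ) : ℕ :=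
  if φ (endAddr n h B c i s q) = 0 then 0 else
  if φ (endAddr n h B c i s' q') = 0 then 0 else
  if endAddr n h B c i s q = endAddr n h B c i s' q' then 0 else
  if occCode φ n h B c i s ≤ τ then
    if occCode φ n h B c i s' ≤ τ then
      if occCode φ n h B (1 - c) i (endWrite n h B s q) ≤ τ then
        if occCode φ n h B (1 - c) i (endWrite n h B s' q') ≤ τ then
          if φ (endAddr n h B c i s q) = φ (endAddr n h B c i s' q') then 1 else 2
        else 3
      else 3
    else 3
  else 3

def edgeNum (n h B : ℕ) : ℕ := n * ((B ^ h * n ^ h) * (B ^ h * n ^ h))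

def vertNum (n h B : ℕ) : ℕ := 2 * (n ^ (h * B) * n ^ (h * B))

def edgeKernel (φ : ℕ → ℕ) (n h B τ v e : ℕ) : ℕ :=
  kernelCode φ n h B τ (v % 2) (v / 2 % n ^ (h * B)) (v / 2 / n ^ (h * B)) (e % n)
    (e / n % (B ^ h * n ^ h)) (e / n / (B ^ h * n ^ h))

def nbCode (n h B v e : ℕ) : ℕ :=
  (1 - v % 2) + 2 * (endWrite n h B (v / 2 % n ^ (h * B)) (e / n % (B ^ h * n ^ h)) +
    n ^ (h * B) * endWrite n h B (v / 2 / n ^ (h * B)) (e / n / (B ^ h * n ^ h)))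

/-- Number of walks of length `t` from `v` to `v₀` of sign `+` (`σ = 0`) or `-` (`σ = 1`). -/
def walkNum (φ : ℕ → ℕ) (n h B τ v₀ : ℕ) : (t σ v : ℕ) → ℕ
  | 0, σ, v => if v = v₀ then (if σ = 0 then 1 else 0) else 0
  | t + 1, σ, v => ∑ e ∈ range (edgeNum n h B),
      if edgeKernel φ n h B τ v e = 1 then walkNum φ n h B τ v₀ t σ (nbCode n h B v e) else
      if edgeKernel φ n h B τ v e = 2 then walkNum φ n h B τ v₀ t (1 - σ) (nbCode n h B v e) else 0

def traceNum (φ : ℕ → ℕ) (n h B τ t σ : ℕ) : ℕ :=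
  ∑ v ∈ range (vertNum n h B), walkNum φ n h B τ v t σ v

def lostNum (φ : ℕ → ℕ) (n h B τ : ℕ) : ℕ :=
  ∑ v ∈ range (vertNum n h B), ∑ e ∈ range (edgeNum n h B),
    if edgeKernel φ n h B τ v e = 3 then 1 else 0

def sizeNum (φ : ℕ → ℕ) (b : ℕ) : ℕ := ∑ x ∈ range b, if φ x = 0 then 0 else 1

section feasible

open Ram

/-- Feasible parameters for the codes of vertices and edges, and a feasible table size. -/
structure Params {Γ : Type} (C : Ctx Γ) (h : ℕ) (n B b : Γ → ℕ) : Prop where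
  feas_n : Feasible C n
  feas_B : Feasible C B
  feas_b : Feasible C b
  bdd : Bdd C fun γ => n γ ^ (h * B γ)
  n_pos : ∀ γ, C.pre γ → 0 < n γ
  B_pos : ∀ γ, C.pre γ → 0 < B γ
  b_pos : ∀ γ, C.pre γ → 0 < b γ

variable {Γ : Type} {C : Ctx Γ} {h : ℕ} {n B b : Γ → ℕ} {s s' P x y c i q q' τ v e : Γ → ℕ}

namespace Params

theorem fst (H : Params C h n B b) (R : Γ → ℕ → Prop) :
    Params (C.push R) h (fun q => n q.1) (fun q => B q.1) fun q => b q.1 :=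
  ⟨H.feas_n.fst R, H.feas_B.fst R, H.feas_b.fst R, H.bdd.fst R, fun q hq => H.n_pos q.1 hq.1,
    fun q hq => H.B_pos q.1 hq.1, fun q hq => H.b_pos q.1 hq.1⟩

theorem powB (H : Params C h n B b) {f : Γ → ℕ} (hf : Feasible C f)
    (hle : ∀ γ, C.pre γ → f γ ≤ h) : Feasible C fun γ => B γ ^ f γ :=
  H.feas_B.pow hf ((H.feas_B.bdd.pow_const h).mono fun γ hγ => Nat.pow_le_pow_right (H.B_pos γ hγ) (hle γ hγ))

theorem pown (H : Params C h n B b) {f : Γ → ℕ} (hf : Feasible C f)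
    (hle : ∀ γ, C.pre γ → f γ ≤ h * B γ) : Feasible C fun γ => n γ ^ f γ :=
  H.feas_n.pow hf (H.bdd.mono fun γ hγ => Nat.pow_le_pow_right (H.n_pos γ hγ) (hle γ hγ))

theorem card (H : Params C h n B b) : Feasible C fun γ => n γ ^ (h * B γ) :=
  H.feas_n.pow ((Feasible.const h).mul H.feas_B) H.bdd

theorem ends (H : Params C h n B b) : Feasible C fun γ => B γ ^ h * n γ ^ h :=
  (H.feas_B.pow_const h).mul (H.feas_n.pow_const h)

theorem ends_pos (H : Params C h n B b) {γ : Γ} (hγ : C.pre γ) : 0 < B γ ^ h * n γ ^ h :=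
  Nat.mul_pos (pow_pos (H.B_pos γ hγ) h) (pow_pos (H.n_pos γ hγ) h)

theorem readCode (H : Params C h n B b) (hs : Feasible C s) (hP : Feasible C P) :
    Feasible C fun γ => Kikuchi.readCode (n γ) h (B γ) (s γ) (P γ) := by
  refine Feasible.sum (.const h) ?_
  have H' := H.fst fun _ i => i < h
  have hj : Feasible (C.push fun _ i => i < h) fun q => q.2 := .snd_lt (.const h)
  have hpow : ∀ q : Γ × ℕ, (C.push fun _ i => i < h).pre q → 0 < B q.1 ^ q.2 :=
    fun q hq => pow_pos (H'.B_pos q hq) _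
  refine .mul (.mod (.div (hs.fst _) (H'.pown (.add (.mod (.div (hP.fst _)
    (H'.powB hj fun q hq => hq.2.le) hpow) H'.feas_B H'.B_pos) (H'.feas_B.mul hj)) fun q hq => ?_)
    fun q hq => pow_pos (H'.n_pos q hq) _) H'.feas_n H'.n_pos) (H'.pown hj fun q hq => ?_)
  · have h1 := Nat.mod_lt (P q.1 / B q.1 ^ q.2) (H'.B_pos q hq)
    have h2 : B q.1 * (q.2 + 1) ≤ B q.1 * h := Nat.mul_le_mul_left _ hq.2
    rw [Nat.mul_comm h]
    rw [Nat.mul_succ] at h2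
    omega
  · exact hq.2.le.trans (Nat.le_mul_of_pos_right h (H'.B_pos q hq))

theorem writeCode (H : Params C h n B b) (hs : Feasible C s) (hP : Feasible C P)
    (hx : Feasible C x) : Feasible C fun γ => Kikuchi.writeCode (n γ) h (B γ) (s γ) (P γ) (x γ) := by
  have hb : Feasible C fun γ => h * B γ := (Feasible.const h).mul H.feas_B
  refine Feasible.sum hb ?_
  have H' := H.fst fun γ i => i < h * B γ
  have hz : Feasible (C.push fun γ i => i < h * B γ) fun q => q.2 := .snd_lt hb.bdd
  have hd := hz.div H'.feas_B H'.B_pos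
  have hle : ∀ q : Γ × ℕ, (C.push fun γ i => i < h * B γ).pre q → q.2 / B q.1 ≤ h := fun q hq =>
    (Nat.div_lt_of_lt_mul (by rw [Nat.mul_comm]; exact hq.2)).le
  exact .mul (.iteEq (Feasible.comp (.mod (.div (hP.fst _) (H'.powB hd hle)
    fun q hq => pow_pos (H'.B_pos q hq) _) H'.feas_B H'.B_pos)) (hz.mod H'.feas_B H'.B_pos).comp
    (.mod (.div (hx.fst _) (H'.pown hd fun q hq => (hle q hq).trans
      (Nat.le_mul_of_pos_right h (H'.B_pos q hq))) fun q hq => pow_pos (H'.n_pos q hq) _)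
      H'.feas_n H'.n_pos)
    (.mod (.div (hs.fst _) (H'.pown hz fun q hq => hq.2.le) fun q hq => pow_pos (H'.n_pos q hq) _)
      H'.feas_n H'.n_pos)) (H'.pown hz fun q hq => hq.2.le)

theorem slotAddr (H : Params C h n B b) (hc : Feasible C c) (hi : Feasible C i) (hx : Feasible C x)
    (hy : Feasible C y) : Feasible C fun γ => Kikuchi.slotAddr (n γ) h (c γ) (i γ) (x γ) (y γ) :=
  hi.add (H.feas_n.mul (.iteZero hc.comp (hx.add ((H.feas_n.pow_const h).mul hy))
    (hy.add ((H.feas_n.pow_const h).mul hx))))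

theorem endAddr (H : Params C h n B b) (hc : Feasible C c) (hi : Feasible C i) (hs : Feasible C s)
    (hq : Feasible C q) : Feasible C fun γ => Kikuchi.endAddr (n γ) h (B γ) (c γ) (i γ) (s γ) (q γ) :=
  have hB := H.feas_B.pow_const h
  have hB' : ∀ γ, C.pre γ → 0 < B γ ^ h := fun γ hγ => pow_pos (H.B_pos γ hγ) h
  H.slotAddr hc hi (H.readCode hs (hq.mod hB hB')) (hq.div hB hB')

theorem endWrite (H : Params C h n B b) (hs : Feasible C s) (hq : Feasible C q) :
    Feasible C fun γ => Kikuchi.endWrite (n γ) h (B γ) (s γ) (q γ) :=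
  have hB := H.feas_B.pow_const h
  have hB' : ∀ γ, C.pre γ → 0 < B γ ^ h := fun γ hγ => pow_pos (H.B_pos γ hγ) h
  H.writeCode hs (hq.mod hB hB') (hq.div hB hB')

/-- Reducing addresses modulo `b` confines look-ups to the input cells, so a table stored behind the
input does not affect them. -/
theorem look (H : Params C h n B b) (hx : Feasible C x) :
    Computes C fun γ => C.mem γ (x γ % b γ) :=
  .load (hx.mod H.feas_b H.b_pos).comp

theorem occCode (H : Params C h n B b) (hc : Feasible C c) (hi : Feasible C i)
    (hs : Feasible C s) : Feasible C fun γ =>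
      Kikuchi.occCode (fun x => C.mem γ (x % b γ)) (n γ) h (B γ) (c γ) (i γ) (s γ) := by
  refine Feasible.sum H.ends ?_
  have H' := H.fst fun γ i => i < B γ ^ h * n γ ^ h
  exact .iteZero (H'.look (H'.endAddr (hc.fst _) (hi.fst _) (hs.fst _) (.snd_lt H.ends.bdd)))
    (.const 0) (.const 1)

theorem kernelCode (H : Params C h n B b) (hτ : Feasible C τ) (hc : Feasible C c)
    (hs : Feasible C s) (hs' : Feasible C s') (hi : Feasible C i) (hq : Feasible C q)
    (hq' : Feasible C q') : Feasible C fun γ =>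
      Kikuchi.kernelCode (fun x => C.mem γ (x % b γ)) (n γ) h (B γ) (τ γ) (c γ) (s γ) (s' γ) (i γ) (q γ)
        (q' γ) := by
  have h1 := H.endAddr hc hi hs hq
  have h2 := H.endAddr hc hi hs' hq'
  have hc' := (Feasible.const (C := C) 1).sub hc
  exact .iteZero (H.look h1) (.const 0) <| .iteZero (H.look h2) (.const 0) <|
    .iteEq h1.comp h2.comp (.const 0) <|
    .iteLe (H.occCode hc hi hs).comp hτ.comp (.iteLe (H.occCode hc hi hs').comp hτ.comp
      (.iteLe (H.occCode hc' hi (H.endWrite hs hq)).comp hτ.comp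
        (.iteLe (H.occCode hc' hi (H.endWrite hs' hq')).comp hτ.comp
          (.iteEq (H.look h1) (H.look h2) (.const 1) (.const 2)) (.const 3)) (.const 3)) (.const 3))
      (.const 3)

theorem edgeNum (H : Params C h n B b) : Feasible C fun γ => Kikuchi.edgeNum (n γ) h (B γ) :=
  H.feas_n.mul (H.ends.mul H.ends)

theorem vertNum (H : Params C h n B b) : Feasible C fun γ => Kikuchi.vertNum (n γ) h (B γ) :=
  (Feasible.const 2).mul (H.card.mul H.card)

theorem edgeKernel (H : Params C h n B b) (hτ : Feasible C τ) (hv : Feasible C v)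
    (he : Feasible C e) : Feasible C fun γ =>
      Kikuchi.edgeKernel (fun x => C.mem γ (x % b γ)) (n γ) h (B γ) (τ γ) (v γ) (e γ) := by
  have hV : ∀ γ, C.pre γ → 0 < n γ ^ (h * B γ) := fun γ hγ => pow_pos (H.n_pos γ hγ) _
  have h2 : Feasible C fun γ => v γ / 2 := hv.div (.const 2) fun _ _ => two_pos
  have hen := he.div H.feas_n H.n_pos
  exact H.kernelCode hτ (hv.mod (.const 2) fun _ _ => two_pos) (h2.mod H.card hV)
    (h2.div H.card hV) (he.mod H.feas_n H.n_pos) (hen.mod H.ends fun γ hγ => H.ends_pos hγ)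
    (hen.div H.ends fun γ hγ => H.ends_pos hγ)

theorem nbCode (H : Params C h n B b) (hv : Feasible C v) (he : Feasible C e) :
    Feasible C fun γ => Kikuchi.nbCode (n γ) h (B γ) (v γ) (e γ) := by
  have hV : ∀ γ, C.pre γ → 0 < n γ ^ (h * B γ) := fun γ hγ => pow_pos (H.n_pos γ hγ) _
  have h2 : Feasible C fun γ => v γ / 2 := hv.div (.const 2) fun _ _ => two_pos
  have hen := he.div H.feas_n H.n_pos
  exact .add (.sub (.const 1) (hv.mod (.const 2) fun _ _ => two_pos)) (.mul (.const 2)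
    (.add (H.endWrite (h2.mod H.card hV) (hen.mod H.ends fun γ hγ => H.ends_pos hγ))
    (H.card.mul (H.endWrite (h2.div H.card hV) (hen.div H.ends fun γ hγ => H.ends_pos hγ)))))

theorem lostNum (H : Params C h n B b) (hτ : Feasible C τ) :
    Feasible C fun γ => Kikuchi.lostNum (fun x => C.mem γ (x % b γ)) (n γ) h (B γ) (τ γ) := by
  refine Feasible.sum H.vertNum ?_
  have H' := H.fst fun γ i => i < Kikuchi.vertNum (n γ) h (B γ)
  refine Feasible.sum H'.edgeNum ?_
  have H'' := H'.fst fun q i => i < Kikuchi.edgeNum (n q.1) h (B q.1)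
  exact .iteEq (H''.edgeKernel ((hτ.fst _).fst _) ((Feasible.snd_lt H.vertNum.bdd).fst _)
    (.snd_lt H'.edgeNum.bdd)).comp (.const 3) (.const 1) (.const 0)

theorem sizeNum (H : Params C h n B b) :
    Feasible C fun γ => Kikuchi.sizeNum (fun x => C.mem γ (x % b γ)) (b γ) := by
  refine Feasible.sum H.feas_b ?_
  exact .iteZero ((H.fst fun γ i => i < b γ).look (.snd_lt H.feas_b.bdd)) (.const 0) (.const 1)

end Params

end feasible

end Kikuchi

/-! ### The table of walk numbers. -/

namespace Kikuchi

open Finset Ram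

section cells

/-- The length t is the leading digit, so shorter walks have smaller addresses and the recursion
only looks back. -/
def cellIdx (Z σ v v₀ τ β t : ℕ) : ℕ := σ + Z * (v + Z * (v₀ + Z * (τ + Z * (β + Z * t))))

/-- Entry of the table of walk numbers. -/
def cellVal (φ : ℕ → ℕ) (n h d Z c : ℕ) : ℕ :=
  -- The cap changes only cells whose digit is not a legal β. It keeps B ≤ d, so even those cells
  -- obey the time bound.
  walkNum φ n h (min (c / Z / Z / Z / Z % Z) (d - 1) + 1) (c / Z / Z / Z % Z) (c / Z / Z % Z)
    (c / Z / Z / Z / Z / Z) (c % Z) (c / Z % Z)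

theorem digit_mod {Z a r : ℕ} (ha : a < Z) : (a + Z * r) % Z = a := by
  rw [Nat.add_mul_mod_self_left, Nat.mod_eq_of_lt ha]

theorem digit_div {Z a r : ℕ} (ha : a < Z) : (a + Z * r) / Z = r := by
  rw [Nat.add_mul_div_left _ _ (by omega), Nat.div_eq_of_lt ha, zero_add]

theorem digit_lt {Z a r c : ℕ} (ha : a < Z) (hr : r < c / Z) : a + Z * r < c :=
  calc a + Z * r < Z * (r + 1) := by rw [Nat.mul_succ]; omega
    _ ≤ Z * (c / Z) := Nat.mul_le_mul_left _ hr
    _ ≤ c := Nat.mul_div_le _ _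

theorem cellVal_cellIdx {φ : ℕ → ℕ} {n h d Z σ v v₀ τ β t : ℕ} (hσ : σ < Z) (hv : v < Z)
    (hv₀ : v₀ < Z) (hτ : τ < Z) (hβ : β < Z) (hβd : β < d) :
    cellVal φ n h d Z (cellIdx Z σ v v₀ τ β t) = walkNum φ n h (β + 1) τ v₀ t σ v := by
  simp only [cellVal, cellIdx, digit_mod hσ, digit_div hσ, digit_mod hv, digit_div hv,
    digit_mod hv₀, digit_div hv₀, digit_mod hτ, digit_div hτ, digit_mod hβ, digit_div hβ]
  rw [min_eq_left (by omega)]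

theorem cellIdx_lt {Z σ v v₀ τ β t c : ℕ} (hσ : σ < Z) (hv : v < Z) (hv₀ : v₀ < Z) (hτ : τ < Z)
    (hβ : β < Z) (ht : t < c / Z / Z / Z / Z / Z) : cellIdx Z σ v v₀ τ β t < c :=
  digit_lt hσ (digit_lt hv (digit_lt hv₀ (digit_lt hτ (digit_lt hβ ht))))

theorem cellIdx_lt_pow {Z σ v v₀ τ β t : ℕ} (hσ : σ < Z) (hv : v < Z) (hv₀ : v₀ < Z) (hτ : τ < Z)
    (hβ : β < Z) (ht : t < Z) : cellIdx Z σ v v₀ τ β t < Z ^ 6 := by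
  have hZ : 0 < Z := by omega
  refine cellIdx_lt hσ hv hv₀ hτ hβ (ht.trans_le (le_of_eq ?_))
  simp only [Nat.div_div_eq_div_mul]
  rw [show Z ^ 6 = Z * (Z * Z * Z * Z * Z) by ring, Nat.mul_div_cancel _ (by positivity)]

theorem writeCode_lt {n h B s P x : ℕ} (hn : 0 < n) : writeCode n h B s P x < n ^ (h * B) := by
  rw [writeCode, Finset.sum_range fun z => (if P / B ^ (z / B) % B = z % B then x / n ^ (z / B) % n
    else s / n ^ z % n) * n ^ z]
  have := (finFunctionFinEquiv (m := n) (n := h * B) fun z =>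
    ⟨if P / B ^ ((z : ℕ) / B) % B = z % B then x / n ^ ((z : ℕ) / B) % n else s / n ^ (z : ℕ) % n, by
      split_ifs <;> exact Nat.mod_lt _ hn⟩).2
  rwa [finFunctionFinEquiv_apply] at this

theorem pair_lt {a b x y : ℕ} (hx : x < a) (hy : y < b) : x + a * y < a * b :=
  calc x + a * y < a * (y + 1) := by rw [Nat.mul_succ]; omega
    _ ≤ a * b := Nat.mul_le_mul_left _ hy

theorem nbCode_lt {n h B v e : ℕ} (hn : 0 < n) : nbCode n h B v e < vertNum n h B :=
  pair_lt (by omega) (pair_lt (writeCode_lt hn) (writeCode_lt hn))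

end cells

section program

/-- Contexts in which `n` and `d` are at hand and sizes polynomial in `n ^ d` are allowed. -/
structure Base {Γ : Type} (C : Ctx Γ) (n d : Γ → ℕ) : Prop where
  feas_n : Feasible C n
  feas_d : Feasible C d
  bdd : Bdd C fun γ => n γ ^ d γ
  two_le : ∀ γ, C.pre γ → 2 ≤ n γ
  one_le : ∀ γ, C.pre γ → 1 ≤ d γ

variable {Γ : Type} {C : Ctx Γ} {h κ : ℕ} {n d : Γ → ℕ}

namespace Base

theorem fst (H : Base C n d) (R : Γ → ℕ → Prop) :
    Base (C.push R) (fun q => n q.1) fun q => d q.1 :=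
  ⟨H.feas_n.fst R, H.feas_d.fst R, H.bdd.fst R, fun q hq => H.two_le q.1 hq.1,
    fun q hq => H.one_le q.1 hq.1⟩

theorem n_pos (H : Base C n d) {γ : Γ} (hγ : C.pre γ) : 0 < n γ := by
  have := H.two_le γ hγ
  omega

theorem range (H : Base C n d) (κ : ℕ) : Feasible C fun γ => n γ ^ (κ * d γ) :=
  H.feas_n.pow ((Feasible.const κ).mul H.feas_d) ((H.bdd.pow_const κ).mono fun γ _ => by
    rw [← pow_mul, mul_comm])

theorem range_pos (H : Base C n d) (κ : ℕ) {γ : Γ} (hγ : C.pre γ) : 0 < n γ ^ (κ * d γ) :=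
  pow_pos (H.n_pos hγ) _

theorem params (H : Base C n d) (h : ℕ) {B : Γ → ℕ} (hB : Feasible C B)
    (h1 : ∀ γ, C.pre γ → 1 ≤ B γ) (h2 : ∀ γ, C.pre γ → B γ ≤ d γ) :
    Params C h n B fun γ => n γ ^ (h + h + 1) :=
  ⟨H.feas_n, hB, H.feas_n.pow_const _, (H.range h).bdd.mono fun γ hγ =>
    Nat.pow_le_pow_right (H.n_pos hγ) (Nat.mul_le_mul_left _ (h2 γ hγ)), fun _ hγ => H.n_pos hγ, h1,
    fun _ hγ => pow_pos (H.n_pos hγ) _⟩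

theorem cellIdx (H : Base C n d) {σ v v₀ τ β t : Γ → ℕ} (hσ : Feasible C σ) (hv : Feasible C v)
    (hv₀ : Feasible C v₀) (hτ : Feasible C τ) (hβ : Feasible C β) (ht : Feasible C t) :
    Feasible C fun γ => cellIdx (n γ ^ (κ * d γ)) (σ γ) (v γ) (v₀ γ) (τ γ) (β γ) (t γ) :=
  have hZ := H.range κ
  hσ.add (hZ.mul (hv.add (hZ.mul (hv₀.add (hZ.mul (hτ.add (hZ.mul (hβ.add (hZ.mul ht)))))))))

end Base

theorem feasible_min {f g : Γ → ℕ} (hf : Feasible C f) (hg : Feasible C g) :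
    Feasible C fun γ => min (f γ) (g γ) :=
  (hf.sub (hf.sub hg)).congr fun γ _ => by omega

theorem vertNum_le {n h B d κ : ℕ} (hn : 2 ≤ n) (hB : B ≤ d) (hd : 1 ≤ d) (hκ : 4 * h + 5 ≤ κ) :
    vertNum n h B ≤ n ^ (κ * d) := by
  calc vertNum n h B ≤ n * (n ^ (h * B) * n ^ (h * B)) := Nat.mul_le_mul_right _ hn
    _ = n ^ (1 + (h * B + h * B)) := by rw [pow_add, pow_add, pow_one]
    _ ≤ n ^ (κ * d) := Nat.pow_le_pow_right (by omega) (by nlinarith)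

theorem two_le_range {n d κ h : ℕ} (hn : 2 ≤ n) (hd : 1 ≤ d) (hκ : 4 * h + 5 ≤ κ) :
    2 ≤ n ^ (κ * d) := by
  calc 2 ≤ n := hn
    _ = n ^ 1 := (pow_one n).symm
    _ ≤ n ^ (κ * d) := Nat.pow_le_pow_right (by omega) (by nlinarith)

/-- One step of the recursion for walk numbers, when shorter walks are looked up in the table `M`. -/
def walkStep (M φ : ℕ → ℕ) (n h b Z σ v v₀ τ β t : ℕ) : ℕ :=
  if t = 0 then (if v = v₀ then (if σ = 0 then 1 else 0) else 0) else
  ∑ e ∈ Finset.range (edgeNum n h (β + 1)),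
    if edgeKernel φ n h (β + 1) τ v e = 1 then
      M (b + cellIdx Z σ (nbCode n h (β + 1) v e) v₀ τ β (t - 1)) else
    if edgeKernel φ n h (β + 1) τ v e = 2 then
      M (b + cellIdx Z (1 - σ) (nbCode n h (β + 1) v e) v₀ τ β (t - 1)) else 0

theorem Base.walkStep (H : Base C n d) {σ v v₀ τ β t : Γ → ℕ} (hσ : Feasible C σ)
    (hv : Feasible C v) (hv₀ : Feasible C v₀) (hτ : Feasible C τ) (hβ : Feasible C β)
    (ht : Feasible C t) (hβd : ∀ γ, C.pre γ → β γ < d γ) : Computes C fun γ =>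
      walkStep (C.mem γ) (fun x => C.mem γ (x % n γ ^ (h + h + 1))) (n γ) h (n γ ^ (h + h + 1))
        (n γ ^ (κ * d γ)) (σ γ) (v γ) (v₀ γ) (τ γ) (β γ) (t γ) := by
  have P := H.params h (hβ.add (.const 1)) (fun _ _ => Nat.le_add_left _ _) fun q hq => hβd q hq
  have he := Feasible.snd_lt P.edgeNum.bdd
  have HE := H.fst fun q i => i < edgeNum (n q) h (β q + 1)
  have PE := P.fst fun q i => i < edgeNum (n q) h (β q + 1)
  have hker := PE.edgeKernel (hτ.fst _) (hv.fst _) he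
  have hnb := PE.nbCode (hv.fst _) he
  have hidx := fun {σ} (hσ' : Feasible _ σ) => Computes.load ((HE.feas_n.pow_const (h + h + 1)).add
    (HE.cellIdx (κ := κ) hσ' hnb (hv₀.fst _) (hτ.fst _) (hβ.fst _)
      ((ht.fst _).sub (.const 1)))).comp
  refine Computes.iteZero ht.comp (Computes.iteEq hv.comp hv₀.comp
    (Computes.iteZero hσ.comp (.const 1) (.const 0)) (.const 0)) (Computes.sum' P.edgeNum ?_)
  exact Computes.iteEq hker.comp (.const 1) (hidx (hσ.fst _))
    (Computes.iteEq hker.comp (.const 2) (hidx (.sub (.const 1) (hσ.fst _))) (.const 0))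

theorem walkStep_eq {M φ : ℕ → ℕ} {n h b d κ σ v v₀ τ β t c : ℕ} (hn : 2 ≤ n) (hβd : β < d)
    (hκ : 4 * h + 5 ≤ κ) (hσ : σ < n ^ (κ * d)) (hv₀ : v₀ < n ^ (κ * d))
    (hτ : τ < n ^ (κ * d)) (hβ : β < n ^ (κ * d))
    (ht : t = c / n ^ (κ * d) / n ^ (κ * d) / n ^ (κ * d) / n ^ (κ * d) / n ^ (κ * d))
    (hM : ∀ x < c, M (b + x) = cellVal φ n h d (n ^ (κ * d)) x) :
    walkStep M φ n h b (n ^ (κ * d)) σ v v₀ τ β t = walkNum φ n h (β + 1) τ v₀ t σ v := by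
  cases t with
  | zero => rfl
  | succ t =>
    have h2 := two_le_range hn (show 1 ≤ d by omega) hκ
    simp only [walkStep, walkNum, Nat.add_one_ne_zero, if_false, Nat.add_sub_cancel]
    refine Finset.sum_congr rfl fun e _ => ?_
    have hnb : nbCode n h (β + 1) v e < n ^ (κ * d) :=
      (nbCode_lt (by omega)).trans_le (vertNum_le hn hβd (by omega) hκ)
    have key : ∀ σ' < n ^ (κ * d), M (b + cellIdx (n ^ (κ * d)) σ' (nbCode n h (β + 1) v e) v₀ τ β t)
        = walkNum φ n h (β + 1) τ v₀ t σ' (nbCode n h (β + 1) v e) := fun σ' hσ' => by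
      rw [hM _ (cellIdx_lt hσ' hnb hv₀ hτ hβ (by omega)), cellVal_cellIdx hσ' hnb hv₀ hτ hβ hβd]
    rw [key _ hσ, key (1 - σ) (by omega)]

/-- The input below the table is still intact while the table is being filled, so the instance read
from the current memory is the original one. -/
theorem computes_cell (H : Base (C.remem fun _ _ => True) (fun q => n q.1) fun q => d q.1)
    (hκ : 4 * h + 5 ≤ κ) :
    Computes (C.cell (fun γ => n γ ^ (h + h + 1)) (fun γ => (n γ ^ (κ * d γ)) ^ 6)
      fun γ => cellVal (fun x => C.mem γ (x % n γ ^ (h + h + 1))) (n γ) h (d γ) (n γ ^ (κ * d γ)))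
      fun q => cellVal (fun x => C.mem q.1.1 (x % n q.1.1 ^ (h + h + 1))) (n q.1.1) h (d q.1.1)
        (n q.1.1 ^ (κ * d q.1.1)) q.2 := by
  set D := C.cell (fun γ => n γ ^ (h + h + 1)) (fun γ => (n γ ^ (κ * d γ)) ^ 6)
      fun γ => cellVal (fun x => C.mem γ (x % n γ ^ (h + h + 1))) (n γ) h (d γ) (n γ ^ (κ * d γ))
    with hD
  have HD : Base D (fun q => n q.1.1) fun q => d q.1.1 := H.fst _
  have hZ := HD.range κ
  have hZ0 := fun q hq => HD.range_pos κ (γ := q) hq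
  have hc : Feasible D fun q => q.2 :=
    ⟨.snd _, (hZ.pow_const 6).bdd.mono fun q hq => hq.2.1.le⟩
  have hc1 := hc.div hZ hZ0
  have hc2 := hc1.div hZ hZ0
  have hc3 := hc2.div hZ hZ0
  have hc4 := hc3.div hZ hZ0
  have hc5 := hc4.div hZ hZ0
  have hβ := feasible_min (hc4.mod hZ hZ0) (HD.feas_d.sub (.const 1))
  refine (HD.walkStep (h := h) (κ := κ) (hc.mod hZ hZ0) (hc1.mod hZ hZ0) (hc2.mod hZ hZ0)
    (hc3.mod hZ hZ0) hβ hc5 fun q hq => ?_).congr fun q hq => ?_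
  · have := HD.one_le q hq
    omega
  have hd1 := HD.one_le q hq
  have hn2 := HD.two_le q hq
  have hZp := hZ0 q hq
  obtain ⟨_, -, hold, htab⟩ := hq
  have hφ : (fun x => D.mem q (x % n q.1.1 ^ (h + h + 1))) =
      fun x => C.mem q.1.1 (x % n q.1.1 ^ (h + h + 1)) := by
    funext x
    exact hold _ (Nat.mod_lt _ (pow_pos (by omega) _))
  rw [hφ, walkStep_eq (c := q.2) hn2 (by omega) hκ (Nat.mod_lt _ hZp) (Nat.mod_lt _ hZp)
    (Nat.mod_lt _ hZp) ((min_le_left _ _).trans_lt (Nat.mod_lt _ hZp)) rfl htab]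
  rfl

end program

end Kikuchi

/-! ### Exhaustive search for the best certificate. -/

namespace Kikuchi

open Finset Ram

section best

def traceTab (M : ℕ → ℕ) (n h b Z β τ t σ : ℕ) : ℕ :=
  ∑ v ∈ range (vertNum n h (β + 1)), M (b + cellIdx Z σ v v τ β t)

/-- The second inequality of a certificate. -/
def Dominates (φ : ℕ → ℕ) (n h b g β τ θ : ℕ) : Prop :=
  n ^ 3 * (2 * ((β + 1) ^ h * n ^ (h * β)) ^ 2 * sizeNum φ b +
    θ * (2 * (n ^ (h * (β + 1))) ^ 2) + lostNum φ n h (β + 1) τ) ≤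
      2 * ((β + 1) ^ h * n ^ (h * β)) ^ 2 * (g ^ 2 * sizeNum φ b ^ 2)

instance (φ : ℕ → ℕ) (n h b g β τ θ : ℕ) : Decidable (Dominates φ n h b g β τ θ) :=
  Nat.decLe _ _

/-- Negative walks are moved to the other side, so that all quantities are natural numbers. The
index β stands for B = β + 1, which keeps B positive. -/
def Check (φ : ℕ → ℕ) (n h b g β L τ θ : ℕ) : Prop :=
  traceNum φ n h (β + 1) τ (2 * L) 0 ≤ θ ^ (2 * L) + traceNum φ n h (β + 1) τ (2 * L) 1 ∧
    Dominates φ n h b g β τ θ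

def checkTab (M φ : ℕ → ℕ) (n h b Z g β L τ θ : ℕ) : ℕ :=
  if traceTab M n h b Z β τ (2 * L) 0 ≤ θ ^ (2 * L) + traceTab M n h b Z β τ (2 * L) 1 then
    (if Dominates φ n h b g β τ θ then 1 else 0) else 0

variable {Γ : Type} {C : Ctx Γ} {h κ : ℕ} {n d : Γ → ℕ}

namespace Base

theorem traceTab (H : Base C n d) {β τ t σ : Γ → ℕ} (hβ : Feasible C β) (hτ : Feasible C τ)
    (ht : Feasible C t) (hσ : Feasible C σ) (hβd : ∀ γ, C.pre γ → β γ < d γ) : Computes C fun γ =>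
      traceTab (C.mem γ) (n γ) h (n γ ^ (h + h + 1)) (n γ ^ (κ * d γ)) (β γ) (τ γ) (t γ) (σ γ) := by
  have P := H.params h (hβ.add (.const 1)) (fun _ _ => Nat.le_add_left _ _) fun q hq => hβd q hq
  have hv := Feasible.snd_lt P.vertNum.bdd
  have HE := H.fst fun q i => i < vertNum (n q) h (β q + 1)
  exact Computes.sum' P.vertNum (Computes.load ((HE.feas_n.pow_const (h + h + 1)).add
    (HE.cellIdx (κ := κ) (hσ.fst _) hv hv (hτ.fst _) (hβ.fst _) (ht.fst _))).comp)

theorem checkTab (H : Base C n d) {g β L τ θ : Γ → ℕ} (hg : Feasible C g) (hβ : Feasible C β)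
    (hL : Feasible C L) (hτ : Feasible C τ) (hθ : Feasible C θ) (hβd : ∀ γ, C.pre γ → β γ < d γ) :
    Feasible C fun γ => checkTab (C.mem γ) (fun x => C.mem γ (x % n γ ^ (h + h + 1))) (n γ) h
      (n γ ^ (h + h + 1)) (n γ ^ (κ * d γ)) (g γ) (β γ) (L γ) (τ γ) (θ γ) := by
  have P := H.params h (hβ.add (.const 1)) (fun _ _ => Nat.le_add_left _ _) fun q hq => hβd q hq
  have hL2 := (Feasible.const (C := C) 2).mul hL
  have hE := (((hβ.add (.const 1)).pow_const h).mul (P.pown ((Feasible.const h).mul hβ)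
    fun γ _ => Nat.mul_le_mul_left h (Nat.le_succ _))).pow_const 2
  have hE2 := (Feasible.const (C := C) 2).mul hE
  exact Feasible.iteLe (H.traceTab hβ hτ hL2 (.const 0) hβd)
    ((hθ.comp.pow hL2.comp hθ.bdd hL2.bdd).add (H.traceTab hβ hτ hL2 (.const 1) hβd))
    ((Feasible.iteLe ((H.feas_n.pow_const 3).mul (((hE2.mul P.sizeNum).add (hθ.mul
      ((Feasible.const 2).mul (P.card.pow_const 2)))).add (P.lostNum hτ))).comp
      (hE2.mul ((hg.pow_const 2).mul (P.sizeNum.pow_const 2))).comp (.const 1) (.const 0)).congr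
        fun γ _ => by simp only [Dominates]) (.const 0)

end Base

/-- The least `g < n` with a certificate according to the tables, or `n`. -/
def bestTab (M φ : ℕ → ℕ) (n h b d Z : ℕ) : ℕ :=
  -- The indices descend and each success overwrites the accumulator, so the least success remains.
  -- The number x encodes β, L − 1, τ and θ in mixed radix.
  down n n fun g acc => if ∑ x ∈ range (d * (n * (Z * Z))),
    checkTab M φ n h b Z g (x % d) (x / d % n + 1) (x / d / n % Z) (x / d / n / Z) = 0 then acc
    else g

theorem Base.bestTab (H : Base C n d) : Computes C fun γ =>
    bestTab (C.mem γ) (fun x => C.mem γ (x % n γ ^ (h + h + 1))) (n γ) h (n γ ^ (h + h + 1)) (d γ)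
      (n γ ^ (κ * d γ)) := by
  refine Computes.iter (F := fun q => if ∑ x ∈ Finset.range (d q.1.1 * (n q.1.1 * (n q.1.1 ^ (κ * d q.1.1) *
    n q.1.1 ^ (κ * d q.1.1)))), Kikuchi.checkTab (C.mem q.1.1)
      (fun x => C.mem q.1.1 (x % n q.1.1 ^ (h + h + 1))) (n q.1.1) h (n q.1.1 ^ (h + h + 1))
      (n q.1.1 ^ (κ * d q.1.1)) q.1.2 (x % d q.1.1) (x / d q.1.1 % n q.1.1 + 1)
      (x / d q.1.1 / n q.1.1 % n q.1.1 ^ (κ * d q.1.1))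
      (x / d q.1.1 / n q.1.1 / n q.1.1 ^ (κ * d q.1.1)) = 0 then q.2 else q.1.2)
    H.feas_n.comp H.feas_n.comp ?_ H.feas_n.bdd
  have H1 := (H.fst fun γ i => i < n γ).fst fun _ _ => True
  have hg := (Feasible.snd_lt H.feas_n.bdd).fst fun _ _ => True
  have hN := H1.feas_d.mul (H1.feas_n.mul ((H1.range κ).mul (H1.range κ)))
  refine Computes.iteZero (Feasible.comp (Feasible.sum hN ?_)) (.snd _) hg.comp
  have H2 := H1.fst fun q i => i < d q.1.1 * (n q.1.1 * (n q.1.1 ^ (κ * d q.1.1) *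
    n q.1.1 ^ (κ * d q.1.1)))
  have hx := Feasible.snd_lt hN.bdd
  have h1 := hx.div H2.feas_d H2.one_le
  have h2 := h1.div H2.feas_n fun q hq => H2.n_pos hq
  exact H2.checkTab (hg.fst _) (hx.mod H2.feas_d H2.one_le)
    ((h1.mod H2.feas_n fun q hq => H2.n_pos hq).add (.const 1))
    (h2.mod (H2.range κ) fun q hq => H2.range_pos κ hq)
    (h2.div (H2.range κ) fun q hq => H2.range_pos κ hq)
    fun q hq => Nat.mod_lt _ (H2.one_le q hq)

/-- Some certificate within the ranges of the algorithm certifies `g`. -/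
def Certified (φ : ℕ → ℕ) (n h b d Z g : ℕ) : Prop :=
  ∃ β < d, ∃ L < n, ∃ τ < Z, ∃ θ < Z, Check φ n h b g β (L + 1) τ θ

theorem traceTab_eq {M φ : ℕ → ℕ} {n h b d κ β τ t σ : ℕ} (hn : 2 ≤ n) (hβd : β < d) (hdn : d ≤ n)
    (hκ : 4 * h + 5 ≤ κ) (hτ : τ < n ^ (κ * d)) (ht : t ≤ 2 * n) (hσ : σ < 2)
    (hM : ∀ x < (n ^ (κ * d)) ^ 6, M (b + x) = cellVal φ n h d (n ^ (κ * d)) x) :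
    traceTab M n h b (n ^ (κ * d)) β τ t σ = traceNum φ n h (β + 1) τ t σ := by
  refine Finset.sum_congr rfl fun v hv => ?_
  have hnZ : 2 * n < n ^ (κ * d) := by
    calc 2 * n ≤ n * n := Nat.mul_le_mul_right _ hn
      _ < n * n * n := lt_mul_of_one_lt_right (by positivity) (by omega)
      _ = n ^ 3 := by ring
      _ ≤ n ^ (κ * d) := Nat.pow_le_pow_right (by omega) (by nlinarith)
  have hv' : v < n ^ (κ * d) :=
    (Finset.mem_range.1 hv).trans_le (vertNum_le hn hβd (by omega) hκ)
  rw [hM _ (cellIdx_lt_pow (by omega) hv' hv' hτ (by omega) (by omega)),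
    cellVal_cellIdx (by omega) hv' hv' hτ (by omega) hβd]

open Classical in
theorem bestTab_eq {M φ : ℕ → ℕ} {n h b d κ : ℕ} (hn : 2 ≤ n) (hd : 1 ≤ d) (hdn : d ≤ n)
    (hκ : 4 * h + 5 ≤ κ)
    (hM : ∀ x < (n ^ (κ * d)) ^ 6, M (b + x) = cellVal φ n h d (n ^ (κ * d)) x) :
    bestTab M φ n h b d (n ^ (κ * d)) =
      down n n fun g acc => if Certified φ n h b d (n ^ (κ * d)) g then g else acc := by
  unfold bestTab
  congr 1
  funext g acc
  have hZ := two_le_range hn hd hκ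
  set Z := n ^ (κ * d) with hZdef
  have key : (∑ x ∈ range (d * (n * (Z * Z))), checkTab M φ n h b Z g (x % d) (x / d % n + 1)
      (x / d / n % Z) (x / d / n / Z) = 0) ↔ ¬ Certified φ n h b d Z g := by
    have hchk : ∀ β < d, ∀ L < n, ∀ τ < Z, ∀ θ, (checkTab M φ n h b Z g β (L + 1) τ θ ≠ 0 ↔
        Check φ n h b g β (L + 1) τ θ) := by
      intro β hβ L hL τ hτ θ
      simp only [checkTab, Check]
      rw [traceTab_eq hn hβ hdn hκ hτ (by omega) (by omega) hM,
        traceTab_eq hn hβ hdn hκ hτ (by omega) (by omega) hM]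
      split_ifs <;> simp_all
    rw [Finset.sum_eq_zero_iff, iff_not_comm]
    push Not
    constructor
    · rintro ⟨β, hβ, L, hL, τ, hτ, θ, hθ, hc⟩
      refine ⟨β + d * (L + n * (τ + Z * θ)), Finset.mem_range.2
        (pair_lt hβ (pair_lt hL (pair_lt hτ hθ))), ?_⟩
      rw [digit_div hβ, digit_mod hβ, digit_div hL, digit_mod hL, digit_div hτ, digit_mod hτ]
      exact (hchk β hβ L hL τ hτ θ).2 hc
    · rintro ⟨x, hx, hc⟩
      rw [Finset.mem_range] at hx
      refine ⟨x % d, Nat.mod_lt _ hd, x / d % n, Nat.mod_lt _ (by omega), x / d / n % Z,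
        Nat.mod_lt _ (by omega), x / d / n / Z, ?_, (hchk _ (Nat.mod_lt _ hd) _
          (Nat.mod_lt _ (by omega)) _ (Nat.mod_lt _ (by omega)) _).1 hc⟩
      exact Nat.div_lt_of_lt_mul (Nat.div_lt_of_lt_mul (Nat.div_lt_of_lt_mul hx))
  by_cases hC : Certified φ n h b d Z g
  · rw [if_neg (mt key.1 (not_not.2 hC)), if_pos hC]
  · rw [if_pos (key.2 hC), if_neg hC]

open Classical in
theorem exists_prog_best (H : Base C n d)
    (HR : ∀ R, Base (C.remem R) (fun q => n q.1) fun q => d q.1) (hdn : ∀ γ, C.pre γ → d γ ≤ n γ)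
    (hκ : 4 * h + 5 ≤ κ) (r : ℕ) (ρ : C.Idx → ℕ) (hρ : ∀ j, ρ j < r) :
    ∃ (c : ℕ) (P : Prog), ∀ (γ : Γ) (s : State), C.pre γ → s.mem = C.mem γ →
      (∀ j, s.reg (ρ j) = C.var j γ) → ∃ (t : ℕ) (s' : State), Exec P s t s' ∧
        t ≤ C.size γ ^ c ∧ s'.reg 0 = n γ + (down (n γ) (n γ) fun g acc =>
          if Certified (fun x => C.mem γ (x % n γ ^ (h + h + 1))) (n γ) h (n γ ^ (h + h + 1)) (d γ)
            (n γ ^ (κ * d γ)) g then g else acc) ∧ s'.reg 1 = 2 * n γ := by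
  have hT := (H.range κ).pow_const 6
  obtain ⟨c, P, hP⟩ := exists_prog_table (H.feas_n.pow_const (h + h + 1)).comp hT.comp hT.bdd
    (computes_cell (HR _) hκ) (((HR _).feas_n.comp).add (HR _).bestTab)
    ((Feasible.const 2).mul (HR _).feas_n).comp r ρ hρ
  refine ⟨c, P, fun γ s hγ hm hv => ?_⟩
  obtain ⟨t, s', μ, he, ht, ⟨hold, htab⟩, h0, h1⟩ := hP γ s hγ hm hv
  refine ⟨t, s', he, ht, ?_, h1⟩
  have hφ : (fun x => μ (x % n γ ^ (h + h + 1))) = fun x => C.mem γ (x % n γ ^ (h + h + 1)) := by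
    funext x
    exact hold _ (Nat.mod_lt _ (pow_pos (H.n_pos hγ) _))
  rw [h0, ← bestTab_eq (H.two_le γ hγ) (H.one_le γ hγ) (hdn γ hγ) hκ htab, ← hφ]

end best

end Kikuchi

/-! ### Agreement of the arithmetic codes with the combinatorial objects. -/

namespace Kikuchi

open Finset

section codes

variable {m n h B : ℕ}

/-- Base `n` code of a tuple. -/
def cd (a : Tup m n) : ℕ := (finFunctionFinEquiv a : Fin (n ^ m))

theorem cd_eq (a : Tup m n) : cd a = ∑ i, (a i : ℕ) * n ^ (i : ℕ) := finFunctionFinEquiv_apply a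

theorem cd_lt (a : Tup m n) : cd a < n ^ m := (finFunctionFinEquiv a).2

theorem cd_injective : Function.Injective (cd : Tup m n → ℕ) :=
  Fin.val_injective.comp finFunctionFinEquiv.injective

theorem cd_digit (a : Tup m n) (i : Fin m) : cd a / n ^ (i : ℕ) % n = a i := by
  conv_rhs => rw [← finFunctionFinEquiv.symm_apply_apply a]
  rfl

theorem sum_cd {M : Type*} [AddCommMonoid M] (f : ℕ → M) :
    ∑ a : Tup m n, f (cd a) = ∑ x ∈ range (n ^ m), f x :=
  (finFunctionFinEquiv.sum_comp fun x => f x).trans (Fin.sum_univ_eq_sum_range f _)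

theorem sum_range_mul {M : Type*} [AddCommMonoid M] (a b : ℕ) (f : ℕ → M) :
    ∑ x ∈ range (a * b), f x = ∑ x ∈ range a, ∑ y ∈ range b, f (x + a * y) := by
  rw [Finset.sum_comm]
  induction b with
  | zero => simp
  | succ b ih =>
    rw [Nat.mul_succ, Finset.sum_range_add, ih, Finset.sum_range_succ]
    simp only [add_comm]

theorem readCode_cd (s : Tup (h * B) n) (p : Tup h B) :
    readCode n h B (cd s) (cd p) = cd ((tape h B n).rd s p) := by
  rw [readCode, cd_eq ((tape h B n).rd s p), Finset.sum_range]
  refine Finset.sum_congr rfl fun j _ => ?_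
  rw [cd_digit]
  congr 1
  exact cd_digit s (finProdFinEquiv (j, p j))

theorem writeCode_cd (s : Tup (h * B) n) (p : Tup h B) (b : Tup h n) :
    writeCode n h B (cd s) (cd p) (cd b) = cd ((tape h B n).wr s p b) := by
  rw [writeCode, cd_eq ((tape h B n).wr s p b), Finset.sum_range]
  refine Finset.sum_congr rfl fun z _ => ?_
  have h1 : (z : ℕ) / B = (finProdFinEquiv.symm z).1 := rfl
  have h2 : (z : ℕ) % B = (finProdFinEquiv.symm z).2 := rfl
  rw [h1, h2, cd_digit, cd_digit, cd_digit]
  congr 1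
  by_cases hz : (finProdFinEquiv.symm z).2 = p (finProdFinEquiv.symm z).1
  · simp only [tape, hz, if_true]
  · simp only [tape, if_neg hz, Fin.val_inj, if_neg (Ne.symm hz)]

theorem cd_slot (i : Fin n) (a b : Tup h n) : cd (slot i a b) = i + n * (cd a + n ^ h * cd b) := by
  rw [cd_eq (slot i a b), Fin.sum_univ_succ, Fin.sum_univ_add]
  simp only [slot, Fin.cons_zero, Fin.cons_succ, Fin.append_left, Fin.append_right, Fin.val_zero,
    Fin.val_succ, Fin.val_castAdd, Fin.val_natAdd, pow_zero, mul_one, cd_eq, mul_add,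
    Finset.mul_sum]
  congr 2 <;> exact Finset.sum_congr rfl fun j _ => by ring

theorem slotAddr_cd (c : Bool) (i : Fin n) (a b : Tup h n) :
    slotAddr n h c.toNat i (cd a) (cd b) = cd (slot i (lab c a b).1 (lab c a b).2) := by
  rw [cd_slot]
  cases c <;> rfl

def pairCode (q : Tup h B × Tup h n) : ℕ := cd q.1 + B ^ h * cd q.2

def edgeCode (e : Edge (Fin n) (Tup h B) (Tup h n)) : ℕ :=
  e.1 + n * (pairCode e.2.1 + (B ^ h * n ^ h) * pairCode e.2.2)

def vertCode (v : Vert (Tup (h * B) n)) : ℕ := v.1.toNat + 2 * (cd v.2.1 + n ^ (h * B) * cd v.2.2)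

theorem pairCode_lt (q : Tup h B × Tup h n) : pairCode q < B ^ h * n ^ h := pair_lt (cd_lt _) (cd_lt _)

theorem sum_pairCode {M : Type*} [AddCommMonoid M] (f : ℕ → M) :
    ∑ q : Tup h B × Tup h n, f (pairCode q) = ∑ x ∈ range (B ^ h * n ^ h), f x := by
  rw [Fintype.sum_prod_type, sum_range_mul, ← sum_cd fun x => ∑ y ∈ range (n ^ h), f (x + B ^ h * y)]
  exact Finset.sum_congr rfl fun a _ => sum_cd fun y => f (cd a + B ^ h * y)

theorem sum_edgeCode {M : Type*} [AddCommMonoid M] (f : ℕ → M) :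
    ∑ e : Edge (Fin n) (Tup h B) (Tup h n), f (edgeCode e) = ∑ x ∈ range (edgeNum n h B), f x := by
  rw [Fintype.sum_prod_type, edgeNum, sum_range_mul, Finset.sum_range]
  refine Finset.sum_congr rfl fun i _ => ?_
  rw [Fintype.sum_prod_type, sum_range_mul, ← sum_pairCode fun x => ∑ y ∈ range (B ^ h * n ^ h),
    f (i + n * (x + B ^ h * n ^ h * y))]
  exact Finset.sum_congr rfl fun q _ => sum_pairCode fun y =>
    f (i + n * (pairCode q + B ^ h * n ^ h * y))

theorem sum_vertCode {M : Type*} [AddCommMonoid M] (f : ℕ → M) :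
    ∑ v : Vert (Tup (h * B) n), f (vertCode v) = ∑ x ∈ range (vertNum n h B), f x := by
  rw [Fintype.sum_prod_type, vertNum, sum_range_mul, Finset.sum_range_succ, Finset.sum_range_one,
    Fintype.sum_bool, add_comm]
  have key : ∀ c : ℕ, ∑ q : Tup (h * B) n × Tup (h * B) n,
      f (c + 2 * (cd q.1 + n ^ (h * B) * cd q.2)) =
      ∑ y ∈ range (n ^ (h * B) * n ^ (h * B)), f (c + 2 * y) := by
    intro c
    rw [Fintype.sum_prod_type, sum_range_mul, ← sum_cd fun x => ∑ y ∈ range (n ^ (h * B)),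
      f (c + 2 * (x + n ^ (h * B) * y))]
    exact Finset.sum_congr rfl fun a _ => sum_cd fun y => f (c + 2 * (cd a + n ^ (h * B) * y))
  exact congrArg₂ (· + ·) (key 0) (key 1)

theorem vertCode_injective : Function.Injective (vertCode : Vert (Tup (h * B) n) → ℕ) := by
  rintro ⟨c, s, s'⟩ ⟨c', u, u'⟩ he
  simp only [vertCode] at he
  have hc : ∀ c : Bool, c.toNat < 2 := Bool.toNat_lt
  have h1 := congrArg (· % 2) he
  have h2 := congrArg (· / 2) he
  simp only [digit_mod (hc _), digit_div (hc _)] at h1 h2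
  have h3 := congrArg (· % n ^ (h * B)) h2
  have h4 := congrArg (· / n ^ (h * B)) h2
  simp only [digit_mod (cd_lt _), digit_div (cd_lt _)] at h3 h4
  rw [cd_injective h3, cd_injective h4]
  cases c <;> cases c' <;> simp_all

end codes

section link

open Classical

variable {n h B : ℕ} {φ : ℕ → ℕ} {Φ : KXor.Formula (h + h + 1) n}

theorem slotCode_eq_zero {o : Option ℤˣ} : KXor.slotCode o = 0 ↔ ¬ o.isSome := by
  rcases o with _ | η
  · simp [KXor.slotCode]
  · simp only [KXor.slotCode]
    split_ifs <;> simp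

theorem slotCode_injective : Function.Injective KXor.slotCode := by
  rintro (_ | η) (_ | η') he
  · rfl
  · simp only [KXor.slotCode] at he
    split_ifs at he
  · simp only [KXor.slotCode] at he
    split_ifs at he
  · rcases Int.units_eq_one_or η with rfl | rfl <;> rcases Int.units_eq_one_or η' with rfl | rfl <;>
      simp [KXor.slotCode] at he ⊢

theorem sgn_mul_sgn {o o' : Option ℤˣ} (ho : o.isSome) (ho' : o'.isSome) :
    sgn o * sgn o' = if o = o' then 1 else -1 := by
  obtain ⟨η, rfl⟩ := Option.isSome_iff_exists.1 ho
  obtain ⟨η', rfl⟩ := Option.isSome_iff_exists.1 ho'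
  rcases Int.units_eq_one_or η with rfl | rfl <;> rcases Int.units_eq_one_or η' with rfl | rfl <;>
    simp [sgn]

theorem endAddr_code (c : Bool) (i : Fin n) (s : Tup (h * B) n) (q : Tup h B × Tup h n) :
    endAddr n h B c.toNat i (cd s) (pairCode q) =
      cd (slot i (lab c ((tape h B n).rd s q.1) q.2).1 (lab c ((tape h B n).rd s q.1) q.2).2) := by
  rw [endAddr, pairCode, digit_mod (cd_lt _), digit_div (cd_lt _), readCode_cd, slotAddr_cd]

theorem endWrite_code (s : Tup (h * B) n) (q : Tup h B × Tup h n) :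
    endWrite n h B (cd s) (pairCode q) = cd ((tape h B n).wr s q.1 q.2) := by
  rw [endWrite, pairCode, digit_mod (cd_lt _), digit_div (cd_lt _), writeCode_cd]

theorem nbCode_code (v : Vert (Tup (h * B) n)) (e : Edge (Fin n) (Tup h B) (Tup h n)) :
    nbCode n h B (vertCode v) (edgeCode e) = vertCode (nb (tape h B n) v e) := by
  rw [nbCode, vertCode, edgeCode, digit_mod (Bool.toNat_lt _), digit_div (Bool.toNat_lt _),
    digit_mod (cd_lt _), digit_div (cd_lt _), digit_div e.1.2, digit_mod (pairCode_lt _),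
    digit_div (pairCode_lt _), endWrite_code, endWrite_code]
  obtain ⟨c, s, s'⟩ := v
  cases c <;> rfl

theorem occCode_code (hφ : ∀ S, φ (cd S) = KXor.slotCode (Φ S)) (c : Bool) (i : Fin n) (s : Tup (h * B) n) :
    occCode φ n h B c.toNat i (cd s) = occ (tape h B n) (inst Φ) c i s := by
  rw [occCode, ← sum_pairCode, occ, Finset.card_filter]
  refine Finset.sum_congr rfl fun q _ => ?_
  rw [endAddr_code, hφ]
  simp only [slotCode_eq_zero, ite_not]
  rfl

theorem edgeKernel_code (hφ : ∀ S, φ (cd S) = KXor.slotCode (Φ S)) (τ : ℕ) (v : Vert (Tup (h * B) n)) (e : Edge (Fin n) (Tup h B) (Tup h n)) :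
    edgeKernel φ n h B τ (vertCode v) (edgeCode e) =
      if Full (tape h B n) (inst Φ) v e then
        if Incl (tape h B n) (inst Φ) τ v e then
          if inst Φ e.1 (lab1 (tape h B n) v e) = inst Φ e.1 (lab2 (tape h B n) v e) then 1 else 2
        else 3
      else 0 := by
  rw [edgeKernel, vertCode, edgeCode, digit_mod (Bool.toNat_lt _), digit_div (Bool.toNat_lt _),
    digit_mod (cd_lt _), digit_div (cd_lt _), digit_div e.1.2, digit_mod e.1.2,
    digit_mod (pairCode_lt _), digit_div (pairCode_lt _)]
  have hc : 1 - v.1.toNat = (!v.1).toNat := by cases v.1 <;> rfl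
  have hinj : endAddr n h B v.1.toNat e.1 (cd v.2.1) (pairCode e.2.1) =
      endAddr n h B v.1.toNat e.1 (cd v.2.2) (pairCode e.2.2) ↔
      lab1 (tape h B n) v e = lab2 (tape h B n) v e := by
    rw [endAddr_code, endAddr_code, cd_injective.eq_iff]
    constructor
    · intro he
      have := (slotEquiv h n).injective (a₁ := (e.1, lab1 (tape h B n) v e))
        (a₂ := (e.1, lab2 (tape h B n) v e)) he
      exact (Prod.mk.inj this).2
    · intro he
      rw [lab1, lab2] at he
      rw [he]
  have h1 : φ (endAddr n h B v.1.toNat e.1 (cd v.2.1) (pairCode e.2.1)) =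
      KXor.slotCode (inst Φ e.1 (lab1 (tape h B n) v e)) := by rw [endAddr_code, hφ]; rfl
  have h2 : φ (endAddr n h B v.1.toNat e.1 (cd v.2.2) (pairCode e.2.2)) =
      KXor.slotCode (inst Φ e.1 (lab2 (tape h B n) v e)) := by rw [endAddr_code, hφ]; rfl
  have hI : Incl (tape h B n) (inst Φ) τ v e ↔ Full (tape h B n) (inst Φ) v e ∧
      (occ (tape h B n) (inst Φ) v.1 e.1 v.2.1 ≤ τ ∧ occ (tape h B n) (inst Φ) v.1 e.1 v.2.2 ≤ τ) ∧
      occ (tape h B n) (inst Φ) (!v.1) e.1 ((tape h B n).wr v.2.1 e.2.1.1 e.2.1.2) ≤ τ ∧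
      occ (tape h B n) (inst Φ) (!v.1) e.1 ((tape h B n).wr v.2.2 e.2.2.1 e.2.2.2) ≤ τ := Iff.rfl
  simp only [kernelCode, hinj, h1, h2, hc, endWrite_code, occCode_code hφ,
    slotCode_injective.eq_iff, slotCode_eq_zero]
  by_cases hF : Full (tape h B n) (inst Φ) v e
  · rw [if_neg (not_not.2 hF.2.1), if_neg (not_not.2 hF.2.2), if_neg hF.1, if_pos hF]
    by_cases hi : Incl (tape h B n) (inst Φ) τ v e
    · obtain ⟨-, ⟨k1, k2⟩, k3, k4⟩ := hI.1 hi
      rw [if_pos k1, if_pos k2, if_pos k3, if_pos k4, if_pos hi]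
    · rw [if_neg hi]
      rw [hI] at hi
      split_ifs with k1 k2 k3 k4
      · exact absurd ⟨hF, ⟨k1, k2⟩, k3, k4⟩ hi
      · exact absurd ⟨hF, ⟨k1, k2⟩, k3, k4⟩ hi
      all_goals rfl
  · rw [if_neg hF]
    split_ifs with k1 k2 k3
    all_goals first | rfl | exact absurd ⟨k3, k1, k2⟩ hF

/-- All weights of included edges are ±1, so an entry of a power is the number of positive walks
minus the number of negative ones. -/
theorem mat_pow_code (hφ : ∀ S, φ (cd S) = KXor.slotCode (Φ S)) (τ t : ℕ) (v v₀ : Vert (Tup (h * B) n)) :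
    (mat (tape h B n) (inst Φ) τ ^ t) v v₀ = (walkNum φ n h B τ (vertCode v₀) t 0 (vertCode v) : ℝ) -
      walkNum φ n h B τ (vertCode v₀) t 1 (vertCode v) := by
  induction t generalizing v with
  | zero =>
    simp only [pow_zero, Matrix.one_apply, walkNum, vertCode_injective.eq_iff]
    split_ifs <;> simp_all
  | succ t ih =>
    have h1 : (mat (tape h B n) (inst Φ) τ ^ (t + 1)) v v₀ =
        ∑ e : Edge (Fin n) (Tup h B) (Tup h n), if Incl (tape h B n) (inst Φ) τ v e then
          wgt (tape h B n) (inst Φ) v e *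
            (mat (tape h B n) (inst Φ) τ ^ t) (nb (tape h B n) v e) v₀ else 0 := by
      rw [pow_succ', Matrix.mul_apply]
      simp only [mat, Finset.sum_mul]
      rw [Finset.sum_comm]
      refine Finset.sum_congr rfl fun e _ => ?_
      rw [Finset.sum_eq_single (nb (tape h B n) v e)]
      · simp
      · intro u _ hu
        simp [hu.symm]
      · simp
    rw [h1, walkNum, walkNum, ← sum_edgeCode, ← sum_edgeCode]
    push_cast
    rw [← Finset.sum_sub_distrib]
    refine Finset.sum_congr rfl fun e _ => ?_
    have hk := edgeKernel_code hφ τ v e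
    rw [nbCode_code, ih]
    by_cases hI : Incl (tape h B n) (inst Φ) τ v e
    · have hF := hI.1
      rw [if_pos hI, wgt, sgn_mul_sgn hF.2.1 hF.2.2]
      rw [if_pos hF, if_pos hI] at hk
      by_cases he : inst Φ e.1 (lab1 (tape h B n) v e) = inst Φ e.1 (lab2 (tape h B n) v e)
      · rw [if_pos he] at hk ⊢
        rw [hk, if_pos rfl, if_pos rfl, one_mul]
      · rw [if_neg he] at hk ⊢
        rw [hk, if_neg (by norm_num), if_pos rfl, if_neg (by norm_num), if_pos rfl]
        ring
    · rw [if_neg hI]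
      have h12 : edgeKernel φ n h B τ (vertCode v) (edgeCode e) ≠ 1 ∧
          edgeKernel φ n h B τ (vertCode v) (edgeCode e) ≠ 2 := by
        rw [hk, if_neg hI]
        split_ifs <;> exact ⟨by norm_num, by norm_num⟩
      rw [if_neg h12.1, if_neg h12.2, if_neg h12.1, if_neg h12.2, sub_self]

theorem trace_code (hφ : ∀ S, φ (cd S) = KXor.slotCode (Φ S)) (τ t : ℕ) : (mat (tape h B n) (inst Φ) τ ^ t).trace =
    (traceNum φ n h B τ t 0 : ℝ) - traceNum φ n h B τ t 1 := by
  rw [traceNum, traceNum, ← sum_vertCode, ← sum_vertCode]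
  push_cast
  rw [← Finset.sum_sub_distrib]
  exact Finset.sum_congr rfl fun v _ => mat_pow_code hφ τ t v v

theorem lostNum_code (hφ : ∀ S, φ (cd S) = KXor.slotCode (Φ S)) (τ : ℕ) : lostNum φ n h B τ = lost (tape h B n) (inst Φ) τ := by
  rw [lostNum, lost, Finset.card_filter, Fintype.sum_prod_type, ← sum_vertCode]
  refine Finset.sum_congr rfl fun v _ => ?_
  rw [← sum_edgeCode]
  refine Finset.sum_congr rfl fun e _ => ?_
  rw [edgeKernel_code hφ]
  by_cases hF : Full (tape h B n) (inst Φ) v e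
  · by_cases hI : Incl (tape h B n) (inst Φ) τ v e
    · rw [if_pos hF, if_pos hI, if_neg (by split_ifs <;> norm_num)]
      exact (if_neg fun hc => hc.2 hI).symm
    · rw [if_pos hF, if_neg hI, if_pos rfl]
      exact (if_pos ⟨hF, hI⟩).symm
  · rw [if_neg hF, if_neg (by norm_num)]
    exact (if_neg fun hc => hF hc.1).symm

theorem sizeNum_code (hφ : ∀ S, φ (cd S) = KXor.slotCode (Φ S)) : sizeNum φ (n ^ (h + h + 1)) = size (inst Φ) := by
  rw [size_inst, KXor.constraints, Finset.card_filter, sizeNum, ← sum_cd]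
  refine Finset.sum_congr rfl fun S _ => ?_
  rw [hφ]
  simp only [slotCode_eq_zero, ite_not]

theorem check_iff (hφ : ∀ S, φ (cd S) = KXor.slotCode (Φ S)) (g β L τ θ : ℕ) : Check φ n h (n ^ (h + h + 1)) g β L τ θ ↔
    Certifies (inst Φ) g (β + 1) L τ θ := by
  rw [Check, Certifies, Dominates, lostNum_code hφ, sizeNum_code hφ, trace_code hφ,
    Nat.add_sub_cancel, sub_le_iff_le_add]
  exact and_congr_left fun _ => by exact_mod_cast Iff.rfl

end link

end Kikuchi

/-! ### Assembling the algorithm and its guarantees. -/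

namespace Ram

open Classical in
theorem down_ite_spec (p : ℕ → Prop) (b a : ℕ) :
    ((down b a fun g acc => if p g then g else acc) = a ∨
      ((down b a fun g acc => if p g then g else acc) < b ∧
        p (down b a fun g acc => if p g then g else acc))) ∧
    ∀ g < b, p g → (down b a fun g acc => if p g then g else acc) ≤ g := by
  induction b generalizing a with
  | zero => exact ⟨.inl rfl, fun g hg => by omega⟩
  | succ b ih =>
    rw [down]
    obtain ⟨h1, h2⟩ := ih (if p b then b else a)
    set r := down b (if p b then b else a) fun g acc => if p g then g else acc
    refine ⟨?_, fun g hg hp => ?_⟩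
    · rcases h1 with h1 | ⟨h1, h3⟩
      · by_cases hb : p b
        · rw [if_pos hb] at h1
          exact .inr ⟨by omega, h1 ▸ hb⟩
        · rw [if_neg hb] at h1
          exact .inl h1
      · exact .inr ⟨by omega, h3⟩
    · rcases Nat.lt_succ_iff_lt_or_eq.1 hg with hg | rfl
      · exact h2 g hg hp
      · rw [if_pos hp] at h1
        omega

end Ram

namespace Kikuchi

section algorithm

open Ram

variable {h n : ℕ}

/-- Some parameters within the ranges of the algorithm certify the bound `1 / 2 + g / (2 n)`. -/
def Certifiable (Ψ : Inst (Fin n) (Tup h n)) (d g : ℕ) : Prop :=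
  ∃ β < d, ∃ L < n, ∃ τ < n ^ ((4 * h + 5) * d), ∃ θ < n ^ ((4 * h + 5) * d),
    Certifies Ψ g (β + 1) (L + 1) τ θ

open Classical in
/-- The least `g < n` whose bound is certified, or `n`. -/
noncomputable def best (Ψ : Inst (Fin n) (Tup h n)) (d : ℕ) : ℕ :=
  down n n fun g acc => if Certifiable Ψ d g then g else acc

theorem best_le {Ψ : Inst (Fin n) (Tup h n)} {d g : ℕ} (hg : Certifiable Ψ d g) : best Ψ d ≤ g := by
  classical
  obtain ⟨h1, h2⟩ := down_ite_spec (Certifiable Ψ d) n n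
  rcases lt_or_ge g n with hgn | hgn
  · exact h2 g hgn hg
  · refine le_trans ?_ hgn
    rcases h1 with h1 | h1
    · exact h1.le
    · exact h1.1.le

/-- The certified upper bound. -/
noncomputable def bound (Ψ : Inst (Fin n) (Tup h n)) (d : ℕ) : ℚ :=
  ((n + best Ψ d : ℕ) : ℚ) / ((2 * n : ℕ) : ℚ)

theorem satFraction_le_one (Φ : KXor.Formula (h + h + 1) n) (x : Fin n → ℤˣ) :
    KXor.satFraction Φ x ≤ 1 := by
  refine div_le_one_of_le₀ ?_ (Nat.cast_nonneg _)
  refine Nat.cast_le.2 (Finset.card_le_card fun S hS => ?_)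
  simp only [KXor.satisfied, KXor.constraints, Finset.mem_filter, Finset.mem_univ, true_and] at hS ⊢
  rw [hS]
  rfl

theorem satFraction_le_bound (hn : 0 < n) (d : ℕ) (Φ : KXor.Formula (h + h + 1) n)
    (x : Fin n → ℤˣ) : KXor.satFraction Φ x ≤ (bound (inst Φ) d : ℝ) := by
  classical
  have hb : ((bound (inst Φ) d : ℚ) : ℝ) =
      ((n + best (inst Φ) d : ℕ) : ℝ) / ((2 * n : ℕ) : ℝ) := by
    rw [bound, Rat.cast_div, Rat.cast_natCast, Rat.cast_natCast]
  rw [hb]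
  rcases (down_ite_spec (Certifiable (inst Φ) d) n n).1 with h1 | ⟨-, h1⟩
  -- Without any certificate the output is (n + n) / (2n) = 1, the trivial bound.
  · have h2 : best (inst Φ) d = n := h1
    refine (satFraction_le_one Φ x).trans (le_of_eq ?_)
    rw [h2, ← two_mul, div_self]
    exact_mod_cast (by omega : 2 * n ≠ 0)
  · obtain ⟨β, -, L, -, τ, -, θ, -, hc⟩ := h1
    exact satFraction_le_of_certifies Φ x hn (Nat.succ_pos β) (Nat.succ_ne_zero L) hc

theorem bound_le {Ψ : Inst (Fin n) (Tup h n)} {d g : ℕ} {γ : ℝ} (hn : 0 < n)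
    (hg : Certifiable Ψ d g) (hγ : (g : ℝ) ≤ 2 * γ * n) : (bound Ψ d : ℝ) ≤ 1 / 2 + γ := by
  have hn' : (0 : ℝ) < n := by exact_mod_cast hn
  have h1 : (best Ψ d : ℝ) ≤ g := by exact_mod_cast best_le hg
  rw [bound, Rat.cast_div, Rat.cast_natCast, Rat.cast_natCast, div_le_iff₀ (by positivity)]
  push_cast
  linarith

/-- The tasks of the algorithm: `n`, `d` and a formula. -/
def taskCtx (h : ℕ) : Ctx (Σ n : ℕ, ℕ × KXor.Formula (h + h + 1) n) where
  Idx := Bool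
  var j q := if j then q.1 else q.2.1
  pre q := 2 ≤ q.1 ∧ 1 ≤ q.2.1 ∧ q.2.1 ≤ q.1
  size q := q.1 ^ q.2.1
  mem q := (KXor.inputState q.2.1 q.2.2).mem
  two_le q hq := hq.1.trans (Nat.le_self_pow (by have := hq.2.1; omega) _)

theorem base_of_size {Γ : Type} {C : Ctx Γ} {n d : Γ → ℕ} (hn : Computes C n) (hd : Computes C d)
    (hs : ∀ γ, C.size γ = n γ ^ d γ) (h2 : ∀ γ, C.pre γ → 2 ≤ n γ) (h1 : ∀ γ, C.pre γ → 1 ≤ d γ) :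
    Base C n d where
  feas_n := ⟨hn, Bdd.size.mono fun γ hγ => by
    rw [hs]
    exact Nat.le_self_pow (by have := h1 γ hγ; omega) _⟩
  feas_d := ⟨hd, Bdd.size.mono fun γ hγ => by
    rw [hs]
    exact (Nat.lt_pow_self (h2 γ hγ)).le⟩
  bdd := Bdd.size.mono fun γ _ => (hs γ).ge
  two_le := h2
  one_le := h1

theorem certified_iff {φ : ℕ → ℕ} {Φ : KXor.Formula (h + h + 1) n}
    (hφ : ∀ S, φ (cd S) = KXor.slotCode (Φ S)) (d g : ℕ) :
    Certified φ n h (n ^ (h + h + 1)) d (n ^ ((4 * h + 5) * d)) g ↔ Certifiable (inst Φ) d g := by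
  simp only [Certified, Certifiable, check_iff hφ]

theorem inputState_mem_cd (d : ℕ) (Φ : KXor.Formula (h + h + 1) n) (S : Tup (h + h + 1) n) :
    (KXor.inputState d Φ).mem (cd S % n ^ (h + h + 1)) = KXor.slotCode (Φ S) := by
  rw [Nat.mod_eq_of_lt (cd_lt S)]
  simp only [KXor.inputState, dif_pos (cd_lt S)]
  congr 2
  exact finFunctionFinEquiv.symm_apply_apply S

theorem exists_prog_bound (h : ℕ) : ∃ (A : Prog) (C : ℕ),
    KXor.ComputesInTime A C fun n d (Φ : KXor.Formula (h + h + 1) n) => bound (inst Φ) d := by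
  classical
  have hn := Computes.var (C := taskCtx h) true
  have hd := Computes.var (C := taskCtx h) false
  obtain ⟨c, P, hP⟩ := exists_prog_best (h := h) (κ := 4 * h + 5) (C := taskCtx h)
    (n := fun q => q.1) (d := fun q => q.2.1)
    (base_of_size hn hd (fun _ => rfl) (fun _ hq => hq.1) fun _ hq => hq.2.1)
    (fun R => base_of_size (Computes.var (C := (taskCtx h).remem R) true)
      (Computes.var (C := (taskCtx h).remem R) false) (fun _ => rfl) (fun _ hq => hq.1.1)
      fun _ hq => hq.1.2.1) (fun _ hq => hq.2.2) le_rfl 2 (fun j : Bool => if j then 0 else 1)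
    fun j : Bool => by cases j <;> simp
  refine ⟨P, c, fun n d hn hd hdn Φ => ?_⟩
  obtain ⟨t, s, he, ht, h0, h1⟩ := hP ⟨n, d, Φ⟩ (KXor.inputState d Φ) ⟨hn, hd, hdn⟩ rfl fun j => by
    cases j <;> rfl
  -- The size of a task is n^d, so polynomial time in the size means n^(c d).
  refine ⟨t, s, he, ht.trans (le_of_eq ?_), ?_⟩
  · show (n ^ d) ^ c = _
    rw [← pow_mul, mul_comm]
  · change _ = bound (inst Φ) d
    have hiff : ∀ g, Certified (fun x => (KXor.inputState d Φ).mem (x % n ^ (h + h + 1))) n h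
        (n ^ (h + h + 1)) d (n ^ ((4 * h + 5) * d)) g = Certifiable (inst Φ) d g := fun g =>
      propext (certified_iff (inputState_mem_cd d Φ) d g)
    rw [State.output, h0, h1, bound, best]
    simp only [taskCtx, hiff]

theorem pow_lt_range {m d e : ℕ} (hn : 2 ≤ n) (hd : 1 ≤ d) (hm : m ≤ e) {x : ℕ} (hx : x < n ^ m) :
    x < n ^ (e * d) :=
  hx.trans_le (Nat.pow_le_pow_right (by omega) (by nlinarith))

theorem tendsto_prob_bound (h : ℕ) {γ : ℝ} (hγ : 0 < γ) {d : ℕ → ℕ} {p : ℕ → ℝ}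
    (hd : ∀ᶠ n in atTop, 1 ≤ d n) (hdn : ∀ᶠ n in atTop, d n ≤ n)
    (hp : ∀ᶠ n in atTop, 0 ≤ p n ∧ p n ≤ 1)
    (hD : ∀ᶠ n : ℕ in atTop, Real.log n ^ (5 * (h + 1) + 5) *
      ((n : ℝ) / d n) ^ (((2 * h + 1 : ℕ) : ℝ) / 2) ≤ p n * ((n : ℝ) ^ (h + 1)) ^ 2) :
    Tendsto (fun n => KXor.prob (p n)
      {Φ : KXor.Formula (h + 1 + (h + 1) + 1) n | (bound (inst Φ) (d n) : ℝ) ≤ 1 / 2 + γ})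
      atTop (𝓝 1) := by
  have hlog : Tendsto (fun n : ℕ => Real.log n) atTop atTop :=
    Real.tendsto_log_atTop.comp tendsto_natCast_atTop_atTop
  have hlow : Tendsto (fun n : ℕ => 1 - (4 / (n : ℝ) + (48 / (γ ^ 2 * Real.log n) +
      (1 / (n : ℝ) + 1 / n)))) atTop (𝓝 1) := by
    have h4 := tendsto_const_div_atTop_nhds_zero_nat (4 : ℝ)
    have h1 := tendsto_const_div_atTop_nhds_zero_nat (1 : ℝ)
    have h48 : Tendsto (fun n : ℕ => 48 / (γ ^ 2 * Real.log n)) atTop (𝓝 0) :=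
      tendsto_const_nhds.div_atTop (hlog.const_mul_atTop (by positivity))
    simpa using (h4.add (h48.add (h1.add h1))).const_sub 1
  refine tendsto_of_tendsto_of_tendsto_of_le_of_le' hlow tendsto_const_nhds ?_ ?_
  · filter_upwards [exists_params h hγ, hd, hdn, hp, hD, eventually_ge_atTop 2] with n hpar hd hdn hp
      hD hn
    obtain ⟨B, g, L, τ, θ, hB, hL, hτ, hθ, hg, hpr⟩ := hpar (d n) (p n) hd hdn hp.1 hp.2 hD
    rw [prob_eq_pr (p n) fun Ψ : Inst (Fin n) (Tup (h + 1) n) => (bound Ψ (d n) : ℝ) ≤ 1 / 2 + γ]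
    rw [pr_not] at hpr
    have hmono := pr_mono hp.1 hp.2 (E := fun Ψ : Inst (Fin n) (Tup (h + 1) n) =>
      Certifies Ψ g B L τ θ) (F := fun Ψ => (bound Ψ (d n) : ℝ) ≤ 1 / 2 + γ) fun Ψ hc => by
        refine bound_le (by omega) ⟨B - 1, by omega, L - 1, by omega, τ,
          pow_lt_range hn hd (by omega) hτ, θ, pow_lt_range hn hd (by omega) hθ, ?_⟩ hg
        rwa [Nat.sub_add_cancel hB.1, Nat.sub_add_cancel hL.1]
    linarith
  · filter_upwards [hp] with n hp
    rw [prob_eq_pr (p n) fun Ψ : Inst (Fin n) (Tup (h + 1) n) => (bound Ψ (d n) : ℝ) ≤ 1 / 2 + γ]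
    refine (pr_mono hp.1 hp.2 (F := fun _ => True) fun _ _ => trivial).trans (le_of_eq ?_)
    simp [pr, ex_const]

end algorithm

end Kikuchi

theorem mainTheorem10 (k : ℕ) (hk : Odd k) (hk3 : 3 ≤ k) :
    ∃ (A : Ram.Prog) (C : ℕ) (v : (n d : ℕ) → KXor.Formula k n → ℚ),
      KXor.ComputesInTime A C v ∧
      (∀ n d : ℕ, 2 ≤ n → 1 ≤ d → d ≤ n → ∀ (Φ : KXor.Formula k n) (x : Fin n → ℤˣ),
        KXor.satFraction Φ x ≤ (v n d Φ : ℝ)) ∧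
      ∀ γ : ℝ, 0 < γ → ∃ K : ℕ, ∀ (d : ℕ → ℕ) (p : ℕ → ℝ),
        (∀ᶠ n in atTop, 1 ≤ d n) →
        (fun n => (d n : ℝ)) =o[atTop] (fun n : ℕ => (n : ℝ)) →
        (∀ᶠ n in atTop, 0 ≤ p n ∧ p n ≤ 1) →
        (∀ᶠ n : ℕ in atTop,
          (K : ℝ) * Real.log n ^ K * ((n : ℝ) / (d n : ℝ)) ^ (((k : ℝ) - 2) / 2)
            ≤ p n * (n : ℝ) ^ (k - 1)) →
        Tendsto (fun n => KXor.prob (p n) {Φ : KXor.Formula k n | (v n (d n) Φ : ℝ) ≤ 1 / 2 + γ})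
          atTop (𝓝 1) := by
  obtain ⟨h, rfl⟩ : ∃ h, k = h + 1 + (h + 1) + 1 := by
    obtain ⟨m, rfl⟩ := hk
    exact ⟨m - 1, by omega⟩
  obtain ⟨A, C, hA⟩ := Kikuchi.exists_prog_bound (h + 1)
  -- The same K serves every γ, because γ only influences how large n has to be.
  refine ⟨A, C, _, hA, fun n d hn _ _ Φ x => Kikuchi.satFraction_le_bound (by omega) d Φ x,
    fun γ hγ => ⟨5 * (h + 1) + 5, fun d p hd hdn hp hD => ?_⟩⟩
  refine Kikuchi.tendsto_prob_bound h hγ hd ?_ hp ?_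
  · filter_upwards [hdn.bound one_pos] with n hn
    simpa using hn
  · filter_upwards [hD, eventually_ge_atTop 1] with n hn hn1
    have hlog : 0 ≤ Real.log n := Real.log_natCast_nonneg n
    have e1 : (((h + 1 + (h + 1) + 1 : ℕ) : ℝ) - 2) / 2 = ((2 * h + 1 : ℕ) : ℝ) / 2 := by
      push_cast; ring
    have e2 : (n : ℝ) ^ (h + 1 + (h + 1) + 1 - 1) = ((n : ℝ) ^ (h + 1)) ^ 2 := by
      rw [Nat.add_sub_cancel, ← two_mul, mul_comm, pow_mul]
    rw [e1, e2] at hn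
    refine le_trans ?_ hn
    rw [mul_assoc]
    exact le_mul_of_one_le_left (by positivity) (by push_cast; linarith [Nat.cast_nonneg (α := ℝ) h])
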